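/- All graphs are finite and simple. $P_m$ denotes the path on $m$ vertices ($P_0$ is empty), $tP_\ell$ the disjoint union of $t$ copies of $P_\ell$, $K_1\vee H$ the graph obtained from $H$ by adding a new vertex adjacent to all vertices of $H$, and $G$ is $F$-free if $F$ is not a (not necessarily induced) subgraph of $G$. A graph is outerplanar if it has a planar embedding in which all vertices lie on the boundary of the outer face. The $Q$-index $q(G)$ is the largest eigenvalue of $Q(G)=D(G)+A(G)$, where $D(G)$ is the diagonal matrix of vertex degrees and $A(G)$ is the adjacency matrix. **Theorem 2.** Let $t\ge 1$, let $n\ge t\ell$, and let $\mathcal{G}$ be the class of all connected outerplanar $tP_\ell$-free graphs of order $n$. (i) Suppose that $t=1$, $\ell\ge 4$ and, with $f=\lfloor\frac{\ell-3}{2}\rfloor$, $$n\ge \max\left\{f^2+f+\ell-1,\ 30f+30\sqrt{f(f+1)}\right\}.$$ Let $\alpha=\left\lfloor \frac{n-\ell+1}{\lfloor(\ell-2)/2\rfloor}\right\rfloor+1$, $r=n-\ell+1-(\alpha-1)\lfloor\frac{\ell-2}{2}\rfloor$ and $$G^*=K_1\vee \left(P_{\lceil\frac{\ell-2}{2}\rceil}\cup\alpha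 P_{\lfloor\frac{\ell-2}{2}\rfloor}\cup P_r\right).$$ Then $G^*\in\mathcal{G}$, and every $G\in\mathcal{G}$ satisfies $q(G)\le q(G^*)$, with equality if and only if $G\cong G^*$. (ii) Suppose that $t\ge 2$, $\ell\ge 2$ and $$n\ge \max\left\{\ell^2+(t-3)\ell+1,\ 30(\ell-2)+30\sqrt{(\ell-2)(\ell-1)}\right\}.$$ Let $\alpha=\left\lfloor \frac{n-t+1}{\ell-1}\right\rfloor-t+1$, $r=n-t\ell+1-(\alpha-1)(\ell-1)$ and $$G^*=K_1\vee \left(P_{t\ell-\ell-1}\cup\alpha P_{\ell-1}\cup P_r\right).$$ Then $G^*\in\mathcal{G}$, and every $G\in\mathcal{G}$ satisfies $q(G)\le q(G^*)$, with equality if and only if $G\cong G^*$. -/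

import Mathlib

namespace OuterplanarQ

/-! ### Outerplanar graphs -/

/-- The plane `ℝ²` (its topology and its bounded sets are the Euclidean ones). -/
abbrev Plane : Type := ℝ × ℝ

/-- The union of the segments `[c 0, c 1], …, [c (k - 1), c k]`. -/
def polyline (c : ℕ → Plane) (k : ℕ) : Set Plane :=
  ⋃ i ∈ Set.Iio k, segment ℝ (c i) (c (i + 1))

/-- `A` is a polygonal arc (a simple curve made of finitely many straight segments) with ends
`a` and `b`: the segments are non-degenerate, consecutive ones share only the bend point between
them, and non-consecutive ones are disjoint. -/
def IsPolygonalArc (A : Set Plane) (a b : Plane) : Prop :=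
  ∃ (c : ℕ → Plane) (k : ℕ), 0 < k ∧ c 0 = a ∧ c k = b ∧ A = polyline c k ∧
    (∀ i < k, c i ≠ c (i + 1)) ∧
    ∀ i j, i < j → j < k →
      ∀ x ∈ segment ℝ (c i) (c (i + 1)) ∩ segment ℝ (c j) (c (j + 1)), j = i + 1 ∧ x = c j

/-- A planar embedding of a graph: distinct points for the vertices, a polygonal arc for every edge
that joins its two ends and passes through no other vertex, and two different arcs meet at most in
common end vertices. (The values of `arc` at non-edges are irrelevant.) -/
structure PlanarEmbedding {V : Type*} (G : SimpleGraph V) where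
  pos : V → Plane
  arc : Sym2 V → Set Plane
  pos_injective : Function.Injective pos
  isPolygonalArc : ∀ u v, G.Adj u v → IsPolygonalArc (arc s(u, v)) (pos u) (pos v)
  mem_of_pos_mem_arc : ∀ e ∈ G.edgeSet, ∀ v, pos v ∈ arc e → v ∈ e
  arc_inter_arc : ∀ e ∈ G.edgeSet, ∀ f ∈ G.edgeSet, e ≠ f →
    ∀ x ∈ arc e ∩ arc f, ∃ v, v ∈ e ∧ v ∈ f ∧ x = pos v

/-- The set of all points of the drawing. -/
def PlanarEmbedding.support {V : Type*} {G : SimpleGraph V} (D : PlanarEmbedding G) : Set Plane :=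
  Set.range D.pos ∪ ⋃ e ∈ G.edgeSet, D.arc e

/-- `O` is the outer face: an unbounded connected component of the complement of the drawing. -/
def PlanarEmbedding.IsOuterFace {V : Type*} {G : SimpleGraph V} (D : PlanarEmbedding G)
    (O : Set Plane) : Prop :=
  (∃ x ∈ D.supportᶜ, O = connectedComponentIn D.supportᶜ x) ∧ ¬ Bornology.IsBounded O

/-- A (finite) graph is outerplanar if it has a planar embedding in which all vertices lie on the
boundary of the outer face. -/
def IsOuterplanar {V : Type*} (G : SimpleGraph V) : Prop :=
  ∃ (D : PlanarEmbedding G) (O : Set Plane), D.IsOuterFace O ∧ ∀ v, D.pos v ∈ frontier O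

/-! ### The `Q`-index -/

open Classical in
/-- The signless Laplacian matrix `Q(G) = D(G) + A(G)`. -/
noncomputable def signlessLaplacian {V : Type*} [Fintype V] (G : SimpleGraph V) : Matrix V V ℝ :=
  G.degMatrix ℝ + G.adjMatrix ℝ

/-- The `Q`-index `q(G)`: the largest eigenvalue of `Q(G)`. -/
noncomputable def qIndex {V : Type*} [Fintype V] (G : SimpleGraph V) : ℝ :=
  sSup {μ : ℝ | Module.End.HasEigenvalue (signlessLaplacian G).mulVecLin μ}

/-! ### Graph operations -/

/-- The disjoint union `tH` of `t` copies of `H`. -/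
def copies (t : ℕ) {W : Type*} (H : SimpleGraph W) : SimpleGraph (Fin t × W) where
  Adj x y := x.1 = y.1 ∧ H.Adj x.2 y.2
  symm := ⟨fun _ _ h => ⟨h.1.symm, h.2.symm⟩⟩
  loopless := ⟨fun _ h => H.irrefl h.2⟩

/-- The join `K₁ ∨ H`: a new vertex `none`, adjacent to all vertices of `H`. -/
def cone {W : Type*} (H : SimpleGraph W) : SimpleGraph (Option W) where
  Adj x y := x ≠ y ∧ ∀ a ∈ x, ∀ b ∈ y, H.Adj a b
  symm := ⟨fun _ _ h => ⟨h.1.symm, fun a ha b hb => (h.2 b hb a ha).symm⟩⟩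
  loopless := ⟨fun _ h => h.1 rfl⟩

open scoped SimpleGraph in
/-- The graph `K₁ ∨ (P_a ∪ α P_b ∪ P_r)`, where `P_m` is the path on `m` vertices. -/
def pathCone (a α b r : ℕ) :
    SimpleGraph (Option ((Fin a ⊕ Fin α × Fin b) ⊕ Fin r)) :=
  cone (SimpleGraph.pathGraph a ⊕g copies α (SimpleGraph.pathGraph b) ⊕g SimpleGraph.pathGraph r)

/-! ### The extremal problem -/

/-- `G` is a connected outerplanar graph of order `n` that does not contain the disjoint union
`tP_ℓ` of `t` paths on `ℓ` vertices as a (not necessarily induced) subgraph. -/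
structure Admissible (n t ℓ : ℕ) {V : Type*} [Fintype V] (G : SimpleGraph V) : Prop where
  card_eq : Fintype.card V = n
  connected : G.Connected
  outerplanar : IsOuterplanar G
  free : (copies t (SimpleGraph.pathGraph ℓ)).Free G

end OuterplanarQ

/-! The competitor `G` is compared with `G*` in two cases, according to whether some vertex is
adjacent to all others.

If there is such a vertex, outerplanarity makes `G` a cone over disjoint paths with `m i` vertices
(`IsOuterplanar.exists_iso_cone`). For these cones the eigenvector is explicit: writing the
eigenvalue as `t + 1/t + 3` and giving the apex the value 1, the entries on each path solve a linear
recurrence, and their total depends on the partition only through the sum of `pathWeight t (m i)`,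
which enters with a negative sign (`forestSum_eq`). So the `Q`-index is large when this sum is
small. The weight is strictly concave and vanishes at 0, hence a majorizing partition has the
smaller sum, with equality only for the same positive parts (`sum_pathWeight_lt`). Being `tP_ℓ`-free
bounds the parts (`sum_div_lt_of_free`, `mod_add_mod_of_free`): either the partition is majorized by
that of `G*`, or its parts are so small that the weight sum is larger by a direct estimate, which is
where the lower bounds on `n` are used (`weight_lt_or_iso_one_path`, `weight_lt_or_iso_many_paths`).

If there is no such vertex, take a nonnegative vector `y` with `q y ≤ Q y` and maximal entry 1 at
`u`. Since `K_{2,3}` is excluded, every other vertex has at most two neighbours in the neighbourhood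
of `u`, and the row inequalities force `q(G) < n` for `n ≥ 9` (`qIndex_lt_card`), whereas `q(G*) ≥
n` (`le_specVal`). Smaller orders occur only when `ℓ = 2` or when `t = 1`, `ℓ = 4`. In the latter
case and for `ℓ = t = 2` no competitor is left, since a connected graph without dominating vertex
contains a path on four vertices; otherwise sharper estimates are used.

The topological input is the exclusion of `K_{2,3}`, `K_4` and long thetas from outerplanar graphs.
It comes from angle functions of curves: two curves with common ends have angle functions differing
by `2π` times a winding number, which is 0 on the outer face, and three curves cannot all border the
region where the three functions agree, because an angle function jumps by `2π` across its own curve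
(`false_of_three_curves`). -/

open Set Filter Topology
namespace OuterplanarQ

/-! ### Angle functions of plane curves and the three-curve obstruction. -/

/-- The plane as the complex line. -/
noncomputable def toC : Plane ≃L[ℝ] ℂ := Complex.equivRealProdCLM.symm

/-- The angle under which the segment from `p` to `q` is seen from `x`. -/
noncomputable def segAngle (p q x : Plane) : ℝ :=
  ((toC q - toC x) / (toC p - toC x)).arg

/-- The quotient is a nonpositive real exactly when `x` lies between `p` and `q`, so the principal
argument is continuous off the segment. -/
theorem div_mem_slitPlane {p q x : Plane} (h : x ∉ segment ℝ p q) :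
    (toC q - toC x) / (toC p - toC x) ∈ Complex.slitPlane := by
  by_contra hz
  rw [Complex.mem_slitPlane_iff] at hz
  push Not at hz
  obtain ⟨hre, him⟩ := hz
  have hxp : toC p - toC x ≠ 0 := by
    intro h0
    have : p = x := toC.injective (sub_eq_zero.1 h0)
    exact h (this ▸ left_mem_segment ℝ p q)
  set z := (toC q - toC x) / (toC p - toC x) with hzdef
  have hz' : z = ((z.re : ℝ) : ℂ) := by
    apply Complex.ext <;> simp [him]
  have hq : toC q - toC x = z * (toC p - toC x) := by
    rw [hzdef]; field_simp
  rw [hz'] at hq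
  set s : ℝ := -z.re with hs
  have hs0 : 0 ≤ s := by simpa [hs] using hre
  apply h
  refine ⟨s / (1 + s), 1 / (1 + s), by positivity, by positivity, by field_simp; ring, ?_⟩
  apply toC.injective
  rw [map_add, map_smul, map_smul, Complex.real_smul, Complex.real_smul]
  have hzs : z.re = -s := by simp [hs]
  rw [hzs] at hq
  have h1s : (1 + (s : ℂ)) ≠ 0 := by
    have : (1 + s : ℝ) ≠ 0 := by positivity
    exact_mod_cast this
  push_cast at hq ⊢
  field_simp
  linear_combination hq

/-- `f` measures, for points off `A`, the angle through which a point travelling along the curve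
`A` from `a` to `b` turns. -/
structure IsIndex (A : Set Plane) (a b : Plane) (f : Plane → ℝ) : Prop where
  isClosed : IsClosed A
  left_mem : a ∈ A
  right_mem : b ∈ A
  cont : ContinuousOn f Aᶜ
  phase : ∀ x ∉ A, ∃ r : ℝ, 0 < r ∧
    toC b - toC x = r * Complex.exp (f x * Complex.I) * (toC a - toC x)
  far : Tendsto f (Bornology.cobounded Plane) (𝓝 0)

theorem isClosed_segment (p q : Plane) : IsClosed (segment ℝ p q) := by
  rw [← convexHull_pair]
  exact ((Set.toFinite {p, q}).isCompact_convexHull ℝ).isClosed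

theorem tendsto_toC_sub (p : Plane) :
    Tendsto (fun x => (toC p - toC x)⁻¹) (Bornology.cobounded Plane) (𝓝 0) := by
  refine tendsto_inv₀_cobounded.comp ?_
  have h1 : Tendsto toC (Bornology.cobounded Plane) (Bornology.cobounded ℂ) :=
    toC.antilipschitz.tendsto_cobounded
  rw [← tendsto_norm_atTop_iff_cobounded] at h1 ⊢
  refine tendsto_atTop_mono (f := fun x => ‖toC x‖ - ‖toC p‖) (fun x => ?_)
    (tendsto_atTop_add_const_right _ _ h1)
  rw [norm_sub_rev]
  exact norm_sub_norm_le _ _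

theorem isIndex_segment (p q : Plane) : IsIndex (segment ℝ p q) p q (segAngle p q) where
  isClosed := isClosed_segment p q
  left_mem := left_mem_segment ℝ p q
  right_mem := right_mem_segment ℝ p q
  cont := by
    intro x hx
    have hne : toC p - toC x ≠ 0 := fun h0 =>
      hx ((toC.injective (sub_eq_zero.1 h0)) ▸ left_mem_segment ℝ p q)
    apply ContinuousAt.continuousWithinAt
    apply ContinuousAt.comp (f := fun x => (toC q - toC x) / (toC p - toC x))
      (Complex.continuousAt_arg (div_mem_slitPlane hx))
    exact ContinuousAt.div (by fun_prop) (by fun_prop) hne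
  phase := by
    intro x hx
    have hne : toC p - toC x ≠ 0 := fun h0 =>
      hx ((toC.injective (sub_eq_zero.1 h0)) ▸ left_mem_segment ℝ p q)
    have hz := Complex.slitPlane_ne_zero (div_mem_slitPlane hx)
    refine ⟨‖(toC q - toC x) / (toC p - toC x)‖, norm_pos_iff.2 hz, ?_⟩
    rw [segAngle, Complex.norm_mul_exp_arg_mul_I]
    field_simp
  far := by
    have h1 : Tendsto (fun x => 1 + (toC q - toC p) * (toC p - toC x)⁻¹)
        (Bornology.cobounded Plane) (𝓝 1) := by
      simpa using ((tendsto_toC_sub p).const_mul (toC q - toC p)).const_add 1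
    have h2 : Tendsto (fun x => (1 + (toC q - toC p) * (toC p - toC x)⁻¹).arg)
        (Bornology.cobounded Plane) (𝓝 0) := by
      have := (Complex.continuousAt_arg Complex.one_mem_slitPlane).tendsto.comp h1
      rw [Complex.arg_one] at this
      exact this
    refine h2.congr' ?_
    have : ∀ᶠ x in Bornology.cobounded Plane, x ≠ p :=
      Bornology.eventually_ne_cobounded p
    filter_upwards [this] with x hx
    have hne : toC p - toC x ≠ 0 := fun h0 => hx (toC.injective (sub_eq_zero.1 h0)).symm
    rw [segAngle]
    congr 1
    field_simp
    ring

theorem IsIndex.add {A B : Set Plane} {a b c : Plane} {f g : Plane → ℝ}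
    (hf : IsIndex A a b f) (hg : IsIndex B b c g) :
    IsIndex (A ∪ B) a c (fun x => f x + g x) where
  isClosed := hf.isClosed.union hg.isClosed
  left_mem := Or.inl hf.left_mem
  right_mem := Or.inr hg.right_mem
  cont := (hf.cont.mono (compl_subset_compl.2 subset_union_left)).add
    (hg.cont.mono (compl_subset_compl.2 subset_union_right))
  phase := by
    intro x hx
    obtain ⟨r, hr, h1⟩ := hf.phase x (fun h => hx (Or.inl h))
    obtain ⟨s, hs, h2⟩ := hg.phase x (fun h => hx (Or.inr h))
    refine ⟨r * s, by positivity, ?_⟩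
    rw [h2, h1]
    push_cast
    rw [add_mul, Complex.exp_add]
    ring
  far := by simpa using hf.far.add hg.far

theorem IsIndex.neg {A : Set Plane} {a b : Plane} {f : Plane → ℝ}
    (hf : IsIndex A a b f) : IsIndex A b a (fun x => - f x) where
  isClosed := hf.isClosed
  left_mem := hf.right_mem
  right_mem := hf.left_mem
  cont := hf.cont.neg
  phase := by
    intro x hx
    obtain ⟨r, hr, h1⟩ := hf.phase x hx
    refine ⟨r⁻¹, by positivity, ?_⟩
    rw [h1]
    push_cast
    rw [neg_mul, Complex.exp_neg]
    have := Complex.exp_ne_zero (f x * Complex.I)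
    have hr' : (r : ℂ) ≠ 0 := by exact_mod_cast hr.ne'
    field_simp
  far := by simpa using hf.far.neg

/-- The integer is the winding number around `x` of the closed curve that follows `A` and returns
along `B`. Equating the two phase formulas gives equal moduli and then equal exponentials. -/
theorem IsIndex.exists_int {A B : Set Plane} {a b : Plane} {f g : Plane → ℝ}
    (hf : IsIndex A a b f) (hg : IsIndex B a b g) {x : Plane} (hA : x ∉ A) (hB : x ∉ B) :
    ∃ n : ℤ, f x - g x = n * (2 * Real.pi) := by
  obtain ⟨r, hr, h1⟩ := hf.phase x hA
  obtain ⟨s, hs, h2⟩ := hg.phase x hB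
  have hne : toC a - toC x ≠ 0 := fun h0 =>
    hA ((toC.injective (sub_eq_zero.1 h0)) ▸ hf.left_mem)
  rw [h1] at h2
  have h3 := mul_right_cancel₀ hne h2
  have h4 : r = s := by
    have := congrArg norm h3
    simpa [Complex.norm_exp_ofReal_mul_I, abs_of_pos hr, abs_of_pos hs] using this
  subst h4
  have hr' : (r : ℂ) ≠ 0 := by exact_mod_cast hr.ne'
  have h5 := mul_left_cancel₀ hr' h3
  obtain ⟨n, hn⟩ := Complex.exp_eq_exp_iff_exists_int.1 h5
  refine ⟨n, ?_⟩
  have h6 : ((f x : ℂ) - g x) * Complex.I = (n * (2 * Real.pi)) * Complex.I := by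
    linear_combination hn
  have h7 := mul_right_cancel₀ Complex.I_ne_zero h6
  exact_mod_cast h7

theorem eventually_eq_of_mem_int {α : Type*} [TopologicalSpace α] {s : Set α} {h : α → ℝ} {x : α}
    (hc : ContinuousWithinAt h s x)
    (hx : ∃ n : ℤ, h x = n * (2 * Real.pi))
    (hs : ∀ᶠ y in 𝓝[s] x, ∃ n : ℤ, h y = n * (2 * Real.pi)) : ∀ᶠ y in 𝓝[s] x, h y = h x := by
  have h1 : ∀ᶠ y in 𝓝[s] x, dist (h y) (h x) < 2 * Real.pi :=
    hc (Metric.ball_mem_nhds _ Real.two_pi_pos)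
  filter_upwards [h1, hs] with y hy ⟨n, hn⟩
  obtain ⟨m, hm⟩ := hx
  rw [Real.dist_eq, hn, hm, ← sub_mul, abs_mul, abs_of_pos Real.two_pi_pos] at hy
  have h2 : |((n - m : ℤ) : ℝ)| < 1 := by
    push_cast
    by_contra hcon
    push Not at hcon
    nlinarith [Real.two_pi_pos]
  have h3 : |n - m| < 1 := by exact_mod_cast h2
  have h4 : n = m := by
    have := Int.abs_lt_one_iff.1 h3
    omega
  rw [hn, hm, h4]

theorem eq_of_mem_int_of_isPreconnected {s : Set Plane} (hs : IsPreconnected s) {h : Plane → ℝ}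
    (hc : ContinuousOn h s) (hi : ∀ x ∈ s, ∃ n : ℤ, h x = n * (2 * Real.pi)) {x y : Plane}
    (hx : x ∈ s) (hy : y ∈ s) : h x = h y := by
  have hloc : ∀ z ∈ s, ∀ᶠ w in 𝓝[s] z, h w = h z := fun z hz =>
    eventually_eq_of_mem_int (hc z hz) (hi z hz) (by
      filter_upwards [self_mem_nhdsWithin] with w hw using hi w hw)
  exact hs.induction₂ (fun a b => h a = h b)
    (fun z hz => (hloc z hz).mono fun w hw => hw.symm)
    (fun _ _ _ _ _ _ h1 h2 => h1.trans h2) (fun _ _ _ _ h1 => h1.symm) hx hy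

/-- Along small circles around `a`, the function `f` jumps by `2π` at the only point on `A`. -/
def HasJump (A : Set Plane) (a : Plane) (f : Plane → ℝ) : Prop :=
  ∃ R₀ > 0, ∀ R, 0 < R → R < R₀ → ∃ γ : ℝ → Plane, Continuous γ ∧
    (∀ φ, ‖toC (γ φ) - toC a‖ = R) ∧
    (∀ x, ‖toC x - toC a‖ = R → ∃ φ ∈ Ico 0 (2 * Real.pi), γ φ = x) ∧
    γ (2 * Real.pi) = γ 0 ∧ γ 0 ∈ A ∧ (∀ φ ∈ Ioo 0 (2 * Real.pi), γ φ ∉ A) ∧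
    ∃ l : ℝ, Tendsto (fun φ => f (γ φ)) (𝓝[>] 0) (𝓝 (l + Real.pi)) ∧
      Tendsto (fun φ => f (γ φ)) (𝓝[<] (2 * Real.pi)) (𝓝 (l - Real.pi))

/-- On the circle `p + ρ w exp(iφ)` the quotient defining the angle is `1 - ρ⁻¹ exp(-iφ)`. For `ρ <
1` it approaches a negative real from above as `φ → 0+` and from below as `φ → 2π-`, so the argument
tends to `π` and to `-π`. -/
theorem hasJump_segment {p q : Plane} (hpq : p ≠ q) :
    HasJump (segment ℝ p q) p (segAngle p q) := by
  set w := toC q - toC p with hw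
  have hw0 : w ≠ 0 := fun h0 => hpq (toC.injective (sub_eq_zero.1 h0)).symm
  have hwn : 0 < ‖w‖ := norm_pos_iff.2 hw0
  refine ⟨‖w‖, hwn, fun R hR hRw => ?_⟩
  set ρ : ℝ := R / ‖w‖ with hρ
  have hρ0 : 0 < ρ := by positivity
  have hρ1 : ρ < 1 := by rw [hρ, div_lt_one hwn]; exact hRw
  have hρw : ρ * ‖w‖ = R := by rw [hρ]; field_simp
  have hρC : (ρ : ℂ) ≠ 0 := by exact_mod_cast hρ0.ne'
  set γ : ℝ → Plane := fun φ => toC.symm (toC p + ρ * w * Complex.exp (φ * Complex.I)) with hγ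
  have hγC : ∀ φ, toC (γ φ) = toC p + ρ * w * Complex.exp (φ * Complex.I) := fun φ => by
    simp [hγ]
  have hquot : ∀ φ : ℝ, (toC q - toC (γ φ)) / (toC p - toC (γ φ)) =
      1 - (ρ : ℂ)⁻¹ * Complex.exp (-(φ * Complex.I)) := by
    intro φ
    have he := Complex.exp_ne_zero (φ * Complex.I)
    rw [hγC, Complex.exp_neg]
    have h1 : toC q = w + toC p := by rw [hw]; ring
    rw [h1]
    have : toC p - (toC p + ρ * w * Complex.exp (φ * Complex.I)) ≠ 0 := by
      simp [hρC, hw0]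
    rw [div_eq_iff this]
    field_simp
    ring
  have hre : ∀ φ : ℝ, (1 - (ρ : ℂ)⁻¹ * Complex.exp (-(φ * Complex.I))) =
      ⟨1 - ρ⁻¹ * Real.cos φ, ρ⁻¹ * Real.sin φ⟩ := by
    intro φ
    have : -((φ : ℂ) * Complex.I) = ((-φ : ℝ) : ℂ) * Complex.I := by push_cast; ring
    rw [this, Complex.exp_mul_I, ← Complex.ofReal_cos, ← Complex.ofReal_sin, ← Complex.ofReal_inv]
    apply Complex.ext <;> simp [Complex.cos_ofReal_re, Complex.sin_ofReal_re]
  have hcont : Continuous fun φ : ℝ => (1 - (ρ : ℂ)⁻¹ * Complex.exp (-(φ * Complex.I))) := by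
    fun_prop
  have hneg : 1 - ρ⁻¹ < 0 := by
    have := one_lt_inv_iff₀.2 ⟨hρ0, hρ1⟩
    linarith
  refine ⟨γ, ?_, ?_, ?_, ?_, ?_, ?_, 0, ?_, ?_⟩
  · exact toC.symm.continuous.comp (by fun_prop)
  · intro φ
    rw [hγC, add_sub_cancel_left, norm_mul, norm_mul, Complex.norm_exp_ofReal_mul_I]
    simp [abs_of_pos hρ0, hρw]
  · intro x hx
    set z := (toC x - toC p) / w with hz
    have hzn : ‖z‖ = ρ := by rw [hz, norm_div, hx, hρ]
    have hz1 : z = ρ * Complex.exp (z.arg * Complex.I) := by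
      rw [← hzn, Complex.norm_mul_exp_arg_mul_I]
    have hxz : toC x = toC p + ρ * w * Complex.exp (z.arg * Complex.I) := by
      have : toC x = toC p + w * z := by rw [hz]; field_simp; ring
      rw [this, mul_comm (ρ : ℂ) w, mul_assoc, ← hz1]
    by_cases h0 : 0 ≤ z.arg
    · refine ⟨z.arg, ⟨h0, ?_⟩, toC.injective ?_⟩
      · linarith [Complex.arg_le_pi z, Real.pi_pos]
      · rw [hγC, hxz]
    · refine ⟨z.arg + 2 * Real.pi, ⟨?_, ?_⟩, toC.injective ?_⟩
      · linarith [Complex.neg_pi_lt_arg z, Real.pi_pos]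
      · linarith
      · rw [hγC, hxz]
        push_cast
        rw [add_mul, Complex.exp_add, Complex.exp_two_pi_mul_I, mul_one]
  · apply toC.injective
    rw [hγC, hγC]
    push_cast
    rw [Complex.exp_two_pi_mul_I]
    simp
  · refine ⟨1 - ρ, ρ, by linarith, hρ0.le, by ring, ?_⟩
    apply toC.injective
    rw [hγC, map_add, map_smul, map_smul, Complex.real_smul, Complex.real_smul, hw]
    push_cast
    simp
    ring
  · rintro φ ⟨h0, h2⟩ ⟨s, t, hs, ht, hst, h⟩
    have h3 := congrArg toC h
    rw [hγC, map_add, map_smul, map_smul, Complex.real_smul, Complex.real_smul] at h3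
    have h4 : w * t = w * (ρ * Complex.exp (φ * Complex.I)) := by
      have hs' : (s : ℂ) = 1 - t := by rw [eq_sub_iff_add_eq]; exact_mod_cast hst
      rw [hs'] at h3
      rw [hw] at h3 ⊢
      linear_combination h3
    have h5 := mul_left_cancel₀ hw0 h4
    have h6 : t = ρ := by
      have := congrArg norm h5
      simpa [Complex.norm_exp_ofReal_mul_I, abs_of_pos hρ0, abs_of_nonneg ht] using this
    rw [h6] at h5
    have h7 : Complex.exp (φ * Complex.I) = 1 := by
      have := mul_left_cancel₀ hρC (a := (ρ : ℂ)) (b := 1) (c := Complex.exp (φ * Complex.I))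
        (by rw [mul_one]; exact h5)
      exact this.symm
    have h8 : Real.cos φ = 1 := by
      have := congrArg Complex.re h7
      simpa [Complex.exp_ofReal_mul_I_re] using this
    have h9 := (Real.cos_eq_one_iff_of_lt_of_lt (x := φ - 2 * Real.pi)
      (by linarith) (by linarith [Real.pi_pos])).1 (by rw [Real.cos_sub_two_pi, h8])
    linarith
  · have h1 : Tendsto (fun φ : ℝ => (1 - (ρ : ℂ)⁻¹ * Complex.exp (-(φ * Complex.I)))) (𝓝[>] 0)
        (𝓝[{z | 0 ≤ z.im}] (⟨1 - ρ⁻¹, 0⟩ : ℂ)) := by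
      apply tendsto_nhdsWithin_of_tendsto_nhds_of_eventually_within
      · have := (hcont.tendsto 0).mono_left (nhdsWithin_le_nhds (s := Ioi (0:ℝ)))
        rw [hre 0] at this
        simpa using this
      · have : Ioo (0 : ℝ) Real.pi ∈ 𝓝[>] (0 : ℝ) := Ioo_mem_nhdsGT Real.pi_pos
        filter_upwards [this] with φ hφ
        rw [hre]
        have := Real.sin_pos_of_mem_Ioo hφ
        change 0 ≤ ρ⁻¹ * Real.sin φ
        positivity
    have h2 := (Complex.tendsto_arg_nhdsWithin_im_nonneg_of_re_neg_of_im_zero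
      (z := ⟨1 - ρ⁻¹, 0⟩) hneg rfl).comp h1
    rw [zero_add]
    refine h2.congr fun φ => ?_
    rw [segAngle, hquot]
    rfl
  · have h1 : Tendsto (fun φ : ℝ => (1 - (ρ : ℂ)⁻¹ * Complex.exp (-(φ * Complex.I))))
        (𝓝[<] (2 * Real.pi)) (𝓝[{z | z.im < 0}] (⟨1 - ρ⁻¹, 0⟩ : ℂ)) := by
      apply tendsto_nhdsWithin_of_tendsto_nhds_of_eventually_within
      · have := (hcont.tendsto (2 * Real.pi)).mono_left
          (nhdsWithin_le_nhds (s := Iio (2 * Real.pi)))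
        rw [hre (2 * Real.pi)] at this
        simpa using this
      · have : Ioo Real.pi (2 * Real.pi) ∈ 𝓝[<] (2 * Real.pi) :=
          Ioo_mem_nhdsLT (by linarith [Real.pi_pos])
        filter_upwards [this] with φ hφ
        rw [hre]
        have h3 : 0 < Real.sin (φ - Real.pi) :=
          Real.sin_pos_of_pos_of_lt_pi (by linarith [hφ.1]) (by linarith [hφ.2])
        rw [Real.sin_sub_pi] at h3
        change ρ⁻¹ * Real.sin φ < 0
        have : 0 < ρ⁻¹ := by positivity
        nlinarith
    have h2 := (Complex.tendsto_arg_nhdsWithin_im_neg_of_re_neg_of_im_zero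
      (z := ⟨1 - ρ⁻¹, 0⟩) hneg rfl).comp h1
    rw [zero_sub]
    refine h2.congr fun φ => ?_
    rw [segAngle, hquot]
    rfl

/-- Circles around `a` smaller than the distance to `B` see `g` as a continuous function, which only
shifts the two one-sided limits by the same amount. -/
theorem HasJump.add {A B : Set Plane} {a : Plane} {f g : Plane → ℝ} (hf : HasJump A a f)
    (hB : IsClosed B) (haB : a ∉ B) (hg : ContinuousOn g Bᶜ) :
    HasJump (A ∪ B) a (fun x => f x + g x) := by
  obtain ⟨R₀, hR₀, H⟩ := hf
  have hB' : IsClosed (toC '' B) := toC.toHomeomorph.isClosedMap B hB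
  have haB' : toC a ∉ toC '' B := by
    rintro ⟨b, hb, hab⟩
    exact haB (toC.injective hab ▸ hb)
  obtain ⟨R₁, hR₁, H₁⟩ := Metric.isOpen_iff.1 hB'.isOpen_compl (toC a) haB'
  refine ⟨min R₀ R₁, lt_min hR₀ hR₁, fun R hR hlt => ?_⟩
  obtain ⟨γ, hγ, hn, hs, h2, h0, hA, l, hl1, hl2⟩ := H R hR (hlt.trans_le (min_le_left _ _))
  have hγB : ∀ φ, γ φ ∉ B := fun φ hφ => by
    have : toC (γ φ) ∈ Metric.ball (toC a) R₁ := by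
      rw [Metric.mem_ball, dist_eq_norm, hn]
      exact hlt.trans_le (min_le_right _ _)
    exact H₁ this ⟨_, hφ, rfl⟩
  have hgc : ∀ φ, ContinuousAt (fun φ => g (γ φ)) φ := fun φ =>
    ContinuousAt.comp (hg.continuousAt (hB.isOpen_compl.mem_nhds (hγB φ))) hγ.continuousAt
  refine ⟨γ, hγ, hn, hs, h2, Or.inl h0, fun φ hφ h => h.elim (hA φ hφ) (hγB φ), l + g (γ 0), ?_, ?_⟩
  · have := hl1.add ((hgc 0).mono_left (nhdsWithin_le_nhds (s := Ioi (0 : ℝ))))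
    convert this using 2
    ring
  · have := hl2.add
      ((hgc (2 * Real.pi)).mono_left (nhdsWithin_le_nhds (s := Iio (2 * Real.pi))))
    convert this using 2
    simp only [h2]
    ring

theorem IsIndex.continuousAt {A : Set Plane} {a b x : Plane} {f : Plane → ℝ}
    (h : IsIndex A a b f) (hx : x ∉ A) : ContinuousAt f x :=
  h.cont.continuousAt (h.isClosed.isOpen_compl.mem_nhds hx)

theorem IsIndex.eventually_sub_eq {A B : Set Plane} {a b x : Plane} {f g : Plane → ℝ}
    (hf : IsIndex A a b f) (hg : IsIndex B a b g) (hA : x ∉ A) (hB : x ∉ B) :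
    ∀ᶠ y in 𝓝 x, f y - g y = f x - g x := by
  have h1 : ∀ᶠ y in 𝓝 x, y ∉ A := hf.isClosed.isOpen_compl.mem_nhds hA
  have h2 : ∀ᶠ y in 𝓝 x, y ∉ B := hg.isClosed.isOpen_compl.mem_nhds hB
  have := eventually_eq_of_mem_int (s := univ) (h := fun y => f y - g y) (x := x)
    ((hf.continuousAt hA).sub (hg.continuousAt hB)).continuousWithinAt
    (hf.exists_int hg hA hB) (by
      rw [nhdsWithin_univ]
      filter_upwards [h1, h2] with y hy1 hy2 using hf.exists_int hg hy1 hy2)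
  rwa [nhdsWithin_univ] at this

/-- Three curves with the same ends cannot all border the region in which the three indices
agree. -/
theorem false_of_three_curves {A₁ A₂ A₃ : Set Plane} {a b : Plane} {f₁ f₂ f₃ : Plane → ℝ}
    (hab : a ≠ b) (i₁ : IsIndex A₁ a b f₁) (i₂ : IsIndex A₂ a b f₂) (i₃ : IsIndex A₃ a b f₃)
    (hj : HasJump A₁ a f₁) (hc : IsPreconnected A₂)
    (h₁₂ : ∀ x ∈ A₁, x ∈ A₂ → x = a ∨ x = b) (h₁₃ : ∀ x ∈ A₁, x ∈ A₃ → x = a ∨ x = b)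
    (h₂₃ : ∀ x ∈ A₂, x ∈ A₃ → x = a ∨ x = b)
    (e₁ : ∀ x ∈ A₁, x ≠ a → x ≠ b → f₂ x = f₃ x) (e₂ : ∀ x ∈ A₂, x ≠ a → x ≠ b → f₁ x = f₃ x)
    (e₃ : ∀ x ∈ A₃, x ≠ a → x ≠ b → f₁ x = f₂ x) : False := by
  obtain ⟨R₀, hR₀, H⟩ := hj
  have hd : 0 < ‖toC b - toC a‖ :=
    norm_pos_iff.2 fun h => hab (toC.injective (sub_eq_zero.1 h)).symm
  obtain ⟨R, hR, hRlt⟩ := exists_between (lt_min hR₀ hd)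
  obtain ⟨γ, hγ, hn, hs, h2, h0, hA, l, hl1, hl2⟩ := H R hR (hRlt.trans_le (min_le_left _ _))
  have hRb : R < ‖toC b - toC a‖ := hRlt.trans_le (min_le_right _ _)
  have hγa : ∀ φ, γ φ ≠ a := fun φ h => by
    have := hn φ
    rw [h, sub_self, norm_zero] at this
    exact hR.ne this
  have hγb : ∀ φ, γ φ ≠ b := fun φ h => by
    have := hn φ
    rw [h] at this
    exact hRb.ne' this
  have h02 : γ 0 ∉ A₂ := fun h => (h₁₂ _ h0 h).elim (hγa 0) (hγb 0)
  have h03 : γ 0 ∉ A₃ := fun h => (h₁₃ _ h0 h).elim (hγa 0) (hγb 0)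
  -- `P` describes the region separated from the common one by `A₁` alone. Away from the three
  -- curves all differences of indices are locally constant; at a point of `A₂` (of `A₃`) the
  -- equality `f₁ = f₃` (`f₁ = f₂`) persists nearby and makes `P` false there. So `P` is constant on
  -- the punctured circle.
  set P : ℝ → Prop := fun φ => γ φ ∉ A₂ ∧ γ φ ∉ A₃ ∧ f₂ (γ φ) = f₃ (γ φ) ∧ f₁ (γ φ) ≠ f₃ (γ φ)
    with hP
  have hloc : ∀ φ ∈ Ioo 0 (2 * Real.pi), ∀ᶠ ψ in 𝓝 φ, (P ψ ↔ P φ) := by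
    intro φ hφ
    have y1 := hA φ hφ
    by_cases y2 : γ φ ∈ A₂
    · have y3 : γ φ ∉ A₃ := fun h => (h₂₃ _ y2 h).elim (hγa φ) (hγb φ)
      have := hγ.continuousAt.eventually (i₁.eventually_sub_eq i₃ y1 y3)
      filter_upwards [this] with ψ hψ
      rw [e₂ _ y2 (hγa φ) (hγb φ), sub_self, sub_eq_zero] at hψ
      simp [hP, hψ, y2]
    by_cases y3 : γ φ ∈ A₃
    · have := hγ.continuousAt.eventually (i₁.eventually_sub_eq i₂ y1 y2)
      filter_upwards [this] with ψ hψ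
      rw [e₃ _ y3 (hγa φ) (hγb φ), sub_self, sub_eq_zero] at hψ
      simp only [hP, y3, not_true_eq_false, false_and, and_false, iff_false]
      rintro ⟨-, -, h23, h13⟩
      exact h13 (hψ.trans h23)
    · have k1 := hγ.continuousAt.eventually (i₁.eventually_sub_eq i₃ y1 y3)
      have k2 := hγ.continuousAt.eventually (i₂.eventually_sub_eq i₃ y2 y3)
      have k3 := hγ.continuousAt.eventually (i₂.isClosed.isOpen_compl.mem_nhds y2)
      have k4 := hγ.continuousAt.eventually (i₃.isClosed.isOpen_compl.mem_nhds y3)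
      filter_upwards [k1, k2, k3, k4] with ψ j1 j2 j3 j4
      have j3' : γ ψ ∉ A₂ := j3
      have j4' : γ ψ ∉ A₃ := j4
      simp only [hP, y2, y3, j3', j4', not_false_eq_true, true_and]
      rw [← sub_eq_zero, j2, sub_eq_zero, ← sub_ne_zero, j1, sub_ne_zero]
  have hconst : ∀ φ ∈ Ioo 0 (2 * Real.pi), ∀ ψ ∈ Ioo 0 (2 * Real.pi), (P φ ↔ P ψ) := by
    intro φ hφ ψ hψ
    exact isPreconnected_Ioo.induction₂ (fun s t => (P s ↔ P t))
      (fun s hs => by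
        refine nhdsWithin_le_nhds ?_
        filter_upwards [hloc s hs] with t ht using ht.symm)
      (fun _ _ _ _ _ _ h1 h2 => h1.trans h2) (fun _ _ _ _ h1 => h1.symm) hφ hψ
  -- The connected set `A₂` leads from the centre `a` to `b` outside the circle, hence meets the
  -- circle, and `P` fails on `A₂`.
  have hnot : ∀ φ ∈ Ioo 0 (2 * Real.pi), ¬ P φ := by
    have hmem : R ∈ Icc ‖toC a - toC a‖ ‖toC b - toC a‖ := by
      rw [sub_self, norm_zero]
      exact ⟨hR.le, hRb.le⟩
    obtain ⟨y, hy, hyR⟩ := hc.intermediate_value (f := fun x => ‖toC x - toC a‖) i₂.left_mem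
      i₂.right_mem (by fun_prop) hmem
    obtain ⟨φ, hφ, rfl⟩ := hs y hyR
    have hφ0 : φ ≠ 0 := by
      rintro rfl
      exact h02 hy
    have hφ' : φ ∈ Ioo 0 (2 * Real.pi) := ⟨lt_of_le_of_ne hφ.1 hφ0.symm, hφ.2⟩
    intro ψ hψ h
    exact ((hconst ψ hψ φ hφ').1 h).1 hy
  have hnear : ∀ᶠ y in 𝓝 (γ 0), y ∉ A₂ ∧ y ∉ A₃ ∧ f₂ y = f₃ y := by
    filter_upwards [i₂.isClosed.isOpen_compl.mem_nhds h02, i₃.isClosed.isOpen_compl.mem_nhds h03,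
      i₂.eventually_sub_eq i₃ h02 h03] with y hy1 hy2 hy3
    rw [e₁ _ h0 (hγa 0) (hγb 0), sub_self, sub_eq_zero] at hy3
    exact ⟨hy1, hy2, hy3⟩
  have hf3 : ContinuousAt f₃ (γ 0) := i₃.continuousAt h03
  have hpi := Real.two_pi_pos
  -- Near `γ 0 ∈ A₁` one has `f₂ = f₃`, so the failure of `P` forces `f₁ = f₃` on both sides of
  -- `A₁`. As `f₃` is continuous there, this contradicts the jump of `f₁`.
  have k1 : Tendsto (fun φ => f₁ (γ φ)) (𝓝[>] 0) (𝓝 (f₃ (γ 0))) := by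
    have : Tendsto (fun φ => f₃ (γ φ)) (𝓝[>] 0) (𝓝 (f₃ (γ 0))) :=
      hf3.tendsto.comp (hγ.continuousAt.tendsto.mono_left nhdsWithin_le_nhds)
    refine this.congr' ?_
    have hn1 : ∀ᶠ φ in 𝓝[>] (0 : ℝ), _ :=
      (hγ.continuousAt.tendsto.mono_left nhdsWithin_le_nhds).eventually hnear
    filter_upwards [hn1, Ioo_mem_nhdsGT hpi] with φ h hφ
    by_contra hne
    exact hnot φ hφ ⟨h.1, h.2.1, h.2.2, Ne.symm hne⟩
  have k2 : Tendsto (fun φ => f₁ (γ φ)) (𝓝[<] (2 * Real.pi)) (𝓝 (f₃ (γ 0))) := by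
    have hg2 : Tendsto γ (𝓝[<] (2 * Real.pi)) (𝓝 (γ 0)) := by
      rw [← h2]
      exact hγ.continuousAt.tendsto.mono_left nhdsWithin_le_nhds
    have : Tendsto (fun φ => f₃ (γ φ)) (𝓝[<] (2 * Real.pi)) (𝓝 (f₃ (γ 0))) :=
      hf3.tendsto.comp hg2
    refine this.congr' ?_
    filter_upwards [hg2.eventually hnear, Ioo_mem_nhdsLT hpi] with φ h hφ
    by_contra hne
    exact hnot φ hφ ⟨h.1, h.2.1, h.2.2, Ne.symm hne⟩
  have q1 := tendsto_nhds_unique k1 hl1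
  have q2 := tendsto_nhds_unique k2 hl2
  linarith [Real.pi_pos]

end OuterplanarQ

/-! ### Polygonal arcs, outer drawings, and the exclusion of thetas and `K_4`. -/

namespace OuterplanarQ

theorem polyline_succ (c : ℕ → Plane) (k : ℕ) :
    polyline c (k + 1) = polyline c k ∪ segment ℝ (c k) (c (k + 1)) := by
  ext x
  simp only [polyline, mem_iUnion, mem_Iio, mem_union, exists_prop]
  constructor
  · rintro ⟨i, hi, hx⟩
    rcases Nat.lt_succ_iff_lt_or_eq.1 hi with h | rfl
    · exact Or.inl ⟨i, h, hx⟩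
    · exact Or.inr hx
  · rintro (⟨i, hi, hx⟩ | hx)
    · exact ⟨i, by omega, hx⟩
    · exact ⟨k, by omega, hx⟩

theorem polyline_succ' (c : ℕ → Plane) (k : ℕ) :
    polyline c (k + 1) = segment ℝ (c 0) (c 1) ∪ polyline (fun i => c (i + 1)) k := by
  ext x
  simp only [polyline, mem_iUnion, mem_Iio, mem_union, exists_prop]
  constructor
  · rintro ⟨i, hi, hx⟩
    rcases i with _ | i
    · exact Or.inl hx
    · exact Or.inr ⟨i, by omega, hx⟩
  · rintro (hx | ⟨i, hi, hx⟩)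
    · exact ⟨0, by omega, hx⟩
    · exact ⟨i + 1, by omega, hx⟩

theorem polyline_one (c : ℕ → Plane) : polyline c 1 = segment ℝ (c 0) (c 1) := by
  rw [polyline_succ]
  simp [polyline]

theorem exists_isIndex_polyline (c : ℕ → Plane) (k : ℕ) :
    ∃ f, IsIndex (polyline c (k + 1)) (c 0) (c (k + 1)) f := by
  induction k with
  | zero => exact ⟨_, by rw [polyline_one]; exact isIndex_segment _ _⟩
  | succ k ih =>
    obtain ⟨f, hf⟩ := ih
    exact ⟨_, by rw [polyline_succ]; exact hf.add (isIndex_segment _ _)⟩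

theorem isPreconnected_polyline (c : ℕ → Plane) (k : ℕ) :
    IsPreconnected (polyline c (k + 1)) := by
  induction k with
  | zero => rw [polyline_one]; exact (convex_segment _ _).isPreconnected
  | succ k ih =>
    rw [polyline_succ]
    refine ih.union (c (k + 1)) ?_ (left_mem_segment ℝ _ _) (convex_segment _ _).isPreconnected
    rw [polyline_succ]
    exact Or.inr (right_mem_segment ℝ _ _)

theorem isPreconnected_segment_diff (p q : Plane) : IsPreconnected (segment ℝ p q \ {q}) := by
  rcases eq_or_ne p q with rfl | h
  · simp [isPreconnected_empty]
  have : segment ℝ p q \ {q} = AffineMap.lineMap p q '' Ico (0 : ℝ) 1 := by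
    rw [segment_eq_image_lineMap]
    ext x
    constructor
    · rintro ⟨⟨t, ht, rfl⟩, hx⟩
      refine ⟨t, ⟨ht.1, lt_of_le_of_ne ht.2 ?_⟩, rfl⟩
      rintro rfl
      simp at hx
    · rintro ⟨t, ht, rfl⟩
      refine ⟨⟨t, ⟨ht.1, ht.2.le⟩, rfl⟩, ?_⟩
      intro hx
      have : AffineMap.lineMap p q t = AffineMap.lineMap p q (1 : ℝ) := by simpa using hx
      exact ht.2.ne (AffineMap.lineMap_injective ℝ h this)
  rw [this]
  exact isPreconnected_Ico.image _ (AffineMap.lineMap_continuous).continuousOn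

/-- One end has to be removable because, for an edge of one curve, that end may lie on the other two
curves, where their indices say nothing. -/
theorem IsPolygonalArc.isPreconnected_diff {A : Set Plane} {a b : Plane}
    (h : IsPolygonalArc A a b) : IsPreconnected (A \ {b}) := by
  obtain ⟨c, k, hk, rfl, rfl, rfl, hne, hd⟩ := h
  obtain ⟨k, rfl⟩ : ∃ l, k = l + 1 := ⟨k - 1, by omega⟩
  rcases k with _ | k
  · rw [polyline_one]; exact isPreconnected_segment_diff _ _
  have hb : c (k + 2) ∉ polyline c (k + 1) := by
    intro hx
    simp only [polyline, mem_iUnion, mem_Iio, exists_prop] at hx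
    obtain ⟨i, hi, hx⟩ := hx
    have := (hd i (k + 1) (by omega) (by omega) _ ⟨hx, right_mem_segment ℝ _ _⟩).2
    exact hne (k + 1) (by omega) this.symm
  rw [polyline_succ, union_sdiff_distrib, sdiff_singleton_eq_self hb]
  refine (isPreconnected_polyline c k).union (c (k + 1)) ?_ ⟨left_mem_segment ℝ _ _, ?_⟩
    (isPreconnected_segment_diff _ _)
  · rw [polyline_succ]
    exact Or.inr (right_mem_segment ℝ _ _)
  · exact hne (k + 1) (by omega)

theorem IsPolygonalArc.isPreconnected {A : Set Plane} {a b : Plane}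
    (h : IsPolygonalArc A a b) : IsPreconnected A := by
  obtain ⟨c, k, hk, rfl, rfl, rfl, hne, hd⟩ := h
  obtain ⟨k, rfl⟩ : ∃ l, k = l + 1 := ⟨k - 1, by omega⟩
  exact isPreconnected_polyline c k

/-- The angles of the segments add up. The jump comes from the first segment, since a simple arc
never returns to its start. -/
theorem IsPolygonalArc.exists_isIndex {A : Set Plane} {a b : Plane}
    (h : IsPolygonalArc A a b) : ∃ f, IsIndex A a b f ∧ HasJump A a f := by
  obtain ⟨c, k, hk, rfl, rfl, rfl, hne, hd⟩ := h
  obtain ⟨k, rfl⟩ : ∃ l, k = l + 1 := ⟨k - 1, by omega⟩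
  rcases k with _ | k
  · rw [polyline_one]
    exact ⟨_, isIndex_segment _ _, hasJump_segment (hne 0 (by omega))⟩
  obtain ⟨g, hg⟩ := exists_isIndex_polyline (fun i => c (i + 1)) k
  rw [polyline_succ']
  refine ⟨_, (isIndex_segment _ _).add hg,
    (hasJump_segment (hne 0 (by omega))).add hg.isClosed ?_ hg.cont⟩
  intro hx
  simp only [polyline, mem_iUnion, mem_Iio, exists_prop] at hx
  obtain ⟨i, hi, hx⟩ := hx
  have := hd 0 (i + 1) (by omega) (by omega) _ ⟨left_mem_segment ℝ _ _, hx⟩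
  exact hne 0 (by omega) (by rw [this.2, this.1])

variable {V : Type*} {G : SimpleGraph V}

theorem PlanarEmbedding.arc_subset_support (D : PlanarEmbedding G) {e : Sym2 V}
    (he : e ∈ G.edgeSet) : D.arc e ⊆ D.support := fun _ hx =>
  Or.inr (mem_biUnion he hx)

/-- On the connected set `O` the difference is a constant multiple of `2π`; as `O` is unbounded and
both indices vanish at infinity, the constant is 0. Local constancy carries this to points of the
closure that avoid both curves. -/
theorem IsIndex.eq_of_outer {D : PlanarEmbedding G} {O : Set Plane} (hO : D.IsOuterFace O)
    {A B : Set Plane} {a b p : Plane} {f g : Plane → ℝ} (hf : IsIndex A a b f)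
    (hg : IsIndex B a b g) (hA : A ⊆ D.support) (hB : B ⊆ D.support) (hp : p ∈ closure O)
    (hpA : p ∉ A) (hpB : p ∉ B) : f p = g p := by
  obtain ⟨⟨x, hx, rfl⟩, hunb⟩ := hO
  set O := connectedComponentIn D.supportᶜ x
  have hsub : O ⊆ D.supportᶜ := connectedComponentIn_subset _ _
  have hOA : ∀ y ∈ O, y ∉ A := fun y hy h => hsub hy (hA h)
  have hOB : ∀ y ∈ O, y ∉ B := fun y hy h => hsub hy (hB h)
  have hfar : ∀ᶠ y in Bornology.cobounded Plane, |f y - g y| < 2 * Real.pi := by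
    have := (hf.far.sub hg.far).abs
    simp only [sub_zero, abs_zero] at this
    exact this.eventually (gt_mem_nhds Real.two_pi_pos)
  obtain ⟨y, hyO, hy⟩ : ∃ y ∈ O, |f y - g y| < 2 * Real.pi := by
    by_contra hcon
    push Not at hcon
    apply hunb
    rw [Bornology.isBounded_def]
    filter_upwards [hfar] with y hy hyO
    exact absurd hy (not_lt.2 (hcon y hyO))
  have hy0 : f y - g y = 0 := by
    obtain ⟨n, hn⟩ := hf.exists_int hg (hOA y hyO) (hOB y hyO)
    rw [hn, abs_mul, abs_of_pos Real.two_pi_pos] at hy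
    have h1 : |(n : ℝ)| < 1 := by
      by_contra h
      push Not at h
      nlinarith [Real.two_pi_pos]
    have h2 : |n| < 1 := by exact_mod_cast h1
    rw [hn, Int.abs_lt_one_iff.1 h2]
    simp
  have hall : ∀ z ∈ O, f z - g z = 0 := by
    intro z hz
    rw [← hy0]
    exact eq_of_mem_int_of_isPreconnected isPreconnected_connectedComponentIn (h := fun z => f z - g z)
      (((hf.cont.mono hOA).sub (hg.cont.mono hOB)))
      (fun w hw => hf.exists_int hg (hOA w hw) (hOB w hw)) hz hyO
  have hev := hf.eventually_sub_eq hg hpA hpB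
  obtain ⟨z, hz1, hz2⟩ := mem_closure_iff_nhds.1 hp _ hev
  have : f z - g z = f p - g p := hz1
  rw [hall z hz2] at this
  linarith

/-- A planar drawing all of whose vertices are in the closure of the outer face. -/
structure IsOuterDrawing (D : PlanarEmbedding G) (O : Set Plane) : Prop where
  isOuterFace : D.IsOuterFace O
  mem_closure : ∀ v, D.pos v ∈ closure O

/-- The end `t` touches the outer face, so the indices agree there, and the difference is constant
along the arc without its end `s`. -/
theorem IsIndex.eq_on_arc {D : PlanarEmbedding G} {O : Set Plane} (hO : IsOuterDrawing D O)
    {A B : Set Plane} {a b : Plane} {f g : Plane → ℝ} (hf : IsIndex A a b f)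
    (hg : IsIndex B a b g) (hA : A ⊆ D.support) (hB : B ⊆ D.support) {s t : V} (hst : G.Adj s t)
    (hd : ∀ x ∈ D.arc s(s, t), x ≠ D.pos s → x ∉ A ∧ x ∉ B) {z : Plane}
    (hz : z ∈ D.arc s(s, t)) (hzs : z ≠ D.pos s) : f z = g z := by
  have harc : IsPolygonalArc (D.arc s(s, t)) (D.pos t) (D.pos s) := by
    rw [Sym2.eq_swap]; exact D.isPolygonalArc t s hst.symm
  obtain ⟨_, hi, -⟩ := harc.exists_isIndex
  have hts : D.pos t ≠ D.pos s := fun h => hst.ne' (D.pos_injective h)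
  have ht := hi.left_mem
  have hsub : ∀ x ∈ D.arc s(s, t) \ {D.pos s}, x ∉ A ∧ x ∉ B := fun x hx => hd x hx.1 hx.2
  have h1 := hf.eq_of_outer hO.isOuterFace hg hA hB (hO.mem_closure t) (hd _ ht hts).1
    (hd _ ht hts).2
  have := eq_of_mem_int_of_isPreconnected harc.isPreconnected_diff (h := fun z => f z - g z)
      (((hf.cont.mono fun x hx => (hsub x hx).1).sub (hg.cont.mono fun x hx => (hsub x hx).2)))
      (fun w hw => hf.exists_int hg (hsub w hw).1 (hsub w hw).2) (x := z) (y := D.pos t)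
      ⟨hz, hzs⟩ ⟨ht, hts⟩
  linarith

/-- The part of the drawing that belongs to a walk. -/
def walkSet (D : PlanarEmbedding G) {a b : V} (w : G.Walk a b) : Set Plane :=
  {x | ∃ e ∈ w.edges, x ∈ D.arc e}

theorem walkSet_cons (D : PlanarEmbedding G) {a b c : V} (h : G.Adj a b) (w : G.Walk b c) :
    walkSet D (.cons h w) = D.arc s(a, b) ∪ walkSet D w := by
  ext x
  simp [walkSet]

theorem walkSet_nil (D : PlanarEmbedding G) (a : V) :
    walkSet D (.nil : G.Walk a a) = ∅ := by
  ext x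
  simp [walkSet]

theorem walkSet_subset (D : PlanarEmbedding G) {a b : V} (w : G.Walk a b) :
    walkSet D w ⊆ D.support := fun _ ⟨_, he, hx⟩ =>
  D.arc_subset_support (w.edges_subset_edgeSet he) hx

theorem mem_support_of_pos_mem {D : PlanarEmbedding G} {a b v : V} {w : G.Walk a b}
    (h : D.pos v ∈ walkSet D w) : v ∈ w.support := by
  obtain ⟨e, he, hx⟩ := h
  have hv := D.mem_of_pos_mem_arc e (w.edges_subset_edgeSet he) v hx
  exact w.mem_support_of_mem_edges he hv

theorem exists_isIndex_walkSet (D : PlanarEmbedding G) {a b c : V} (h : G.Adj a b)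
    (w : G.Walk b c) :
    (∃ f, IsIndex (walkSet D (.cons h w)) (D.pos a) (D.pos c) f) ∧
      IsPreconnected (walkSet D (.cons h w)) := by
  induction w generalizing a with
  | nil =>
    rw [walkSet_cons, walkSet_nil, union_empty]
    obtain ⟨f, hf, -⟩ := (D.isPolygonalArc _ _ h).exists_isIndex
    exact ⟨⟨f, hf⟩, (D.isPolygonalArc _ _ h).isPreconnected⟩
  | cons h' w ih =>
    obtain ⟨⟨g, hg⟩, hc⟩ := ih h'
    rw [walkSet_cons]
    obtain ⟨f, hf, -⟩ := (D.isPolygonalArc _ _ h).exists_isIndex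
    exact ⟨⟨_, hf.add hg⟩, (D.isPolygonalArc _ _ h).isPreconnected.union _ hf.right_mem
      hg.left_mem hc⟩

theorem exists_isIndex_hasJump_walkSet (D : PlanarEmbedding G) {a b : V} (hab : a ≠ b)
    (w : G.Walk a b) (hw : w.IsPath) :
    ∃ f, IsIndex (walkSet D w) (D.pos a) (D.pos b) f ∧ HasJump (walkSet D w) (D.pos a) f := by
  cases w with
  | nil => exact absurd rfl hab
  | cons h w =>
    rw [SimpleGraph.Walk.cons_isPath_iff] at hw
    obtain ⟨f, hf, hj⟩ := (D.isPolygonalArc _ _ h).exists_isIndex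
    cases w with
    | nil =>
      rw [walkSet_cons, walkSet_nil, union_empty]
      exact ⟨f, hf, hj⟩
    | cons h' w =>
      obtain ⟨⟨g, hg⟩, -⟩ := exists_isIndex_walkSet D h' w
      rw [walkSet_cons]
      exact ⟨_, hf.add hg, hj.add hg.isClosed (fun hx => hw.2 (mem_support_of_pos_mem hx)) hg.cont⟩

theorem edge_ends {a b s t : V} (hst : s ≠ t) (hs : s = a ∨ s = b) (ht : t = a ∨ t = b) :
    s(s, t) = s(a, b) := by
  rcases hs with rfl | rfl <;> rcases ht with rfl | rfl
  · exact absurd rfl hst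
  · rfl
  · exact Sym2.eq_swap
  · exact absurd rfl hst

theorem walkSet_inter {D : PlanarEmbedding G} {a b : V} {w w' : G.Walk a b}
    (hd : ∀ v ∈ w.support, v ∈ w'.support → v = a ∨ v = b) (he : s(a, b) ∉ w.edges)
    {x : Plane} (hx : x ∈ walkSet D w) (hx' : x ∈ walkSet D w') :
    x = D.pos a ∨ x = D.pos b := by
  obtain ⟨e, hew, hxe⟩ := hx
  obtain ⟨e', hew', hxe'⟩ := hx'
  by_cases hee : e = e'
  · subst hee
    induction e using Sym2.ind with
    | _ s t =>
      have hst : G.Adj s t := w.edges_subset_edgeSet hew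
      have := edge_ends hst.ne
        (hd s (w.fst_mem_support_of_mem_edges hew) (w'.fst_mem_support_of_mem_edges hew'))
        (hd t (w.snd_mem_support_of_mem_edges hew) (w'.snd_mem_support_of_mem_edges hew'))
      exact absurd (this ▸ hew) he
  · obtain ⟨v, hv, hv', rfl⟩ := D.arc_inter_arc e (w.edges_subset_edgeSet hew) e'
      (w'.edges_subset_edgeSet hew') hee x ⟨hxe, hxe'⟩
    rcases hd v (w.mem_support_of_mem_edges hew hv) (w'.mem_support_of_mem_edges hew' hv') with
      rfl | rfl
    · exact Or.inl rfl
    · exact Or.inr rfl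

/-- As the edge `ab` is not used, each edge of `w` has an end different from `a` and `b`. That
vertex is off the other two curves, and agreement spreads from it along the edge. -/
theorem index_eq_on_walkSet {D : PlanarEmbedding G} {O : Set Plane} (hO : IsOuterDrawing D O)
    {a b : V} {w w' w'' : G.Walk a b}
    (hd' : ∀ v ∈ w.support, v ∈ w'.support → v = a ∨ v = b)
    (hd'' : ∀ v ∈ w.support, v ∈ w''.support → v = a ∨ v = b) (he : s(a, b) ∉ w.edges)
    {f g : Plane → ℝ} (hf : IsIndex (walkSet D w') (D.pos a) (D.pos b) f)
    (hg : IsIndex (walkSet D w'') (D.pos a) (D.pos b) g) {z : Plane} (hz : z ∈ walkSet D w)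
    (hza : z ≠ D.pos a) (hzb : z ≠ D.pos b) : f z = g z := by
  obtain ⟨e, hew, hze⟩ := hz
  have key : ∀ s t, s(s, t) ∈ w.edges → z ∈ D.arc s(s, t) → ¬ (t = a ∨ t = b) → f z = g z := by
    intro s t hew hze ht
    have hst : G.Adj s t := w.edges_subset_edgeSet hew
    have hs' := w.fst_mem_support_of_mem_edges hew
    have ht' := w.snd_mem_support_of_mem_edges hew
    by_cases hzs : z = D.pos s
    · subst hzs
      have hs : ¬ (s = a ∨ s = b) := by
        rintro (rfl | rfl)
        · exact hza rfl
        · exact hzb rfl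
      exact hf.eq_of_outer hO.isOuterFace hg (walkSet_subset _ _) (walkSet_subset _ _)
        (hO.mem_closure s) (fun h => hs (hd' s hs' (mem_support_of_pos_mem h)))
        (fun h => hs (hd'' s hs' (mem_support_of_pos_mem h)))
    · have aux : ∀ {u : G.Walk a b}, (∀ v ∈ w.support, v ∈ u.support → v = a ∨ v = b) →
          ∀ x ∈ D.arc s(s, t), x ≠ D.pos s → x ∉ walkSet D u := by
        rintro u hu x hx hxs ⟨e', he', hxe'⟩
        by_cases hee : s(s, t) = e'
        · subst hee
          exact ht (hu t ht' (u.snd_mem_support_of_mem_edges he'))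
        · obtain ⟨v, hv, hv', rfl⟩ := D.arc_inter_arc _ (w.edges_subset_edgeSet hew) e'
            (u.edges_subset_edgeSet he') hee x ⟨hx, hxe'⟩
          rcases Sym2.mem_iff.1 hv with rfl | rfl
          · exact hxs rfl
          · exact ht (hu v ht' (u.mem_support_of_mem_edges he' hv'))
      exact hf.eq_on_arc hO hg (walkSet_subset _ _) (walkSet_subset _ _) hst
        (fun x hx hxs => ⟨aux hd' x hx hxs, aux hd'' x hx hxs⟩) hze hzs
  induction e using Sym2.ind with
  | _ s t =>
    have hst : G.Adj s t := w.edges_subset_edgeSet hew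
    by_cases ht : t = a ∨ t = b
    · by_cases hs : s = a ∨ s = b
      · exact absurd (edge_ends hst.ne hs ht ▸ hew) he
      · rw [Sym2.eq_swap] at hew hze
        exact key t s hew hze hs
    · exact key s t hew hze ht

/-- An outerplanar graph has no three internally disjoint walks between two vertices, each of
which passes through a third vertex. -/
theorem IsOuterplanar.no_theta (h : IsOuterplanar G) {a b : V} (hab : a ≠ b)
    (w₁ w₂ w₃ : G.Walk a b) (hp : w₁.IsPath)
    (h₁₂ : ∀ v ∈ w₁.support, v ∈ w₂.support → v = a ∨ v = b)
    (h₁₃ : ∀ v ∈ w₁.support, v ∈ w₃.support → v = a ∨ v = b)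
    (h₂₃ : ∀ v ∈ w₂.support, v ∈ w₃.support → v = a ∨ v = b)
    (e₁ : s(a, b) ∉ w₁.edges) (e₂ : s(a, b) ∉ w₂.edges) (e₃ : s(a, b) ∉ w₃.edges) : False := by
  obtain ⟨D, O, hO, hfr⟩ := h
  have hOD : IsOuterDrawing D O := ⟨hO, fun v => frontier_subset_closure (hfr v)⟩
  obtain ⟨f₁, i₁, hj⟩ := exists_isIndex_hasJump_walkSet D hab w₁ hp
  have hw : ∀ w : G.Walk a b, (∃ f, IsIndex (walkSet D w) (D.pos a) (D.pos b) f) ∧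
      IsPreconnected (walkSet D w) := by
    intro w
    cases w with
    | nil => exact absurd rfl hab
    | cons h w => exact exists_isIndex_walkSet D h w
  obtain ⟨⟨f₂, i₂⟩, hc⟩ := hw w₂
  obtain ⟨⟨f₃, i₃⟩, -⟩ := hw w₃
  exact false_of_three_curves (fun h => hab (D.pos_injective h)) i₁ i₂ i₃ hj hc
    (fun x hx hx' => walkSet_inter h₁₂ e₁ hx hx') (fun x hx hx' => walkSet_inter h₁₃ e₁ hx hx')
    (fun x hx hx' => walkSet_inter h₂₃ e₂ hx hx')
    (fun x hx ha hb => index_eq_on_walkSet hOD h₁₂ h₁₃ e₁ i₂ i₃ hx ha hb)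
    (fun x hx ha hb => index_eq_on_walkSet hOD (fun v h h' => h₁₂ v h' h) h₂₃ e₂ i₁ i₃ hx ha hb)
    (fun x hx ha hb => index_eq_on_walkSet hOD (fun v h h' => h₁₃ v h' h)
      (fun v h h' => h₂₃ v h' h) e₃ i₁ i₂ hx ha hb)

theorem PlanarEmbedding.arc_comm (D : PlanarEmbedding G) (p q : V) :
    D.arc s(p, q) = D.arc s(q, p) := by rw [Sym2.eq_swap]

theorem PlanarEmbedding.eq_of_mem_arcs (D : PlanarEmbedding G) {p q s : V} {x : Plane}
    (hpq : G.Adj p q) (hps : G.Adj p s) (hqs : q ≠ s) (hx : x ∈ D.arc s(p, q))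
    (hx' : x ∈ D.arc s(p, s)) : x = D.pos p := by
  obtain ⟨v, hv, hv', rfl⟩ := D.arc_inter_arc s(p, q) hpq s(p, s) hps
    (by simp [hqs, hps.ne]) x ⟨hx, hx'⟩
  rcases Sym2.mem_iff.1 hv with rfl | rfl
  · rfl
  · rcases Sym2.mem_iff.1 hv' with rfl | rfl
    · rfl
    · exact absurd rfl hqs

theorem PlanarEmbedding.not_mem_arc (D : PlanarEmbedding G) {p q r s : V} {x : Plane}
    (hpq : G.Adj p q) (hrs : G.Adj r s) (hpr : p ≠ r) (hps : p ≠ s) (hqr : q ≠ r) (hqs : q ≠ s)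
    (hx : x ∈ D.arc s(p, q)) : x ∉ D.arc s(r, s) := by
  intro hx'
  obtain ⟨v, hv, hv', rfl⟩ := D.arc_inter_arc s(p, q) hpq s(r, s) hrs
    (by simp [hpr, hps]) x ⟨hx, hx'⟩
  rcases Sym2.mem_iff.1 hv with rfl | rfl <;> rcases Sym2.mem_iff.1 hv' with rfl | rfl
  · exact hpr rfl
  · exact hps rfl
  · exact hqr rfl
  · exact hqs rfl

/-- An outerplanar graph does not contain `K₄`. -/
theorem IsOuterplanar.no_K4 (h : IsOuterplanar G) {a b c d : V} (hab : G.Adj a b)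
    (hac : G.Adj a c) (had : G.Adj a d) (hbc : G.Adj b c) (hbd : G.Adj b d) (hcd : G.Adj c d) :
    False := by
  obtain ⟨D, O, hO, hfr⟩ := h
  have hOD : IsOuterDrawing D O := ⟨hO, fun v => frontier_subset_closure (hfr v)⟩
  obtain ⟨fab, iab, -⟩ := (D.isPolygonalArc _ _ hab).exists_isIndex
  obtain ⟨fca, ica, -⟩ := (D.isPolygonalArc _ _ hac.symm).exists_isIndex
  obtain ⟨fda, ida, -⟩ := (D.isPolygonalArc _ _ had.symm).exists_isIndex
  obtain ⟨fcb, icb, -⟩ := (D.isPolygonalArc _ _ hbc.symm).exists_isIndex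
  obtain ⟨fdb, idb, -⟩ := (D.isPolygonalArc _ _ hbd.symm).exists_isIndex
  obtain ⟨fdc, idc, jdc⟩ := (D.isPolygonalArc _ _ hcd.symm).exists_isIndex
  have nab := hab.ne
  have nac := hac.ne
  have nad := had.ne
  have nbc := hbc.ne
  have nbd := hbd.ne
  have ncd := hcd.ne
  have sub : ∀ {p q : V}, G.Adj p q → D.arc s(p, q) ⊆ D.support := fun h =>
    D.arc_subset_support h
  -- The edge `cd` has no inner vertex from which agreement could spread. Instead the edge `ab` is
  -- compared with the path `a c b` starting from `d`, and with the path `a d b` starting from `c`;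
  -- rearranged, the two results say that the paths `d a c` and `d b c` have the same index on the
  -- arc `cd`.
  have k1 : ∀ x ∈ D.arc s(d, c), x ≠ D.pos c → x ≠ D.pos d →
      - fca x + fcb x = - fda x + fdb x := by
    intro x hx hxc hxd
    have t1 : fab x = - fca x + fcb x := by
      refine iab.eq_on_arc hOD (ica.neg.add icb) (sub hab)
        (union_subset (sub hac.symm) (sub hbc.symm)) (s := c) (t := d) hcd ?_
        (by rw [D.arc_comm]; exact hx) hxc
      intro y hy hyc
      refine ⟨D.not_mem_arc hcd hab nac.symm nbc.symm nad.symm nbd.symm hy, ?_⟩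
      rintro (h | h)
      · exact hyc (D.eq_of_mem_arcs hcd hac.symm nad.symm hy h)
      · exact hyc (D.eq_of_mem_arcs hcd hbc.symm nbd.symm hy h)
    have t2 : fab x = - fda x + fdb x := by
      refine iab.eq_on_arc hOD (ida.neg.add idb) (sub hab)
        (union_subset (sub had.symm) (sub hbd.symm)) (s := d) (t := c) hcd.symm ?_ hx hxd
      intro y hy hyd
      refine ⟨D.not_mem_arc hcd.symm hab nad.symm nbd.symm nac.symm nbc.symm hy, ?_⟩
      rintro (h | h)
      · exact hyd (D.eq_of_mem_arcs hcd.symm had.symm nac.symm hy h)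
      · exact hyd (D.eq_of_mem_arcs hcd.symm hbd.symm nbc.symm hy h)
    linarith
  have path : ∀ {z : V} {f g : Plane → ℝ}, G.Adj d z → G.Adj c z →
      IsIndex (D.arc s(d, z)) (D.pos d) (D.pos z) f →
      IsIndex (D.arc s(c, z)) (D.pos c) (D.pos z) g →
      IsIndex (D.arc s(d, z) ∪ D.arc s(c, z)) (D.pos d) (D.pos c) (fun x => f x + -g x) :=
    fun _ _ hf hg => hf.add hg.neg
  have agree : ∀ {z z' : V} {f : Plane → ℝ} (_ : z ≠ z') (_ : G.Adj d z) (_ : G.Adj c z)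
      (_ : G.Adj d z') (_ : G.Adj c z'),
      IsIndex (D.arc s(d, z') ∪ D.arc s(c, z')) (D.pos d) (D.pos c) f →
      ∀ x ∈ D.arc s(d, z) ∪ D.arc s(c, z), x ≠ D.pos d → x ≠ D.pos c → fdc x = f x := by
    intro z z' f hzz hdz hcz hdz' hcz' hf x hx hxd hxc
    have cov := union_subset (sub hdz') (sub hcz')
    rcases hx with hx | hx
    · refine idc.eq_on_arc hOD hf (sub hcd.symm) cov hdz (fun y hy hyd => ⟨fun h => ?_, ?_⟩) hx hxd
      · exact hyd (D.eq_of_mem_arcs hdz hcd.symm hcz.ne' hy h)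
      · rintro (h | h)
        · exact hyd (D.eq_of_mem_arcs hdz hdz' hzz hy h)
        · exact D.not_mem_arc hdz hcz' ncd.symm hdz'.ne hcz.ne' hzz hy h
    · refine idc.eq_on_arc hOD hf (sub hcd.symm) cov hcz (fun y hy hyc => ⟨fun h => ?_, ?_⟩) hx hxc
      · rw [D.arc_comm] at h
        exact hyc (D.eq_of_mem_arcs hcz hcd hdz.ne' hy h)
      · rintro (h | h)
        · exact D.not_mem_arc hcz hdz' ncd hcz'.ne hdz.ne' hzz hy h
        · exact hyc (D.eq_of_mem_arcs hcz hcz' hzz hy h)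
  have meet : ∀ {z : V}, G.Adj d z → G.Adj c z → ∀ x ∈ D.arc s(d, c),
      x ∈ D.arc s(d, z) ∪ D.arc s(c, z) → x = D.pos d ∨ x = D.pos c := by
    rintro z hdz hcz x hx (h | h)
    · exact Or.inl (D.eq_of_mem_arcs hcd.symm hdz hcz.ne hx h)
    · rw [D.arc_comm] at hx
      exact Or.inr (D.eq_of_mem_arcs hcd hcz hdz.ne hx h)
  have i2 := path had.symm hac.symm ida ica
  have i3 := path hbd.symm hbc.symm idb icb
  have hconn : IsPreconnected (D.arc s(d, a) ∪ D.arc s(c, a)) :=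
    (D.isPolygonalArc _ _ had.symm).isPreconnected.union (D.pos a) ida.right_mem ica.right_mem
      (D.isPolygonalArc _ _ hac.symm).isPreconnected
  refine false_of_three_curves (fun h => ncd.symm (D.pos_injective h)) idc i2 i3 jdc hconn
    (meet had.symm hac.symm) (meet hbd.symm hbc.symm) ?_ ?_
    (agree nab had.symm hac.symm hbd.symm hbc.symm i3)
    (agree nab.symm hbd.symm hbc.symm had.symm hac.symm i2)
  · rintro x (hx | hx) (hx' | hx')
    · exact Or.inl (D.eq_of_mem_arcs had.symm hbd.symm nab hx hx')
    · exact absurd hx' (D.not_mem_arc had.symm hbc.symm ncd.symm nbd.symm nac nab hx)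
    · exact absurd hx' (D.not_mem_arc hac.symm hbd.symm ncd nbc.symm nad nab hx)
    · exact Or.inr (D.eq_of_mem_arcs hac.symm hbc.symm nab hx hx')
  · intro x hx hxd hxc
    have := k1 x hx hxc hxd
    linarith

end OuterplanarQ

/-! ### A straight-line outerplanar drawing of a cone over paths. -/

namespace OuterplanarQ

section Drawing

variable {W : Type*} {H : SimpleGraph W} (g : W → ℕ)

/-- The apex is placed at the origin, the other vertices on the line of height one. -/
def conePos : Option W → Plane
  | none => (0, 0)
  | some w => ((g w : ℝ), 1)

/-- The straight segment that represents an edge of the cone. -/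
def coneArc (e : Sym2 (Option W)) : Set Plane :=
  Sym2.lift ⟨fun u v => segment ℝ (conePos g u) (conePos g v), fun _ _ => segment_symm ℝ _ _⟩ e

theorem coneArc_mk (u v : Option W) :
    coneArc g s(u, v) = segment ℝ (conePos g u) (conePos g v) := rfl

theorem mem_coneArc_spoke {w : W} {x : Plane} :
    x ∈ coneArc g s(none, some w) ↔ 0 ≤ x.2 ∧ x.2 ≤ 1 ∧ x.1 = x.2 * g w := by
  rw [coneArc_mk]
  constructor
  · rintro ⟨s, t, hs, ht, hst, rfl⟩
    simp [conePos, ht]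
    linarith
  · rintro ⟨h0, h1, h⟩
    exact ⟨1 - x.2, x.2, by linarith, h0, by ring, by ext <;> simp [conePos, h]⟩

theorem mem_coneArc_path {w w' : W} (hw : g w + 1 = g w') {x : Plane} :
    x ∈ coneArc g s(some w, some w') ↔ x.2 = 1 ∧ (g w : ℝ) ≤ x.1 ∧ x.1 ≤ g w + 1 := by
  have hw' : (g w' : ℝ) = g w + 1 := by rw [← hw]; push_cast; ring
  rw [coneArc_mk]
  constructor
  · rintro ⟨s, t, hs, ht, hst, rfl⟩
    simp [conePos, hst, hw']
    constructor <;> nlinarith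
  · rintro ⟨h0, h1, h⟩
    refine ⟨1 - (x.1 - g w), x.1 - g w, by linarith, by linarith, by ring, ?_⟩
    ext
    · simp [conePos, hw']; ring
    · simp [conePos, h0]

variable {g}

theorem conePos_injective (hg : Function.Injective g) : Function.Injective (conePos g) := by
  rintro (_ | u) (_ | v) h
  · rfl
  · simp [conePos] at h
  · simp [conePos] at h
  · simp [conePos] at h
    rw [hg h]

theorem isPolygonalArc_segment {p q : Plane} (h : p ≠ q) :
    IsPolygonalArc (segment ℝ p q) p q := by
  refine ⟨fun i => if i = 0 then p else q, 1, one_pos, by simp, by simp, ?_, ?_, ?_⟩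
  · rw [polyline_one]; simp
  · intro i hi
    obtain rfl : i = 0 := by omega
    simpa using h
  · intro i j hij hj
    omega

/-- The edges of a cone over a graph whose vertices are numbered along its paths. -/
theorem cone_edge_cases (hadj : ∀ u v, H.Adj u v → g u + 1 = g v ∨ g v + 1 = g u)
    {e : Sym2 (Option W)} (he : e ∈ (cone H).edgeSet) :
    (∃ w, e = s(none, some w)) ∨ ∃ w w', g w + 1 = g w' ∧ e = s(some w, some w') := by
  induction e using Sym2.ind with
  | _ u v =>
    have h : (cone H).Adj u v := he
    rcases u with _ | u <;> rcases v with _ | v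
    · exact absurd rfl h.1
    · exact Or.inl ⟨v, rfl⟩
    · exact Or.inl ⟨u, Sym2.eq_swap⟩
    · rcases hadj u v (h.2 u rfl v rfl) with h | h
      · exact Or.inr ⟨u, v, h, rfl⟩
      · exact Or.inr ⟨v, u, h, Sym2.eq_swap⟩

theorem mem_of_conePos_mem (hg : Function.Injective g)
    (hadj : ∀ u v, H.Adj u v → g u + 1 = g v ∨ g v + 1 = g u)
    {e : Sym2 (Option W)} (he : e ∈ (cone H).edgeSet) {v : Option W}
    (hv : conePos g v ∈ coneArc g e) : v ∈ e := by
  rcases cone_edge_cases hadj he with ⟨w, rfl⟩ | ⟨w, w', hw, rfl⟩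
  · rw [mem_coneArc_spoke] at hv
    rcases v with _ | v
    · simp
    · simp only [conePos, one_mul] at hv
      have : g v = g w := by exact_mod_cast hv.2.2
      simp [hg this]
  · rw [mem_coneArc_path g hw] at hv
    rcases v with _ | v
    · simp [conePos] at hv
    · simp only [conePos] at hv
      have h1 : g w ≤ g v := by exact_mod_cast hv.2.1
      have h2 : g v ≤ g w + 1 := by exact_mod_cast hv.2.2
      rcases Nat.lt_or_ge (g w) (g v) with h | h
      · have : g v = g w' := by omega
        simp [hg this]
      · have : g v = g w := by omega
        simp [hg this]

theorem coneArc_inter (hg : Function.Injective g)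
    (hadj : ∀ u v, H.Adj u v → g u + 1 = g v ∨ g v + 1 = g u)
    {e f : Sym2 (Option W)} (he : e ∈ (cone H).edgeSet) (hf : f ∈ (cone H).edgeSet) (hne : e ≠ f)
    {x : Plane} (hxe : x ∈ coneArc g e) (hxf : x ∈ coneArc g f) :
    ∃ v, x = conePos g v := by
  rcases cone_edge_cases hadj he with ⟨w, rfl⟩ | ⟨w, w', hw, rfl⟩ <;>
    rcases cone_edge_cases hadj hf with ⟨z, rfl⟩ | ⟨z, z', hz, rfl⟩
  · rw [mem_coneArc_spoke] at hxe hxf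
    have hwz : (g w : ℝ) ≠ g z := fun h => by
      have h' : w = z := hg (by exact_mod_cast h)
      exact hne (by rw [h'])
    have h1 : x.2 * ((g w : ℝ) - g z) = 0 := by linarith [hxe.2.2, hxf.2.2]
    have h2 : x.2 = 0 := (mul_eq_zero.1 h1).resolve_right (sub_ne_zero.2 hwz)
    exact ⟨none, Prod.ext (by simp [conePos, hxe.2.2, h2]) (by simp [conePos, h2])⟩
  · rw [mem_coneArc_spoke] at hxe
    rw [mem_coneArc_path g hz] at hxf
    exact ⟨some w, Prod.ext (by simp [conePos, hxe.2.2, hxf.1]) (by simp [conePos, hxf.1])⟩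
  · rw [mem_coneArc_spoke] at hxf
    rw [mem_coneArc_path g hw] at hxe
    exact ⟨some z, Prod.ext (by simp [conePos, hxf.2.2, hxe.1]) (by simp [conePos, hxe.1])⟩
  · rw [mem_coneArc_path g hz] at hxf
    rw [mem_coneArc_path g hw] at hxe
    have hwz : g w ≠ g z := by
      intro h
      apply hne
      have h' : g w' = g z' := by omega
      rw [hg h, hg h']
    rcases Nat.lt_or_gt_of_ne hwz with h | h
    · refine ⟨some z, Prod.ext ?_ (by simp [conePos, hxe.1])⟩
      have : (g w : ℝ) + 1 ≤ g z := by exact_mod_cast h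
      simp only [conePos]
      linarith [hxe.2.2, hxf.2.1]
    · refine ⟨some w, Prod.ext ?_ (by simp [conePos, hxe.1])⟩
      have : (g z : ℝ) + 1 ≤ g w := by exact_mod_cast h
      simp only [conePos]
      linarith [hxf.2.2, hxe.2.1]

/-- The straight-line drawing of a cone over a union of paths. -/
def coneEmbedding (hg : Function.Injective g)
    (hadj : ∀ u v, H.Adj u v → g u + 1 = g v ∨ g v + 1 = g u) : PlanarEmbedding (cone H) where
  pos := conePos g
  arc := coneArc g
  pos_injective := conePos_injective hg
  isPolygonalArc u v h := isPolygonalArc_segment fun h' => h.ne (conePos_injective hg h')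
  mem_of_pos_mem_arc _ he _ hv := mem_of_conePos_mem hg hadj he hv
  arc_inter_arc e he f hf hne x hx := by
    obtain ⟨v, rfl⟩ := coneArc_inter hg hadj he hf hne hx.1 hx.2
    exact ⟨v, mem_of_conePos_mem hg hadj he hx.1, mem_of_conePos_mem hg hadj hf hx.2, rfl⟩

theorem isOuterplanar_cone (hg : Function.Injective g)
    (hadj : ∀ u v, H.Adj u v → g u + 1 = g v ∨ g v + 1 = g u) : IsOuterplanar (cone H) := by
  set D := coneEmbedding hg hadj with hD
  have hbox : ∀ x ∈ D.support, 0 ≤ x.1 ∧ 0 ≤ x.2 ∧ x.2 ≤ 1 := by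
    rintro x (⟨v, rfl⟩ | hx)
    · rcases v with _ | v <;> simp [hD, coneEmbedding, conePos]
    · simp only [mem_iUnion, exists_prop] at hx
      obtain ⟨e, he, hx⟩ := hx
      change x ∈ coneArc g e at hx
      rcases cone_edge_cases hadj he with ⟨w, rfl⟩ | ⟨w, w', hw, rfl⟩
      · rw [mem_coneArc_spoke] at hx
        refine ⟨?_, hx.1, hx.2.1⟩
        rw [hx.2.2]
        have := hx.1
        positivity
      · rw [mem_coneArc_path g hw] at hx
        have : (0 : ℝ) ≤ g w := by positivity
        exact ⟨by linarith [hx.2.1], by linarith [hx.1], hx.1.le⟩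
  -- Three overlapping half-planes that miss the drawing: the apex is a limit of points to its left,
  -- and the other vertices are limits of points above them.
  set C : Set Plane := ({x | x.1 < 0} ∪ {x | x.2 < 0}) ∪ {x | 1 < x.2} with hC
  have hlin1 : IsLinearMap ℝ fun x : Plane => x.1 := (LinearMap.fst ℝ ℝ ℝ).isLinear
  have hlin2 : IsLinearMap ℝ fun x : Plane => x.2 := (LinearMap.snd ℝ ℝ ℝ).isLinear
  have hCpre : IsPreconnected C := by
    refine IsPreconnected.union (-1, 2) (Or.inl (by simp)) (by simp) ?_
      (convex_halfSpace_gt hlin2 1).isPreconnected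
    exact IsPreconnected.union (-1, -1) (by simp) (by simp)
      (convex_halfSpace_lt hlin1 0).isPreconnected (convex_halfSpace_lt hlin2 0).isPreconnected
  have hCsub : C ⊆ D.supportᶜ := by
    intro x hx hs
    have := hbox x hs
    rcases hx with (hx | hx) | hx
    · exact not_lt.2 this.1 hx
    · exact not_lt.2 this.2.1 hx
    · exact not_lt.2 this.2.2 hx
  have hx0 : ((-1, -1) : Plane) ∈ C := Or.inl (Or.inl (by simp))
  have hCO : C ⊆ connectedComponentIn D.supportᶜ (-1, -1) :=
    hCpre.subset_connectedComponentIn hx0 hCsub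
  refine ⟨D, _, ⟨⟨_, hCsub hx0, rfl⟩, ?_⟩, ?_⟩
  · intro hb
    obtain ⟨r, hr⟩ := (hb.subset hCO).exists_norm_le
    have := hr ((-(|r| + 1), 0) : Plane) (Or.inl (Or.inl (by
      change -(|r| + 1) < 0
      have := abs_nonneg r
      linarith)))
    have h2 : ‖(-(|r| + 1) : ℝ)‖ ≤ r := le_trans (norm_fst_le (-(|r| + 1), (0 : ℝ))) this
    rw [norm_neg, Real.norm_eq_abs, abs_of_nonneg (by positivity)] at h2
    linarith [le_abs_self r]
  · intro v
    refine ⟨closure_mono hCO ?_, fun h => ?_⟩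
    · rcases v with _ | v
      · have h1 : Tendsto (fun t : ℝ => ((t, 0) : Plane)) (𝓝[<] 0) (𝓝 (0, 0)) :=
          ((by fun_prop : Continuous fun t : ℝ => ((t, 0) : Plane)).tendsto 0).mono_left
            nhdsWithin_le_nhds
        refine mem_closure_of_tendsto h1 ?_
        filter_upwards [self_mem_nhdsWithin] with t ht using Or.inl (Or.inl ht)
      · have h1 : Tendsto (fun t : ℝ => ((g v, t) : Plane)) (𝓝[>] 1) (𝓝 (g v, 1)) :=
          ((by fun_prop : Continuous fun t : ℝ => ((g v, t) : Plane)).tendsto 1).mono_left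
            nhdsWithin_le_nhds
        refine mem_closure_of_tendsto h1 ?_
        filter_upwards [self_mem_nhdsWithin] with t ht using Or.inr ht
    · exact connectedComponentIn_subset _ _ (interior_subset h) (Or.inl ⟨v, rfl⟩)

end Drawing

/-- The disjoint union of paths with `m i` vertices. -/
def pathForest {ι : Type*} (m : ι → ℕ) : SimpleGraph (Σ i, Fin (m i)) where
  Adj x y := x.1 = y.1 ∧ (x.2.val + 1 = y.2.val ∨ y.2.val + 1 = x.2.val)
  symm := ⟨fun _ _ h => ⟨h.1.symm, h.2.symm⟩⟩
  loopless := ⟨fun _ h => by have := h.2; omega⟩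

/-- The cone over an isomorphic graph. -/
def coneIso {W W' : Type*} {H : SimpleGraph W} {H' : SimpleGraph W'} (e : H ≃g H') :
    cone H ≃g cone H' where
  toEquiv := Equiv.optionCongr e.toEquiv
  map_rel_iff' := by
    rintro (_ | u) (_ | v)
    · simp [cone]
    · simp [cone]
    · simp [cone]
    · simp only [cone, Equiv.optionCongr_apply, Option.map_some, Option.mem_def, Option.some.injEq,
        forall_eq', ne_eq]
      exact and_congr (not_congr e.injective.eq_iff) e.map_adj_iff

/-- The number of vertices of the paths of the extremal graph. -/
def extremalParts (a α b r : ℕ) : (Unit ⊕ Fin α) ⊕ Unit → ℕ :=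
  Sum.elim (Sum.elim (fun _ => a) fun _ => b) fun _ => r

/-- The vertices of the forest in the extremal graph. -/
def extremalForestEquiv (a α b r : ℕ) :
    (Fin a ⊕ Fin α × Fin b) ⊕ Fin r ≃ Σ i, Fin (extremalParts a α b r i) where
  toFun x := match x with
    | Sum.inl (Sum.inl k) => ⟨Sum.inl (Sum.inl ()), k⟩
    | Sum.inl (Sum.inr (i, k)) => ⟨Sum.inl (Sum.inr i), k⟩
    | Sum.inr k => ⟨Sum.inr (), k⟩
  invFun x := match x with
    | ⟨Sum.inl (Sum.inl _), k⟩ => Sum.inl (Sum.inl k)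
    | ⟨Sum.inl (Sum.inr i), k⟩ => Sum.inl (Sum.inr (i, k))
    | ⟨Sum.inr _, k⟩ => Sum.inr k
  left_inv := by rintro ((k | ⟨i, k⟩) | k) <;> rfl
  right_inv := by rintro ⟨(⟨⟩ | i) | ⟨⟩, k⟩ <;> rfl

open scoped SimpleGraph in
/-- The forest in the extremal graph as a union of paths. -/
def extremalForestIso (a α b r : ℕ) :
    (SimpleGraph.pathGraph a ⊕g copies α (SimpleGraph.pathGraph b) ⊕g SimpleGraph.pathGraph r) ≃g
      pathForest (extremalParts a α b r) where
  toEquiv := extremalForestEquiv a α b r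
  map_rel_iff' := by
    rintro ((k | ⟨i, k⟩) | k) ((l | ⟨j, l⟩) | l) <;>
      simp [extremalForestEquiv, pathForest, copies, SimpleGraph.pathGraph_adj]

/-- The extremal graph as a cone over a union of paths. -/
def extremalIso (a α b r : ℕ) :
    pathCone a α b r ≃g cone (pathForest (extremalParts a α b r)) :=
  coneIso (extremalForestIso a α b r)

theorem isOuterplanar_pathCone (a α b r : ℕ) : IsOuterplanar (pathCone a α b r) := by
  refine isOuterplanar_cone
    -- The vertices are numbered path after path. Consecutive numbers at the border of two paths are
    -- harmless, because only adjacent vertices are required to have consecutive numbers.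
    (g := fun x => match x with
      | Sum.inl (Sum.inl k) => k.val
      | Sum.inl (Sum.inr (i, k)) => a + i.val * b + k.val
      | Sum.inr k => a + α * b + k.val) ?_ ?_
  · have key : ∀ (i j : Fin α) (k l : Fin b), i.val * b + k.val = j.val * b + l.val →
        i = j ∧ k = l := by
      intro i j k l h
      have hk := k.isLt
      have hl := l.isLt
      have h1 : i.val = j.val := by
        have e1 : (i.val * b + k.val) / b = i.val := by
          rw [mul_comm, Nat.mul_add_div (by omega), Nat.div_eq_of_lt hk, add_zero]
        have e2 : (j.val * b + l.val) / b = j.val := by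
          rw [mul_comm, Nat.mul_add_div (by omega), Nat.div_eq_of_lt hl, add_zero]
        rw [← e1, h, e2]
      rw [h1] at h
      exact ⟨Fin.ext h1, Fin.ext (by omega)⟩
    have key2 : ∀ (i : Fin α) (k : Fin b), i.val * b + k.val < α * b := by
      intro i k
      have := k.isLt
      have h2 : (i.val + 1) * b ≤ α * b := Nat.mul_le_mul_right _ i.isLt
      rw [add_mul] at h2
      omega
    rintro ((k | ⟨i, k⟩) | k) ((l | ⟨j, l⟩) | l) h <;> simp only at h
    · rw [Fin.ext h]
    · have := k.isLt; omega
    · have := k.isLt; omega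
    · have := l.isLt; omega
    · obtain ⟨rfl, rfl⟩ := key i j k l (by omega)
      rfl
    · have := key2 i k; omega
    · have := l.isLt; omega
    · have := key2 j l; omega
    · rw [Fin.ext (by omega : k.val = l.val)]
  · rintro ((k | ⟨i, k⟩) | k) ((l | ⟨j, l⟩) | l) h
    · simpa [SimpleGraph.pathGraph_adj] using h
    · simp at h
    · simp at h
    · simp at h
    · have h' : i = j ∧ (SimpleGraph.pathGraph b).Adj k l := h
      rw [SimpleGraph.pathGraph_adj] at h'
      obtain ⟨rfl, h2⟩ := h'
      simp only
      omega
    · simp at h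
    · simp at h
    · simp at h
    · have h' : (SimpleGraph.pathGraph r).Adj k l := h
      rw [SimpleGraph.pathGraph_adj] at h'
      simp only
      omega

end OuterplanarQ

/-! ### Outerplanar graphs with a dominating vertex are cones over linear forests. -/

namespace OuterplanarQ
open SimpleGraph

section LinearForest

variable {W : Type*} {H : SimpleGraph W}

/-- No vertex has three neighbours. -/
def DegreeLeTwo (H : SimpleGraph W) : Prop :=
  ∀ v x y z, H.Adj v x → H.Adj v y → H.Adj v z → x = y ∨ x = z ∨ y = z

theorem exists_longest_path [Finite W] (H : SimpleGraph W) (w : W) :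
    ∃ (u v : W) (p : H.Walk u v), p.IsPath ∧ H.Reachable w u ∧
      ∀ (u' v' : W) (q : H.Walk u' v'), q.IsPath → H.Reachable w u' → q.length ≤ p.length := by
  cases nonempty_fintype W
  set S : Set ℕ := {n | ∃ (u v : W) (p : H.Walk u v), p.IsPath ∧ H.Reachable w u ∧ p.length = n}
  have hne : S.Nonempty := ⟨0, w, w, .nil, .nil, Reachable.refl _, rfl⟩
  have hb : BddAbove S := ⟨Fintype.card W, by
    rintro n ⟨u, v, p, hp, -, rfl⟩
    exact hp.length_lt.le⟩
  obtain ⟨u, v, p, hp, hr, hl⟩ := Nat.sSup_mem hne hb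
  refine ⟨u, v, p, hp, hr, fun u' v' q hq hr' => ?_⟩
  rw [hl]
  exact le_csSup hb ⟨u', v', q, hq, hr', rfl⟩

/-- A neighbour outside a longest path would extend it at an end or be a third neighbour of an inner
vertex. Hence a longest path fills its component. -/
theorem mem_support_of_adj_longest (hdeg : DegreeLeTwo H) {u v : W} {p : H.Walk u v}
    (hp : p.IsPath)
    (hmax : ∀ (u' v' : W) (q : H.Walk u' v'), q.IsPath → H.Reachable u u' → q.length ≤ p.length)
    {y z : W} (hy : y ∈ p.support) (hyz : H.Adj y z) : z ∈ p.support := by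
  by_contra hz
  obtain ⟨k, rfl, hk⟩ := Walk.mem_support_iff_exists_getVert.1 hy
  rcases Nat.eq_zero_or_pos k with rfl | hk0
  · rw [Walk.getVert_zero] at hyz
    have := hmax z v (.cons hyz.symm p) (hp.cons hz) hyz.reachable
    simp at this
  rcases hk.lt_or_eq with hkl | rfl
  · have h1 := (p.adj_getVert_succ (i := k - 1) (by omega)).symm
    rw [Nat.sub_add_cancel hk0] at h1
    have h2 := p.adj_getVert_succ hkl
    have hn : ∀ i, p.getVert i ≠ z := fun i h => hz (h ▸ p.getVert_mem_support i)
    rcases hdeg _ _ _ _ h1 h2 hyz with h | h | h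
    · have := hp.getVert_injOn (by simp; omega) (by simp; omega) h
      omega
    · exact hn _ h
    · exact hn _ h
  · rw [Walk.getVert_length] at hyz
    have := hmax u z (p.concat hyz) (hp.concat hz hyz) (Reachable.refl _)
    simp at this

/-- Every edge of an acyclic graph is a bridge, but a chord could be bypassed along the path. -/
theorem eq_succ_of_adj_getVert (hac : H.IsAcyclic) {u v : W} {p : H.Walk u v} (hp : p.IsPath)
    {i j : ℕ} (hij : i < j) (hj : j ≤ p.length) (h : H.Adj (p.getVert i) (p.getVert j)) :
    i + 1 = j := by
  by_contra hne
  have hb := isBridge_iff.1 (isAcyclic_iff_forall_adj_isBridge.1 hac h)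
  apply hb
  have key : ∀ k, i + k ≤ j → (H.deleteEdges {s(p.getVert i, p.getVert j)}).Reachable
      (p.getVert i) (p.getVert (i + k)) := by
    intro k
    induction k with
    | zero => intro; exact Reachable.refl _
    | succ k ih =>
      intro hk
      refine (ih (by omega)).trans (Adj.reachable ?_)
      rw [deleteEdges_adj]
      refine ⟨p.adj_getVert_succ (by omega), ?_⟩
      intro he
      have inj : ∀ a b, a ≤ j → b ≤ j → p.getVert a = p.getVert b → a = b := fun a b ha hb' hab =>
        hp.getVert_injOn (by simp; omega) (by simp; omega) hab
      rcases Sym2.eq_iff.1 (mem_singleton_iff.1 he) with ⟨h1, h2⟩ | ⟨h1, h2⟩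
      · have e1 := inj _ _ (by omega) (by omega) h1
        have e2 := inj _ _ (by omega) (by omega) h2
        omega
      · have e1 := inj _ _ (by omega) (by omega) h1
        omega
  have := key (j - i) (by omega)
  rwa [Nat.add_sub_cancel' hij.le] at this

/-- A graph without cycles and without vertices of degree at least three is a union of paths. -/
theorem exists_pathForest_iso [Finite W] (hdeg : DegreeLeTwo H) (hac : H.IsAcyclic) :
    ∃ m : H.ConnectedComponent → ℕ, Nonempty (pathForest m ≃g H) := by
  classical
  have hex : ∀ C : H.ConnectedComponent, ∃ (u v : W) (p : H.Walk u v), p.IsPath ∧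
      H.connectedComponentMk u = C ∧ ∀ (u' v' : W) (q : H.Walk u' v'), q.IsPath →
        H.Reachable u u' → q.length ≤ p.length := by
    intro C
    induction C using ConnectedComponent.ind with
    | _ w =>
      obtain ⟨u, v, p, hp, hr, hmax⟩ := exists_longest_path H w
      exact ⟨u, v, p, hp, (ConnectedComponent.eq.2 hr).symm,
        fun u' v' q hq h => hmax u' v' q hq (hr.trans h)⟩
  choose U V p hp hC hmax using hex
  have hcomp : ∀ C k, H.connectedComponentMk ((p C).getVert k) = C := by
    intro C k
    rw [← ConnectedComponent.eq.2
      ((p C).takeUntil _ ((p C).getVert_mem_support k)).reachable]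
    exact hC C
  have hinj : ∀ C k l, k ≤ (p C).length → l ≤ (p C).length →
      (p C).getVert k = (p C).getVert l → k = l := fun C k l hk hl h =>
    (hp C).getVert_injOn hk hl h
  set φ : (Σ C, Fin ((p C).length + 1)) → W := fun x => (p x.1).getVert x.2 with hφ
  have hφinj : Function.Injective φ := by
    rintro ⟨C, k⟩ ⟨C', l⟩ h
    have hCC : C = C' := by
      rw [← hcomp C k, ← hcomp C' l]
      exact congrArg _ h
    subst hCC
    have := hinj C k l (by omega) (by omega) h
    rw [Fin.ext this]
  have hφsurj : Function.Surjective φ := by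
    intro w
    set C := H.connectedComponentMk w with hCw
    have hr : H.Reachable (U C) w := ConnectedComponent.eq.1 ((hC C).trans hCw)
    have hmem : w ∈ (p C).support := by
      obtain ⟨q⟩ := hr
      have : ∀ {a b : W} (q : H.Walk a b), a ∈ (p C).support → b ∈ (p C).support := by
        intro a b q
        induction q with
        | nil => exact id
        | cons h q ih =>
          exact fun ha => ih (mem_support_of_adj_longest hdeg (hp C) (hmax C) ha h)
      exact this q (p C).start_mem_support
    obtain ⟨k, hk, hkl⟩ := Walk.mem_support_iff_exists_getVert.1 hmem
    exact ⟨⟨C, ⟨k, by omega⟩⟩, hk⟩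
  refine ⟨fun C => (p C).length + 1, ⟨⟨Equiv.ofBijective φ ⟨hφinj, hφsurj⟩, ?_⟩⟩⟩
  rintro ⟨C, k⟩ ⟨C', l⟩
  change H.Adj ((p C).getVert k) ((p C').getVert l) ↔ C = C' ∧ (k.val + 1 = l.val ∨ l.val + 1 = k.val)
  have hk : k.val < (p C).length + 1 := k.isLt
  have hl : l.val < (p C').length + 1 := l.isLt
  constructor
  · intro h
    have hCC : C = C' := by
      rw [← hcomp C k, ← hcomp C' l, ConnectedComponent.eq]
      exact h.reachable
    subst hCC
    refine ⟨rfl, ?_⟩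
    rcases lt_trichotomy k.val l.val with hlt | heq | hlt
    · exact Or.inl (eq_succ_of_adj_getVert hac (hp C) hlt (by omega) h)
    · rw [heq] at h
      exact absurd h (H.irrefl)
    · exact Or.inr (eq_succ_of_adj_getVert hac (hp C) hlt (by omega) h.symm)
  · rintro ⟨rfl, h | h⟩
    · rw [← h]
      exact (p C).adj_getVert_succ (by omega)
    · rw [← h]
      exact ((p C).adj_getVert_succ (by omega)).symm

end LinearForest

section Outerplanar

variable {V : Type*} {G : SimpleGraph V}

/-- An outerplanar graph does not contain `K_{2,3}`. -/
theorem IsOuterplanar.no_K23 (h : IsOuterplanar G) {a b x y z : V} (hab : a ≠ b)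
    (hax : G.Adj a x) (hay : G.Adj a y) (haz : G.Adj a z) (hbx : G.Adj b x) (hby : G.Adj b y)
    (hbz : G.Adj b z) : x = y ∨ x = z ∨ y = z := by
  by_contra hne
  push Not at hne
  obtain ⟨hxy, hxz, hyz⟩ := hne
  refine h.no_theta hab (.cons hax (.cons hbx.symm .nil)) (.cons hay (.cons hby.symm .nil))
    (.cons haz (.cons hbz.symm .nil)) ?_ ?_ ?_ ?_ ?_ ?_ ?_
  · simp [Walk.cons_isPath_iff, hab, hax.ne, hbx.ne']
  all_goals simp [*, hax.ne, hay.ne, haz.ne, hbx.ne, hby.ne, hbz.ne, hax.ne', hay.ne',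
    hbx.ne', hby.ne', hab.symm]

/-- The neighbourhood of a vertex in an outerplanar graph contains no vertex of degree three. -/
theorem IsOuterplanar.degreeLeTwo (h : IsOuterplanar G) {u : V} (hu : ∀ v, v ≠ u → G.Adj u v) :
    DegreeLeTwo (G.induce {v | v ≠ u}) := by
  intro v x y z hx hy hz
  have := h.no_K23 (a := v.1) (b := u) v.2 hx hy hz (hu _ x.2) (hu _ y.2) (hu _ z.2)
  exact this.imp Subtype.ext (Or.imp Subtype.ext Subtype.ext)

/-- The neighbourhood of a vertex in an outerplanar graph contains no cycle. -/
theorem IsOuterplanar.isAcyclic (h : IsOuterplanar G) {u : V} (hu : ∀ v, v ≠ u → G.Adj u v) :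
    (G.induce {v | v ≠ u}).IsAcyclic := by
  intro x c hc
  cases c with
  | nil => simp at hc
  | cons hxy p =>
    rename_i y
    rw [Walk.cons_isCycle_iff] at hc
    obtain ⟨hp, he⟩ := hc
    cases p with
    | nil => exact (hxy.ne rfl).elim
    | cons hyz p =>
      rename_i z
      rw [Walk.cons_isPath_iff] at hp
      have hxz : x ≠ z := by
        rintro rfl
        simp at he
      have axy : G.Adj x.1 y.1 := hxy
      have ayz : G.Adj y.1 z.1 := hyz
      -- If `z` and `x` are adjacent, then `u, x, y, z` span a `K_4`. Otherwise the routes from `z`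
      -- to `x` through `y`, through `u`, and along the rest of the cycle form a theta, and none of
      -- them can use the absent edge `zx`.
      by_cases hzx : G.Adj z.1 x.1
      · exact h.no_K4 (hu _ x.2) (hu _ y.2) (hu _ z.2) axy hzx.symm ayz
      have hxz' : z.1 ≠ x.1 := fun h => hxz (Subtype.ext h.symm)
      set f : G.induce {v | v ≠ u} →g G := (Embedding.induce _).toHom with hf
      have hfe : ∀ v, f v = v.1 := fun v => rfl
      set q : G.Walk z.1 x.1 := p.map f with hq
      have hqs : q.support = p.support.map f := Walk.support_map f p
      have hqu : u ∉ q.support := by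
        rw [hqs]
        intro hmem
        obtain ⟨v, -, hv⟩ := List.mem_map.1 hmem
        exact v.2 hv
      have hqy : y.1 ∉ q.support := by
        rw [hqs]
        intro hmem
        obtain ⟨v, hv, hvy⟩ := List.mem_map.1 hmem
        have : v = y := Subtype.ext hvy
        exact hp.2 (this ▸ hv)
      have hyu : y.1 ≠ u := y.2
      refine h.no_theta (a := z.1) (b := x.1) hxz' (.cons ayz.symm (.cons axy.symm .nil))
        (.cons (hu _ z.2).symm (.cons (hu _ x.2) .nil)) q ?_ ?_ ?_ ?_ ?_ ?_ ?_
      · simp [Walk.cons_isPath_iff, hxz', ayz.ne', axy.ne']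
      · simp [hyu, axy.ne', ayz.ne]
      · intro v hv hvq
        simp only [Walk.support_cons, Walk.support_nil, List.mem_cons, List.not_mem_nil,
          or_false] at hv
        rcases hv with rfl | rfl | rfl
        · exact Or.inl rfl
        · exact absurd hvq hqy
        · exact Or.inr rfl
      · intro v hv hvq
        simp only [Walk.support_cons, Walk.support_nil, List.mem_cons, List.not_mem_nil,
          or_false] at hv
        rcases hv with rfl | rfl | rfl
        · exact Or.inl rfl
        · exact absurd hvq hqu
        · exact Or.inr rfl
      · simp [ayz.ne', axy.ne, hxz', hxz'.symm]
      · have h1 : z.1 ≠ u := z.2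
        have h2 : x.1 ≠ u := x.2
        simp [hxz', h1, h2, hxz'.symm]
      · intro hmem
        exact hzx (q.adj_of_mem_edges hmem)

/-- A graph with a dominating vertex is a cone. -/
theorem nonempty_iso_cone {u : V} (hu : ∀ v, v ≠ u → G.Adj u v) :
    Nonempty (cone (G.induce {v | v ≠ u}) ≃g G) := by
  classical
  set e : Option {v | v ≠ u} ≃ V := Equiv.optionSubtypeNe u
  have h0 : e none = u := Equiv.optionSubtypeNe_none u
  have hs : ∀ v, e (some v) = v.1 := fun v => Equiv.optionSubtypeNe_some u v
  refine ⟨⟨e, ?_⟩⟩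
  rintro (_ | v) (_ | w)
  · simp [cone]
  · rw [h0, hs]
    simp [cone, hu w.1 w.2]
  · rw [h0, hs]
    simp [cone, (hu v.1 v.2).symm]
  · rw [hs, hs]
    simp only [cone, Option.mem_def, Option.some.injEq, forall_eq', ne_eq]
    exact ⟨fun h => ⟨fun h' => h.ne (congrArg _ h'), h⟩, fun h => h.2⟩

/-- An outerplanar graph with a dominating vertex is a cone over a union of paths. -/
theorem IsOuterplanar.exists_iso_cone [Fintype V] (h : IsOuterplanar G) {u : V}
    (hu : ∀ v, v ≠ u → G.Adj u v) :
    ∃ (n : ℕ) (m : Fin n → ℕ), Nonempty (G ≃g cone (pathForest m)) := by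
  obtain ⟨m, ⟨e⟩⟩ := exists_pathForest_iso (h.degreeLeTwo hu) (h.isAcyclic hu)
  obtain ⟨e'⟩ := nonempty_iso_cone hu
  have : Finite (G.induce {v | v ≠ u}).ConnectedComponent :=
    Finite.of_surjective _ Quot.mk_surjective
  obtain ⟨n, ⟨σ⟩⟩ := Finite.exists_equiv_fin (G.induce {v | v ≠ u}).ConnectedComponent
  refine ⟨n, m ∘ σ.symm, ⟨(e'.symm.trans (coneIso e.symm)).trans (coneIso (Iso.symm ⟨?_, ?_⟩))⟩⟩
  · exact (Equiv.sigmaCongrLeft (β := fun C => Fin (m C)) σ.symm)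
  · rintro ⟨i, k⟩ ⟨j, l⟩
    simp [pathForest, Equiv.sigmaCongrLeft]

end Outerplanar

end OuterplanarQ

/-! ### Perron–Frobenius type bounds for the signless Laplacian. -/

namespace OuterplanarQ
open SimpleGraph

section Spectral

variable {V : Type*} [Fintype V] {G : SimpleGraph V}

open Classical in
/-- The action of the signless Laplacian on a vector. -/
noncomputable def qAct (G : SimpleGraph V) (v : V → ℝ) (i : V) : ℝ :=
  ∑ j, if G.Adj i j then v i + v j else 0

theorem signlessLaplacian_mulVec (v : V → ℝ) (i : V) :
    (signlessLaplacian G).mulVec v i = qAct G v i := by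
  classical
  rw [signlessLaplacian, Matrix.add_mulVec, Pi.add_apply, SimpleGraph.adjMatrix_mulVec_apply,
    SimpleGraph.degMatrix, Matrix.mulVec_diagonal, qAct, ← Finset.sum_filter,
    ← SimpleGraph.neighborFinset_eq_filter, Finset.sum_add_distrib, Finset.sum_const,
    SimpleGraph.card_neighborFinset_eq_degree, nsmul_eq_mul]

theorem hasEigenvalue_iff {μ : ℝ} :
    Module.End.HasEigenvalue (signlessLaplacian G).mulVecLin μ ↔
      ∃ v : V → ℝ, v ≠ 0 ∧ ∀ i, qAct G v i = μ * v i := by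
  constructor
  · intro h
    obtain ⟨v, hv⟩ := h.exists_hasEigenvector
    refine ⟨v, hv.2, fun i => ?_⟩
    have := congrFun (Module.End.mem_eigenspace_iff.1 hv.1) i
    simpa [signlessLaplacian_mulVec] using this
  · rintro ⟨v, hv, h⟩
    refine Module.End.hasEigenvalue_of_hasEigenvector (x := v) ⟨?_, hv⟩
    rw [Module.End.mem_eigenspace_iff]
    ext i
    simpa [signlessLaplacian_mulVec] using h i

theorem isHermitian_signlessLaplacian : (signlessLaplacian G).IsHermitian := by
  classical
  ext i j
  by_cases h : i = j
  · simp [h]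
  · simp [signlessLaplacian, SimpleGraph.degMatrix, SimpleGraph.adj_comm,
      Matrix.diagonal_apply_ne _ h, Matrix.diagonal_apply_ne _ (Ne.symm h)]

theorem hasEigenvalue_qIndex [Nonempty V] (G : SimpleGraph V) :
    Module.End.HasEigenvalue (signlessLaplacian G).mulVecLin (qIndex G) := by
  classical
  have hfin : {μ : ℝ | Module.End.HasEigenvalue (signlessLaplacian G).mulVecLin μ}.Finite :=
    Module.End.finite_hasEigenvalue _
  refine Set.Nonempty.csSup_mem ?_ hfin
  obtain ⟨i⟩ := ‹Nonempty V›
  have hA := isHermitian_signlessLaplacian (G := G)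
  refine ⟨hA.eigenvalues i, Module.End.hasEigenvalue_of_hasEigenvector
    (x := (hA.eigenvectorBasis i).ofLp) ⟨?_, ?_⟩⟩
  · rw [Module.End.mem_eigenspace_iff]
    exact hA.mulVec_eigenvectorBasis i
  · intro h
    have := hA.eigenvectorBasis.toBasis.ne_zero i
    apply this
    rw [OrthonormalBasis.coe_toBasis]
    ext j
    exact congrFun h j

theorem le_qIndex {μ : ℝ} (h : Module.End.HasEigenvalue (signlessLaplacian G).mulVecLin μ) :
    μ ≤ qIndex G :=
  le_csSup (Module.End.finite_hasEigenvalue (signlessLaplacian G).mulVecLin).bddAbove h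

theorem exists_abs_eigenvector [Nonempty V] (G : SimpleGraph V) :
    ∃ y : V → ℝ, y ≠ 0 ∧ (∀ i, 0 ≤ y i) ∧ ∀ i, qIndex G * y i ≤ qAct G y i := by
  classical
  obtain ⟨v, hv, h⟩ := hasEigenvalue_iff.1 (hasEigenvalue_qIndex G)
  refine ⟨fun i => |v i|, ?_, fun i => abs_nonneg _, fun i => ?_⟩
  · intro h0
    apply hv
    ext i
    exact abs_eq_zero.1 (congrFun h0 i)
  · calc qIndex G * |v i| ≤ |qIndex G * v i| := by
          rw [abs_mul]
          exact mul_le_mul_of_nonneg_right (le_abs_self _) (abs_nonneg _)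
      _ = |qAct G v i| := by rw [h]
      _ ≤ _ := by
          refine (Finset.abs_sum_le_sum_abs _ _).trans (Finset.sum_le_sum fun j _ => ?_)
          split_ifs
          · exact abs_add_le _ _
          · simp

theorem exists_max_eigenvector [Nonempty V] (G : SimpleGraph V) :
    ∃ (y : V → ℝ) (u : V), y u = 1 ∧ (∀ i, 0 ≤ y i) ∧ (∀ i, y i ≤ 1) ∧
      ∀ i, qIndex G * y i ≤ qAct G y i := by
  classical
  obtain ⟨y, hy, h0, h⟩ := exists_abs_eigenvector G
  obtain ⟨u, -, hu⟩ := Finset.exists_max_image Finset.univ y Finset.univ_nonempty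
  have hpos : 0 < y u := by
    rcases (h0 u).lt_or_eq with h' | h'
    · exact h'
    · refine absurd ?_ hy
      ext i
      exact le_antisymm ((hu i (Finset.mem_univ i)).trans h'.symm.le) (h0 i)
  refine ⟨fun i => y i / y u, u, div_self hpos.ne', fun i => div_nonneg (h0 i) hpos.le,
    fun i => (div_le_one hpos).2 (hu i (Finset.mem_univ i)), fun i => ?_⟩
  have : qAct G (fun i => y i / y u) i = qAct G y i / y u := by
    simp only [qAct, Finset.sum_div]
    refine Finset.sum_congr rfl fun j _ => ?_
    split_ifs
    · rw [add_div]
    · simp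
  rw [this, mul_div_assoc']
  exact div_le_div_of_nonneg_right (h i) hpos.le

/-- The Collatz–Wielandt bound. Scale `x` so that it dominates a nonnegative subinvariant vector `y`
and touches it at `i`; nonnegativity of the matrix then compares the two actions at `i`.
Connectedness plays no role. -/
theorem qIndex_le_of_pos [Nonempty V] {x : V → ℝ} (hx : ∀ i, 0 < x i) : ∃ i, qIndex G * x i ≤ qAct G x i := by
  classical
  obtain ⟨y, hy, h0, hq⟩ := exists_abs_eigenvector G
  obtain ⟨i, -, hi⟩ := Finset.exists_max_image Finset.univ (fun i => y i / x i)
    Finset.univ_nonempty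
  set c := y i / x i with hc
  have hyc : ∀ j, y j ≤ c * x j := fun j => by
    have := hi j (Finset.mem_univ j)
    rwa [div_le_iff₀ (hx j)] at this
  have hci : y i = c * x i := by rw [hc]; field_simp [(hx i).ne']
  have hc0 : 0 < c := by
    by_contra hcon
    push Not at hcon
    apply hy
    ext j
    refine le_antisymm ((hyc j).trans ?_) (h0 j)
    exact mul_nonpos_of_nonpos_of_nonneg hcon (hx j).le
  refine ⟨i, ?_⟩
  have h1 : qAct G y i ≤ c * qAct G x i := by
    rw [qAct, qAct, Finset.mul_sum]
    refine Finset.sum_le_sum fun j _ => ?_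
    split_ifs
    · rw [mul_add]
      exact add_le_add (hyc i) (hyc j)
    · simp
  have h2 := (hq i).trans h1
  rw [hci] at h2
  have : c * (qIndex G * x i) ≤ c * qAct G x i := by linarith
  exact le_of_mul_le_mul_left this hc0

theorem qIndex_lt_of_pos [Nonempty V] {μ : ℝ} {x : V → ℝ} (hx : ∀ i, 0 < x i)
    (h : ∀ i, qAct G x i < μ * x i) : qIndex G < μ := by
  obtain ⟨i, hi⟩ := qIndex_le_of_pos (G := G) hx
  exact lt_of_mul_lt_mul_right (hi.trans_lt (h i)) (hx i).le

theorem qIndex_eq_of_pos [Nonempty V] {μ : ℝ} {x : V → ℝ} (hx : ∀ i, 0 < x i)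
    (h : ∀ i, qAct G x i = μ * x i) : qIndex G = μ := by
  obtain ⟨i, hi⟩ := qIndex_le_of_pos (G := G) hx
  rw [h i] at hi
  refine le_antisymm (le_of_mul_le_mul_right hi (hx i)) (le_qIndex (hasEigenvalue_iff.2 ⟨x, ?_, h⟩))
  intro h0
  exact (hx i).ne' (congrFun h0 i)

theorem hasEigenvalue_congr {V' : Type*} [Fintype V'] {G' : SimpleGraph V'} (e : G ≃g G') {μ : ℝ}
    (h : Module.End.HasEigenvalue (signlessLaplacian G).mulVecLin μ) :
    Module.End.HasEigenvalue (signlessLaplacian G').mulVecLin μ := by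
  classical
  obtain ⟨v, hv, h⟩ := hasEigenvalue_iff.1 h
  refine hasEigenvalue_iff.2 ⟨v ∘ e.symm, ?_, fun i => ?_⟩
  · intro h0
    apply hv
    ext j
    have := congrFun h0 (e j)
    simpa using this
  · have := h (e.symm i)
    rw [Function.comp_apply, ← this, qAct, qAct, ← e.toEquiv.sum_comp]
    refine Finset.sum_congr rfl fun j _ => ?_
    have h1 : G'.Adj i (e.toEquiv j) ↔ G.Adj (e.symm i) j := by
      rw [← e.map_adj_iff]
      simp
    have h2 : e.symm (e.toEquiv j) = j := e.symm_apply_apply j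
    simp only [h1, Function.comp_apply, h2]

theorem qIndex_congr {V' : Type*} [Fintype V'] {G' : SimpleGraph V'} (e : G ≃g G') :
    qIndex G = qIndex G' := by
  unfold qIndex
  congr 1
  ext μ
  exact ⟨hasEigenvalue_congr e, hasEigenvalue_congr e.symm⟩

end Spectral

end OuterplanarQ

/-! ### The explicit eigenvector of a cone over paths. -/

namespace OuterplanarQ
open SimpleGraph

section ConeSpectrum

/-- The entry of the eigenvector of a cone at a vertex of a path with `k` vertices on one side and
`l` vertices on the other side. -/
noncomputable def pathVal (t : ℝ) (k l : ℕ) : ℝ :=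
  t / (t - 1) ^ 2 * (1 - 2 * (t ^ (k + 1) + t ^ (l + 1)) / ((1 + t) * (1 + t ^ (k + l + 1))))

/-- The eigenvalue `t + 1 / t + 3`. -/
noncomputable def specVal (t : ℝ) : ℝ := t + 1 / t + 3

/-- The function whose sum over the paths decides between two cones. -/
noncomputable def pathWeight (t : ℝ) (m : ℕ) : ℝ := (t ^ m - 1) / (t ^ m + 1)

variable {t : ℝ}

theorem pathVal_pos (ht : 1 < t) (k l : ℕ) : 0 < pathVal t k l := by
  have h0 : 0 < t := by linarith
  have hk : 1 ≤ t ^ k := one_le_pow₀ ht.le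
  have hl : 1 ≤ t ^ l := one_le_pow₀ ht.le
  have h1 : 0 < t / (t - 1) ^ 2 := div_pos h0 (by nlinarith)
  refine mul_pos h1 ?_
  rw [sub_pos, div_lt_one (by positivity)]
  have e1 : t ^ (k + 1) = t ^ k * t := pow_succ _ _
  have e2 : t ^ (l + 1) = t ^ l * t := pow_succ _ _
  have e3 : t ^ (k + l + 1) = t ^ k * t ^ l * t := by rw [pow_succ, pow_add]
  rw [e1, e2, e3]
  have hkl : t ^ k + t ^ l ≤ 1 + t ^ k * t ^ l := by nlinarith
  have hkl1 : 1 ≤ t ^ k * t ^ l := by nlinarith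
  nlinarith [mul_le_mul_of_nonneg_right hkl h0.le,
    mul_pos (sub_pos.2 ht) (by nlinarith : 0 < t ^ k * t ^ l * t - 1)]

/-- This is the eigenvalue equation on a path with apex value 1. Inside, it reads `x_{k-1} + x_{k+1}
= (t + 1/t) x_k - 1`, with constant solution `t/(t-1)²` and homogeneous solutions `t^k`, `t^{-k}`.
The degree drop at an end amounts to a virtual neighbour whose value is the negative of that of the
end vertex. -/
theorem specVal_mul_pathVal (ht : 1 < t) (k l : ℕ) :
    specVal t * pathVal t k l = 1 + pathVal t k l +
      (if 0 < k then pathVal t k l + pathVal t (k - 1) (l + 1) else 0) +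
      (if 0 < l then pathVal t k l + pathVal t (k + 1) (l - 1) else 0) := by
  have h0 : 0 < t := by linarith
  have h1 : t - 1 ≠ 0 := by linarith
  have h2 : 1 + t ≠ 0 := by linarith
  have h3 : t ≠ 0 := h0.ne'
  have hD : ∀ j, 1 + t ^ j ≠ 0 := fun j => by positivity
  unfold specVal pathVal
  rcases k with _ | k <;> rcases l with _ | l
  · simp
    field_simp
    ring
  · have := hD (l + 2)
    have e1 : 0 + (l + 1) + 1 = l + 2 := by ring
    simp only [e1, lt_irrefl, if_false, Nat.succ_pos, if_true, Nat.add_sub_cancel]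
    field_simp
    ring
  · have := hD (k + 2)
    have e1 : k + 1 + 0 + 1 = k + 2 := by ring
    simp only [e1, lt_irrefl, if_false, Nat.succ_pos, if_true, Nat.add_sub_cancel]
    field_simp
    ring
  · have := hD (k + l + 3)
    have e1 : k + 1 + (l + 1) + 1 = k + l + 3 := by ring
    simp only [e1, Nat.succ_pos, if_true, Nat.add_sub_cancel]
    field_simp
    ring

/-- Two geometric sums. Only the `pathWeight` term is not linear in `m`, so this term alone
distinguishes partitions of the same total. -/
theorem sum_pathVal (ht : 1 < t) (m : ℕ) :
    ∑ k ∈ Finset.range m, pathVal t k (m - 1 - k) =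
      t / (t - 1) ^ 2 * (m - 4 * t / (t ^ 2 - 1) * pathWeight t m) := by
  have h0 : 0 < t := by linarith
  have h1 : t - 1 ≠ 0 := by linarith
  have h2 : 1 + t ≠ 0 := by linarith
  have h3 : 1 + t ^ m ≠ 0 := by positivity
  have hgeom : ∑ k ∈ Finset.range m, t ^ k = (t ^ m - 1) / (t - 1) := geom_sum_eq ht.ne' m
  have hrefl : ∑ k ∈ Finset.range m, t ^ (m - 1 - k) = (t ^ m - 1) / (t - 1) := by
    rw [← hgeom]
    exact Finset.sum_range_reflect (fun k => t ^ k) m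
  have hterm : ∀ k ∈ Finset.range m, pathVal t k (m - 1 - k) =
      t / (t - 1) ^ 2 * (1 - 2 * t / ((1 + t) * (1 + t ^ m)) * (t ^ k + t ^ (m - 1 - k))) := by
    intro k hk
    have hk' := Finset.mem_range.1 hk
    rw [pathVal]
    have e : k + (m - 1 - k) + 1 = m := by omega
    rw [e, pow_succ, pow_succ]
    congr 2
    ring
  rw [Finset.sum_congr rfl hterm, ← Finset.mul_sum, Finset.sum_sub_distrib, ← Finset.mul_sum,
    Finset.sum_add_distrib, hgeom, hrefl, pathWeight, Finset.sum_const, Finset.card_range,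
    nsmul_eq_mul, mul_one]
  congr 2
  have h4 : t ^ 2 - 1 ≠ 0 := by
    have : t ^ 2 - 1 = (t - 1) * (1 + t) := by ring
    rw [this]
    exact mul_ne_zero h1 h2
  have h5 : t ^ m + 1 ≠ 0 := by positivity
  field_simp
  ring

variable {ι : Type*} [Fintype ι] (m : ι → ℕ)

/-- The eigenvector of a cone over a union of paths, with the value `s` at the apex. -/
noncomputable def coneVec (t s : ℝ) : Option (Σ i, Fin (m i)) → ℝ
  | none => s
  | some x => pathVal t x.2 (m x.1 - 1 - x.2)

/-- The sum of the entries of the eigenvector outside the apex. -/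
noncomputable def forestSum (t : ℝ) : ℝ :=
  ∑ i, ∑ k ∈ Finset.range (m i), pathVal t k (m i - 1 - k)

variable {m}

theorem sum_coneVec_some (t s : ℝ) : ∑ x, coneVec m t s (some x) = forestSum m t := by
  rw [Fintype.sum_sigma, forestSum]
  refine Finset.sum_congr rfl fun i _ => ?_
  rw [← Fin.sum_univ_eq_sum_range (fun k => pathVal t k (m i - 1 - k)) (m i)]
  rfl

theorem qAct_coneVec_none (t s : ℝ) :
    qAct (cone (pathForest m)) (coneVec m t s) none = (∑ i, (m i : ℝ)) * s + forestSum m t := by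
  classical
  rw [qAct, Fintype.sum_option, ← sum_coneVec_some t s]
  have h1 : ∀ x, (cone (pathForest m)).Adj none (some x) := fun x => by simp [cone]
  simp only [h1, if_true, SimpleGraph.irrefl, if_false, zero_add, Finset.sum_add_distrib]
  congr 1
  simp [coneVec, Finset.card_univ, Fintype.card_sigma]

theorem sum_adjacent_in_path (f : ℕ → ℝ) (n k : ℕ) (hk : k < n) :
    ∑ l : Fin n, (if k + 1 = l.val ∨ l.val + 1 = k then f l else 0) =
      (if 0 < k then f (k - 1) else 0) + (if k + 1 < n then f (k + 1) else 0) := by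
  rw [Fin.sum_univ_eq_sum_range (fun l => if k + 1 = l ∨ l + 1 = k then f l else 0) n]
  have h : ∀ l, (if k + 1 = l ∨ l + 1 = k then f l else 0) =
      (if l + 1 = k then f l else 0) + (if k + 1 = l then f l else 0) := by
    intro l
    by_cases h1 : k + 1 = l
    · have : ¬ l + 1 = k := by omega
      simp [h1, this]
    · simp [h1]
  simp only [h, Finset.sum_add_distrib]
  congr 1
  · rcases k with _ | k
    · simp
    · simp only [add_left_inj, Finset.sum_ite_eq', Finset.mem_range]
      rw [if_pos (by omega), if_pos (by omega)]
      rfl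
  · simp

theorem qAct_coneVec_some (ht : 1 < t) (s : ℝ) (x : Σ i, Fin (m i)) :
    qAct (cone (pathForest m)) (coneVec m t s) (some x) =
      specVal t * coneVec m t s (some x) + (s - 1) := by
  classical
  obtain ⟨i, k⟩ := x
  rw [qAct, Fintype.sum_option, Fintype.sum_sigma]
  have h1 : (cone (pathForest m)).Adj (some ⟨i, k⟩) none := by simp [cone]
  have h2 : ∀ j l, (cone (pathForest m)).Adj (some ⟨i, k⟩) (some ⟨j, l⟩) ↔
      i = j ∧ (k.val + 1 = l.val ∨ l.val + 1 = k.val) := by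
    intro j l
    have : (cone (pathForest m)).Adj (some ⟨i, k⟩) (some ⟨j, l⟩) ↔
        (pathForest m).Adj ⟨i, k⟩ ⟨j, l⟩ := by
      simp only [cone, Option.mem_def, Option.some.injEq, forall_eq', ne_eq]
      exact ⟨fun h => h.2, fun h => ⟨h.ne, h⟩⟩
    rw [this]
    rfl
  rw [if_pos h1, Finset.sum_eq_single i]
  · simp only [h2, true_and]
    set X : ℕ → ℝ := fun l => pathVal t l (m i - 1 - l) with hX
    have h3 : ∀ l : Fin (m i), coneVec m t s (some ⟨i, l⟩) = X l := fun l => rfl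
    have h4 : coneVec m t s none = s := rfl
    simp only [h3, h4]
    rw [sum_adjacent_in_path (fun l => X k + X l) (m i) k k.isLt]
    have := specVal_mul_pathVal ht k.val (m i - 1 - k.val)
    have hk := k.isLt
    have e1 : (if 0 < k.val then pathVal t k (m i - 1 - k) +
        pathVal t (k - 1) (m i - 1 - k + 1) else 0) =
        if 0 < k.val then X k + X (k.val - 1) else 0 := by
      split_ifs with h
      · simp only [hX]
        congr 2
        omega
      · rfl
    have e2 : (if 0 < m i - 1 - k.val then pathVal t k (m i - 1 - k) +
        pathVal t (k + 1) (m i - 1 - k - 1) else 0) =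
        if k.val + 1 < m i then X k + X (k.val + 1) else 0 := by
      by_cases h : k.val + 1 < m i
      · rw [if_pos h, if_pos (by omega)]
        simp only [hX]
        congr 2
      · rw [if_neg h, if_neg (by omega)]
    rw [e1, e2] at this
    simp only [hX] at this ⊢
    rw [this]
    ring
  · intro j _ hj
    refine Finset.sum_eq_zero fun l _ => ?_
    rw [if_neg]
    rw [h2]
    exact fun h => hj h.1.symm
  · intro h
    exact absurd (Finset.mem_univ _) h

omit [Fintype ι] in
theorem coneVec_pos (ht : 1 < t) {s : ℝ} (hs : 0 < s) (x) : 0 < coneVec m t s x := by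
  rcases x with _ | x
  · exact hs
  · exact pathVal_pos ht _ _

theorem forestSum_nonneg (ht : 1 < t) : 0 ≤ forestSum m t :=
  Finset.sum_nonneg fun _ _ => Finset.sum_nonneg fun _ _ => (pathVal_pos ht _ _).le

theorem qIndex_cone_eq (ht : 1 < t) (h : ∑ i, (m i : ℝ) + forestSum m t = specVal t) :
    qIndex (cone (pathForest m)) = specVal t := by
  refine qIndex_eq_of_pos (coneVec_pos ht one_pos) ?_
  rintro (_ | x)
  · rw [qAct_coneVec_none, mul_one, h]
    simp [coneVec]
  · rw [qAct_coneVec_some ht, sub_self, add_zero]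

/-- Lowering the apex value from 1 to `1 - ε` makes all equations on the paths strict. The choice of
`ε` spends only part of the slack at the apex, so all rows become strict and the Collatz–Wielandt
bound applies. -/
theorem qIndex_cone_lt (ht : 1 < t) (h : ∑ i, (m i : ℝ) + forestSum m t < specVal t) :
    qIndex (cone (pathForest m)) < specVal t := by
  set N := ∑ i, (m i : ℝ) with hN
  have hN0 : 0 ≤ N := Finset.sum_nonneg fun _ _ => by positivity
  have hS := forestSum_nonneg (m := m) ht
  have hq : 0 < specVal t := by linarith
  set ε := (specVal t - N - forestSum m t) / (2 * specVal t) with hε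
  have hε0 : 0 < ε := div_pos (by linarith) (by linarith)
  have hε1 : ε < 1 := by
    rw [hε, div_lt_one (by linarith)]
    linarith
  have hε2 : ε * (2 * specVal t) = specVal t - N - forestSum m t := by
    rw [hε]
    field_simp
  refine qIndex_lt_of_pos (coneVec_pos ht (s := 1 - ε) (by linarith)) ?_
  rintro (_ | x)
  · rw [qAct_coneVec_none]
    simp only [coneVec]
    nlinarith
  · rw [qAct_coneVec_some ht]
    linarith

theorem forestSum_eq (ht : 1 < t) : forestSum m t =
    t / (t - 1) ^ 2 * (∑ i, (m i : ℝ) - 4 * t / (t ^ 2 - 1) * ∑ i, pathWeight t (m i)) := by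
  rw [forestSum, Finset.sum_congr rfl fun i _ => sum_pathVal ht (m i), ← Finset.mul_sum,
    Finset.sum_sub_distrib, Finset.mul_sum]

theorem one_le_mul_pathVal (ht : 1 < t) (k l : ℕ) : 1 ≤ (specVal t - 1) * pathVal t k l := by
  have := specVal_mul_pathVal ht k l
  have h1 := pathVal_pos ht k l
  have h2 := pathVal_pos ht (k - 1) (l + 1)
  have h3 := pathVal_pos ht (k + 1) (l - 1)
  split_ifs at this <;> linarith

theorem sum_le_mul_forestSum (ht : 1 < t) :
    ∑ i, (m i : ℝ) ≤ (specVal t - 1) * forestSum m t := by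
  rw [forestSum, Finset.mul_sum]
  refine Finset.sum_le_sum fun i _ => ?_
  rw [Finset.mul_sum]
  calc (m i : ℝ) = ∑ k ∈ Finset.range (m i), (1 : ℝ) := by simp
    _ ≤ _ := Finset.sum_le_sum fun k _ => one_le_mul_pathVal ht _ _

/-- With `N` the number of vertices other than the apex and `q = N + forestSum`, the bound `N ≤ (q -
1) (q - N)` simplifies to `q ≥ N + 1`. Thus the index of the cone is at least its order. -/
theorem le_specVal (ht : 1 < t) (h : ∑ i, (m i : ℝ) + forestSum m t = specVal t) :
    ∑ i, (m i : ℝ) + 1 ≤ specVal t := by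
  have h0 : 0 < specVal t := by
    unfold specVal
    have : 0 < 1 / t := by apply one_div_pos.2; linarith
    linarith
  have h1 := sum_le_mul_forestSum (m := m) ht
  nlinarith

/-- The intermediate value theorem for the apex equation on `[n - 4, n]`. The location `t ≥ n - 4`
is what turns a large order into the smallness of `1 - pathWeight`. -/
theorem exists_specVal {n : ℕ} (hn : 6 ≤ n) (hsum : ∑ i, m i + 1 = n) :
    ∃ t : ℝ, 1 < t ∧ (n : ℝ) - 4 ≤ t ∧ ∑ i, (m i : ℝ) + forestSum m t = specVal t := by
  have hn' : (6 : ℝ) ≤ n := by exact_mod_cast hn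
  have hsum' : ∑ i, (m i : ℝ) = n - 1 := by
    rw [← hsum]
    push_cast
    ring
  have hcont : ContinuousOn (fun t => specVal t - forestSum m t) (Icc ((n : ℝ) - 4) n) := by
    unfold specVal forestSum pathVal
    have hpos : ∀ t ∈ Icc ((n : ℝ) - 4) n, 1 < t := fun t ht => by linarith [ht.1]
    refine ContinuousOn.sub ?_ ?_
    · refine ContinuousOn.add (ContinuousOn.add continuousOn_id ?_) continuousOn_const
      exact continuousOn_const.div continuousOn_id fun t ht => by linarith [hpos t ht]
    · refine continuousOn_finsetSum _ fun i _ => continuousOn_finsetSum _ fun k _ => ?_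
      refine ContinuousOn.mul (ContinuousOn.div continuousOn_id (by fun_prop) ?_)
        (ContinuousOn.sub continuousOn_const (ContinuousOn.div (by fun_prop) (by fun_prop) ?_))
      · intro t ht
        have := hpos t ht
        have : t - 1 ≠ 0 := by linarith
        positivity
      · intro t ht
        have := hpos t ht
        have : 0 < t := by linarith
        positivity
  have hlow : specVal ((n : ℝ) - 4) - forestSum m ((n : ℝ) - 4) ≤ n - 1 := by
    have ht : 1 < (n : ℝ) - 4 := by linarith
    have h1 := sum_le_mul_forestSum (m := m) ht
    rw [hsum'] at h1
    have h2 : 1 / ((n : ℝ) - 4) ≤ 1 / 2 := one_div_le_one_div_of_le (by norm_num) (by linarith)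
    have h3 : 0 < 1 / ((n : ℝ) - 4) := by apply one_div_pos.2; linarith
    unfold specVal at h1 ⊢
    by_contra hcon
    push Not at hcon
    have h4 : forestSum m ((n : ℝ) - 4) < 1 / 2 := by linarith
    have h5 := forestSum_nonneg (m := m) ht
    nlinarith
  have hhigh : (n : ℝ) - 1 ≤ specVal n - forestSum m n := by
    have ht : 1 < (n : ℝ) := by linarith
    have h1 : forestSum m (n : ℝ) ≤ 2 := by
      rw [forestSum_eq ht, hsum']
      have hw : 0 ≤ ∑ i, pathWeight (n : ℝ) (m i) := Finset.sum_nonneg fun i _ => by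
        have : (1 : ℝ) ≤ (n : ℝ) ^ m i := one_le_pow₀ ht.le
        exact div_nonneg (by linarith) (by linarith)
      have h4 : 0 ≤ 4 * (n : ℝ) / ((n : ℝ) ^ 2 - 1) :=
        div_nonneg (by linarith) (by nlinarith)
      have h5 : (n : ℝ) / ((n : ℝ) - 1) ^ 2 * (n - 1) ≤ 2 := by
        rw [div_mul_eq_mul_div, div_le_iff₀ (by nlinarith)]
        nlinarith
      have h6 : 0 ≤ (n : ℝ) / ((n : ℝ) - 1) ^ 2 := by positivity
      have h7 := mul_nonneg h6 (mul_nonneg h4 hw)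
      linarith
    unfold specVal
    have h3 : 0 < 1 / (n : ℝ) := by apply one_div_pos.2; linarith
    linarith
  obtain ⟨t, ht, heq⟩ := intermediate_value_Icc (by linarith) hcont ⟨hlow, hhigh⟩
  refine ⟨t, by linarith [ht.1], ht.1, ?_⟩
  simp only at heq
  rw [hsum']
  linarith

theorem qIndex_cone_lt_of_weight_lt {κ : Type*} [Fintype κ] {m' : κ → ℕ} (ht : 1 < t)
    (hsum : ∑ i, m i = ∑ j, m' j) (h : ∑ j, (m' j : ℝ) + forestSum m' t = specVal t)
    (hw : ∑ j, pathWeight t (m' j) < ∑ i, pathWeight t (m i)) :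
    qIndex (cone (pathForest m)) < specVal t := by
  apply qIndex_cone_lt ht
  rw [← h]
  have hs : ∑ i, (m i : ℝ) = ∑ j, (m' j : ℝ) := by exact_mod_cast hsum
  rw [hs]
  rw [forestSum_eq ht, forestSum_eq ht, hs]
  have h1 : 0 < t / (t - 1) ^ 2 := div_pos (by linarith) (by nlinarith)
  have h2 : 0 < 4 * t / (t ^ 2 - 1) := div_pos (by linarith) (by nlinarith)
  have := mul_lt_mul_of_pos_left hw h2
  have := mul_lt_mul_of_pos_left (sub_lt_sub_left this (∑ j, (m' j : ℝ))) h1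
  linarith

end ConeSpectrum

end OuterplanarQ

/-! ### Strict concavity of the weight and majorization of partitions. -/

namespace OuterplanarQ
open SimpleGraph

section Majorization

variable {t : ℝ}

/-- The increments of `pathWeight`. -/
noncomputable def weightStep (t : ℝ) (m : ℕ) : ℝ := pathWeight t (m + 1) - pathWeight t m

theorem pathWeight_zero : pathWeight t 0 = 0 := by simp [pathWeight]

theorem weightStep_eq (ht : 1 < t) (m : ℕ) :
    weightStep t m = 2 * (t - 1) * t ^ m / ((t ^ m + 1) * (t ^ (m + 1) + 1)) := by
  have h0 : 0 < t := by linarith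
  have h1 : t ^ m + 1 ≠ 0 := by positivity
  have h2 : t ^ (m + 1) + 1 ≠ 0 := by positivity
  unfold weightStep pathWeight
  field_simp
  ring

theorem weightStep_pos (ht : 1 < t) (m : ℕ) : 0 < weightStep t m := by
  rw [weightStep_eq ht]
  have h0 : 0 < t := by linarith
  have h1 : 0 < t - 1 := by linarith
  positivity

theorem weightStep_succ_lt (ht : 1 < t) (m : ℕ) : weightStep t (m + 1) < weightStep t m := by
  rw [weightStep_eq ht, weightStep_eq ht]
  have h0 : 0 < t := by linarith
  have h1 : 0 < t - 1 := by linarith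
  have hm : 1 ≤ t ^ m := one_le_pow₀ ht.le
  rw [div_lt_div_iff₀ (by positivity) (by positivity)]
  have e1 : t ^ (m + 1) = t ^ m * t := pow_succ _ _
  have e2 : t ^ (m + 1 + 1) = t ^ m * t * t := by rw [pow_succ, pow_succ]
  rw [e1, e2]
  set x := t ^ m
  have key : t * (x + 1) < x * t * t + 1 := by
    nlinarith [mul_pos h1 (by nlinarith : 0 < x * t - 1)]
  have hc : 0 < 2 * (t - 1) * x * (x * t + 1) := by positivity
  nlinarith [mul_lt_mul_of_pos_left key hc]

theorem weightStep_antitone (ht : 1 < t) : Antitone (weightStep t) :=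
  antitone_nat_of_succ_le fun m => (weightStep_succ_lt ht m).le

theorem pathWeight_strictMono (ht : 1 < t) : StrictMono (pathWeight t) :=
  strictMono_nat_of_lt_succ fun m => by
    have := weightStep_pos ht m
    unfold weightStep at this
    linarith

theorem pathWeight_lt_one (ht : 1 < t) (m : ℕ) : pathWeight t m < 1 := by
  have h0 : 0 < t := by linarith
  rw [pathWeight, div_lt_one (by positivity)]
  linarith

theorem mul_weightStep_le (ht : 1 < t) (m : ℕ) : m * weightStep t m ≤ pathWeight t m := by
  induction m with
  | zero => simp [pathWeight_zero]
  | succ m ih =>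
    have h1 := (weightStep_succ_lt ht m).le
    have h2 : pathWeight t (m + 1) = pathWeight t m + weightStep t m := by
      unfold weightStep
      ring
    have h3 := mul_le_mul_of_nonneg_left h1 (Nat.cast_nonneg (α := ℝ) (m + 1))
    push_cast at h3 ⊢
    linarith

/-- Concavity together with the value 0 at 0: the ratio `pathWeight t m / m` decreases. -/
theorem mul_pathWeight_le (ht : 1 < t) {m s : ℕ} (h : m ≤ s) :
    m * pathWeight t s ≤ s * pathWeight t m := by
  induction s, h using Nat.le_induction with
  | base => rfl
  | succ s hs ih =>
    have h1 := mul_weightStep_le ht m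
    have h2 := mul_le_mul_of_nonneg_left (weightStep_antitone ht hs) (Nat.cast_nonneg (α := ℝ) m)
    have h3 : pathWeight t (s + 1) = pathWeight t s + weightStep t s := by
      unfold weightStep
      ring
    rw [h3]
    push_cast
    linarith

/-- Abel summation. It writes the weight as a combination of the truncations `min m h` with the
positive coefficients given by strict concavity, up to a term linear in `m`. -/
theorem sum_weightStep_mul_min (t : ℝ) (m M : ℕ) :
    ∑ h ∈ Finset.range M, (weightStep t h - weightStep t (h + 1)) * (min m (h + 1) : ℕ) =
      pathWeight t (min m M) - weightStep t M * (min m M : ℕ) := by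
  induction M with
  | zero => simp [pathWeight_zero]
  | succ M ih =>
    rw [Finset.sum_range_succ, ih]
    rcases le_or_gt m M with h | h
    · rw [min_eq_left h, min_eq_left (by omega)]
      ring
    · rw [min_eq_right h.le, min_eq_right (by omega)]
      have h3 : pathWeight t (M + 1) = pathWeight t M + weightStep t M := by
        unfold weightStep
        ring
      rw [h3]
      push_cast
      ring

variable {ι κ : Type*} [Fintype ι] [Fintype κ] {m : ι → ℕ} {m' : κ → ℕ}

theorem sum_pathWeight_eq {M : ℕ} (hM : ∀ i, m i ≤ M) (t : ℝ) :
    ∑ i, pathWeight t (m i) = weightStep t M * (∑ i, m i : ℕ) +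
      ∑ h ∈ Finset.range M, (weightStep t h - weightStep t (h + 1)) *
        (∑ i, min (m i) (h + 1) : ℕ) := by
  have h1 : ∀ i, pathWeight t (m i) = weightStep t M * (m i : ℕ) +
      ∑ h ∈ Finset.range M, (weightStep t h - weightStep t (h + 1)) * (min (m i) (h + 1) : ℕ) := by
    intro i
    rw [sum_weightStep_mul_min, min_eq_left (hM i)]
    ring
  rw [Finset.sum_congr rfl fun i _ => h1 i, Finset.sum_add_distrib, ← Finset.mul_sum,
    Finset.sum_comm]
  congr 1
  · push_cast
    rfl
  · refine Finset.sum_congr rfl fun h _ => ?_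
    rw [← Finset.mul_sum]
    push_cast
    rfl

/-- Karamata's inequality with majorization expressed by truncated sums. All coefficients of the
truncated sums are positive, so one strict inequality suffices; `M` is chosen to exceed all parts
and the level `h₀`. -/
theorem sum_pathWeight_lt (ht : 1 < t) (hsum : ∑ i, m i = ∑ j, m' j)
    (hle : ∀ h, ∑ j, min (m' j) h ≤ ∑ i, min (m i) h)
    (hne : ∃ h, ∑ j, min (m' j) h ≠ ∑ i, min (m i) h) :
    ∑ j, pathWeight t (m' j) < ∑ i, pathWeight t (m i) := by
  obtain ⟨h₀, hh₀⟩ := hne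
  have hlt : ∑ j, min (m' j) h₀ < ∑ i, min (m i) h₀ := lt_of_le_of_ne (hle h₀) hh₀
  have hpos : h₀ ≠ 0 := by
    rintro rfl
    simp at hlt
  obtain ⟨k, rfl⟩ := Nat.exists_eq_succ_of_ne_zero hpos
  set M := (∑ i, m i) + k + 1 with hM
  have h1 : ∀ i, m i ≤ M := fun i => by
    have := Finset.single_le_sum (f := m) (fun _ _ => Nat.zero_le _) (Finset.mem_univ i)
    omega
  have h2 : ∀ j, m' j ≤ M := fun j => by
    have := Finset.single_le_sum (f := m') (fun _ _ => Nat.zero_le _) (Finset.mem_univ j)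
    omega
  rw [sum_pathWeight_eq h1, sum_pathWeight_eq h2, hsum]
  have hd : ∀ h, 0 < weightStep t h - weightStep t (h + 1) := fun h =>
    sub_pos.2 (weightStep_succ_lt ht h)
  refine add_lt_add_right (Finset.sum_lt_sum (fun h _ => ?_)
    ⟨k, Finset.mem_range.2 (by omega), ?_⟩) _
  · exact mul_le_mul_of_nonneg_left (by exact_mod_cast hle (h + 1)) (hd h).le
  · exact mul_lt_mul_of_pos_left (by exact_mod_cast hlt) (hd k)

/-- The negative second difference of `h ↦ min m h` at `k` is the indicator of `m = k`. Hence
truncated sums determine the multiset of positive parts. -/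
theorem card_filter_eq_sum_min (m : ι → ℕ) {k : ℕ} (hk : 0 < k) :
    ((Finset.univ.filter fun i => m i = k).card : ℤ) =
      2 * (∑ i, min (m i) k : ℕ) - (∑ i, min (m i) (k - 1) : ℕ) -
        (∑ i, min (m i) (k + 1) : ℕ) := by
  rw [Finset.card_filter]
  push_cast
  rw [Finset.mul_sum, ← Finset.sum_sub_distrib, ← Finset.sum_sub_distrib]
  refine Finset.sum_congr rfl fun i _ => ?_
  split_ifs with hi <;> omega

theorem card_eq_of_sum_min_eq (h : ∀ h, ∑ i, min (m i) h = ∑ j, min (m' j) h) {k : ℕ}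
    (hk : 0 < k) : (Finset.univ.filter fun i => m i = k).card =
      (Finset.univ.filter fun j => m' j = k).card := by
  have h1 := card_filter_eq_sum_min m hk
  have h2 := card_filter_eq_sum_min m' hk
  rw [h, h, h, ← h2] at h1
  exact_mod_cast h1

omit [Fintype ι] in
theorem sigma_fin_ext {x y : Σ i, Fin (m i)} (h1 : x.1 = y.1) (h2 : x.2.val = y.2.val) :
    x = y := by
  obtain ⟨x1, x2⟩ := x
  obtain ⟨y1, y2⟩ := y
  obtain rfl : x1 = y1 := h1
  congr
  exact Fin.ext h2

omit [Fintype ι] [Fintype κ] in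
theorem nonempty_pathForest_iso (e : {i // 0 < m i} ≃ {j // 0 < m' j})
    (he : ∀ i, m' (e i) = m i) : Nonempty (pathForest m ≃g pathForest m') := by
  have hpos : ∀ x : Σ i, Fin (m i), 0 < m x.1 := fun x => by have := x.2.isLt; omega
  let f : (Σ i, Fin (m i)) → Σ j, Fin (m' j) := fun x =>
    ⟨e ⟨x.1, hpos x⟩, Fin.cast (he ⟨x.1, hpos x⟩).symm x.2⟩
  have hfst : ∀ x y, (f x).1 = (f y).1 ↔ x.1 = y.1 := by
    intro x y
    constructor
    · intro h
      have := e.injective (Subtype.ext h)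
      exact congrArg Subtype.val this
    · intro h
      simp only [f]
      congr 3
  have hf : Function.Bijective f := by
    constructor
    · intro x y h
      exact sigma_fin_ext ((hfst x y).1 (congrArg Sigma.fst h))
        (by
          have : (f x).2.val = (f y).2.val := by rw [h]
          exact this)
    · rintro ⟨j, k⟩
      have hj : 0 < m' j := by have := k.isLt; omega
      have h1 : m' j = m (e.symm ⟨j, hj⟩) := by
        have := he (e.symm ⟨j, hj⟩)
        rw [e.apply_symm_apply] at this
        exact this
      refine ⟨⟨e.symm ⟨j, hj⟩, Fin.cast h1 k⟩, sigma_fin_ext ?_ rfl⟩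
      simp [f]
  refine ⟨⟨Equiv.ofBijective f hf, ?_⟩⟩
  intro x y
  simp only [pathForest, Equiv.ofBijective_apply, hfst]
  rfl

theorem nonempty_pathForest_iso_of_sum_min_eq
    (h : ∀ h, ∑ i, min (m i) h = ∑ j, min (m' j) h) :
    Nonempty (pathForest m ≃g pathForest m') := by
  classical
  have hfib : ∀ k : ℕ, Nonempty ({i : {i // 0 < m i} // m i = k} ≃
      {j : {j // 0 < m' j} // m' j = k}) := by
    intro k
    rcases Nat.eq_zero_or_pos k with rfl | hk
    · have : IsEmpty {i : {i // 0 < m i} // m i = 0} := ⟨fun x => by have := x.1.2; have := x.2; omega⟩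
      have : IsEmpty {j : {j // 0 < m' j} // m' j = 0} := ⟨fun x => by have := x.1.2; have := x.2; omega⟩
      exact ⟨Equiv.equivOfIsEmpty _ _⟩
    · have h1 : {i : {i // 0 < m i} // m i = k} ≃ {i // m i = k} :=
        Equiv.subtypeSubtypeEquivSubtype (p := fun i => 0 < m i) (q := fun i => m i = k)
          (fun h => by omega)
      have h2 : {j : {j // 0 < m' j} // m' j = k} ≃ {j // m' j = k} :=
        Equiv.subtypeSubtypeEquivSubtype (p := fun j => 0 < m' j) (q := fun j => m' j = k)
          (fun h => by omega)
      have h3 : Fintype.card {i // m i = k} = Fintype.card {j // m' j = k} := by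
        rw [Fintype.card_subtype, Fintype.card_subtype]
        exact card_eq_of_sum_min_eq h hk
      exact ⟨h1.trans ((Fintype.equivOfCardEq h3).trans h2.symm)⟩
  have hfib' := fun k => (hfib k).some
  refine nonempty_pathForest_iso
    (Equiv.ofFiberEquiv (f := fun i : {i // 0 < m i} => m i)
      (g := fun j : {j // 0 < m' j} => m' j) hfib') ?_
  intro i
  exact Equiv.ofFiberEquiv_map (f := fun i : {i // 0 < m i} => m i)
      (g := fun j : {j // 0 < m' j} => m' j) hfib' i

/-- If the sums of few parts are as small as in the extremal partition, then the
partition is majorized by the extremal one. -/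
theorem sum_min_extremalParts_le {A B α r : ℕ} (hBA : B ≤ A) (hr : r ≤ B)
    (hsum : A + α * B + r = ∑ i, m i)
    (hS : ∀ S : Finset ι, S.Nonempty → ∑ i ∈ S, m i ≤ A + (S.card - 1) * B) (h : ℕ) :
    ∑ j, min (extremalParts A α B r j) h ≤ ∑ i, min (m i) h := by
  classical
  have e1 : ∑ j, min (extremalParts A α B r j) h = min A h + α * min B h + min r h := by
    simp [extremalParts, Fintype.sum_sum_type]
  rw [e1]
  set S := Finset.univ.filter fun i => h < m i with hSdef
  -- Truncation at `h` loses exactly the excess over `h` of the parts in `S`, and `hS` bounds their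
  -- sum by that of the `S.card` largest parts in an unlimited supply `A, B, B, …`.
  have e2 : (∑ i, min (m i) h) + ∑ i ∈ S, m i = ∑ i, m i + S.card * h := by
    rw [hSdef, Finset.sum_filter, Finset.card_filter, Finset.sum_mul, ← Finset.sum_add_distrib,
      ← Finset.sum_add_distrib]
    refine Finset.sum_congr rfl fun i _ => ?_
    split_ifs with hi
    · rw [min_eq_right hi.le]
      ring
    · rw [min_eq_left (by omega)]
      ring
  have hb : α * min B h ≤ α * B := Nat.mul_le_mul_left _ (min_le_left _ _)
  rcases S.eq_empty_or_nonempty with hE | hE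
  · rw [hE] at e2
    simp only [Finset.sum_empty, Finset.card_empty, zero_mul, add_zero] at e2
    rw [e2, ← hsum]
    have := min_le_left A h
    have := min_le_left r h
    omega
  · have h1 := hS S hE
    have h2 : ∑ i ∈ S, m i ≤ ∑ i, m i :=
      Finset.sum_le_sum_of_subset_of_nonneg (Finset.subset_univ _) fun _ _ _ => Nat.zero_le _
    have hcard : 0 < S.card := hE.card_pos
    obtain ⟨j, hj⟩ : ∃ j, S.card = j + 1 := ⟨S.card - 1, by omega⟩
    rw [hj, Nat.add_sub_cancel] at h1
    rw [hj] at e2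
    rcases le_or_gt B h with hh | hh
    · rw [min_eq_left hh, min_eq_left (hr.trans hh)]
      have := min_le_right A h
      have h3 : j * B ≤ j * h := Nat.mul_le_mul_left _ hh
      have h4 : (j + 1) * h = j * h + h := by ring
      omega
    · rw [min_eq_right hh.le, min_eq_right (by omega : h ≤ A)]
      rcases le_or_gt j α with hja | hja
      · obtain ⟨d, rfl⟩ := Nat.exists_eq_add_of_le hja
        have := min_le_left r h
        have h4 : (j + 1) * h = j * h + h := by ring
        have h5 : (j + d) * B = j * B + d * B := by ring
        have h6 : (j + d) * h = j * h + d * h := by ring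
        have h7 : d * h ≤ d * B := Nat.mul_le_mul_left _ hh.le
        omega
      · have := min_le_right r h
        have h4 : (α + 2) * h ≤ (j + 1) * h := Nat.mul_le_mul_right _ (by omega)
        have h5 : (α + 2) * h = α * h + h + h := by ring
        omega

end Majorization

end OuterplanarQ

/-! ### Packing copies of a path into a cone over paths. -/

namespace OuterplanarQ
open SimpleGraph

section Packing

variable {V : Type*} {G : SimpleGraph V} {t ℓ : ℕ}

theorem not_free_copies {T : Type*} [Fintype T] (ht : t ≤ Fintype.card T) (F : T → ℕ → V)
    (hadj : ∀ x k, k + 1 < ℓ → G.Adj (F x k) (F x (k + 1)))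
    (hinj : ∀ x y k l, k < ℓ → l < ℓ → F x k = F y l → x = y ∧ k = l) :
    ¬ (copies t (pathGraph ℓ)).Free G := by
  obtain ⟨g⟩ : Nonempty (Fin t ↪ T) :=
    Function.Embedding.nonempty_of_card_le (by rwa [Fintype.card_fin])
  rw [SimpleGraph.Free, not_not]
  refine ⟨⟨⟨fun x => F (g x.1) x.2, ?_⟩, ?_⟩⟩
  · rintro ⟨x, k⟩ ⟨y, l⟩ ⟨h1, h2⟩
    obtain rfl : x = y := h1
    rw [pathGraph_adj] at h2
    have hk := k.isLt
    have hl := l.isLt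
    rcases h2 with h2 | h2
    · have := hadj (g x) k (by simp only at h2; omega)
      simp only at h2
      rw [h2] at this
      exact this
    · have := hadj (g x) l (by simp only at h2; omega)
      simp only at h2
      rw [h2] at this
      exact this.symm
  · rintro ⟨x, k⟩ ⟨y, l⟩ h
    obtain ⟨h1, h2⟩ := hinj _ _ _ _ k.isLt l.isLt h
    exact Prod.ext (g.injective h1) (Fin.ext h2)

theorem exists_paths_of_isContained (h : (copies t (pathGraph ℓ)).IsContained G) :
    ∃ F : Fin t → Fin ℓ → V, (∀ x k l, k.val + 1 = l.val → G.Adj (F x k) (F x l)) ∧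
      ∀ x y k l, F x k = F y l → x = y ∧ k = l := by
  obtain ⟨f⟩ := h
  refine ⟨fun x k => f (x, k), fun x k l hkl => ?_, fun x y k l h => ?_⟩
  · exact f.toHom.map_adj ⟨rfl, pathGraph_adj.2 (Or.inl hkl)⟩
  · have := f.injective h
    exact ⟨congrArg Prod.fst this, congrArg Prod.snd this⟩

theorem cone_adj_some {W : Type*} {H : SimpleGraph W} {x y : W} :
    (cone H).Adj (some x) (some y) ↔ H.Adj x y := by
  simp only [cone, Option.mem_def, Option.some.injEq, forall_eq', ne_eq]
  exact ⟨fun h => h.2, fun h => ⟨h.ne, h⟩⟩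

theorem cone_adj_none {W : Type*} {H : SimpleGraph W} {x : W} :
    (cone H).Adj none (some x) := by simp [cone]

theorem connected_cone {W : Type*} (H : SimpleGraph W) : (cone H).Connected := by
  have : ∀ x, (cone H).Reachable none x := by
    rintro (_ | x)
    · rfl
    · exact cone_adj_none.reachable
  exact ⟨fun x y => (this x).symm.trans (this y)⟩

variable {ι : Type*} [Fintype ι] {m : ι → ℕ}

/-- Each path is cut into blocks of `ℓ` consecutive vertices. -/
theorem sum_div_lt_of_free (hℓ : 0 < ℓ)
    (h : (copies t (pathGraph ℓ)).Free (cone (pathForest m))) : ∑ i, m i / ℓ < t := by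
  by_contra hcon
  push Not at hcon
  have hlt : ∀ (x : Σ i, Fin (m i / ℓ)) k, k < ℓ → x.2.val * ℓ + k < m x.1 := by
    intro x k hk
    have h1 := x.2.isLt
    have h2 : (x.2.val + 1) * ℓ ≤ m x.1 / ℓ * ℓ := Nat.mul_le_mul_right _ h1
    have h3 := Nat.div_mul_le_self (m x.1) ℓ
    have h4 : (x.2.val + 1) * ℓ = x.2.val * ℓ + ℓ := by ring
    omega
  refine not_free_copies (T := Σ i, Fin (m i / ℓ)) (by simpa using hcon)
    (fun x k => if hk : k < ℓ then some ⟨x.1, ⟨x.2.val * ℓ + k, hlt x k hk⟩⟩ else none)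
    ?_ ?_ h
  · intro x k hk
    rw [dif_pos hk, dif_pos (by omega), cone_adj_some]
    exact ⟨rfl, Or.inl rfl⟩
  · rintro ⟨i, x⟩ ⟨j, y⟩ k l hk hl hxy
    rw [dif_pos hk, dif_pos hl, Option.some.injEq, Sigma.mk.injEq] at hxy
    obtain ⟨rfl, h2⟩ := hxy
    have h2 : x.val * ℓ + k = y.val * ℓ + l := congrArg Fin.val (eq_of_heq h2)
    have h3 : x.val = y.val := by
      have e1 : (x.val * ℓ + k) / ℓ = x.val := by
        rw [Nat.add_comm, Nat.add_mul_div_right _ _ hℓ, Nat.div_eq_of_lt hk, zero_add]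
      have e2 : (y.val * ℓ + l) / ℓ = y.val := by
        rw [Nat.add_comm, Nat.add_mul_div_right _ _ hℓ, Nat.div_eq_of_lt hl, zero_add]
      rw [← e1, ← e2, h2]
    rw [h3] at h2
    obtain rfl : x = y := Fin.ext h3
    exact ⟨rfl, by omega⟩

/-- The blocks already give `t - 1` copies. The remainders of two components, joined through the
apex, form a path with `m i % ℓ + 1 + m j % ℓ` vertices, which must be shorter than `ℓ`. -/
theorem mod_add_mod_of_free (hℓ : 0 < ℓ)
    (h : (copies t (pathGraph ℓ)).Free (cone (pathForest m))) (ht : t ≤ ∑ i, m i / ℓ + 1)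
    {i j : ι} (hij : i ≠ j) : m i % ℓ + m j % ℓ + 2 ≤ ℓ := by
  by_contra hcon
  push Not at hcon
  have hlt : ∀ (x : Σ i, Fin (m i / ℓ)) k, k < ℓ → x.2.val * ℓ + k < m x.1 / ℓ * ℓ := by
    intro x k hk
    have h1 := x.2.isLt
    have h2 : (x.2.val + 1) * ℓ ≤ m x.1 / ℓ * ℓ := Nat.mul_le_mul_right _ h1
    have h4 : (x.2.val + 1) * ℓ = x.2.val * ℓ + ℓ := by ring
    omega
  have hmod : ∀ i, m i / ℓ * ℓ + m i % ℓ = m i := fun i => Nat.div_add_mod' _ _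
  -- points of the forest, given by component and position
  let pt : ι → ℕ → Option (Σ i, Fin (m i)) := fun i k =>
    if hk : k < m i then some ⟨i, ⟨k, hk⟩⟩ else none
  have hpt_adj : ∀ i k, k + 1 < m i → (cone (pathForest m)).Adj (pt i k) (pt i (k + 1)) := by
    intro i k hk
    simp only [pt]
    rw [dif_pos hk, dif_pos (by omega), cone_adj_some]
    exact ⟨rfl, Or.inl rfl⟩
  have hpt_none : ∀ i k, k < m i → (cone (pathForest m)).Adj none (pt i k) := by
    intro i k hk
    simp only [pt]
    rw [dif_pos hk]
    exact cone_adj_none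
  have hpt_ne : ∀ i k, k < m i → pt i k ≠ none := by
    intro i k hk
    simp only [pt]
    rw [dif_pos hk]
    exact Option.some_ne_none _
  have hpt_inj : ∀ i j k l, k < m i → l < m j → pt i k = pt j l → i = j ∧ k = l := by
    intro i j k l hk hl hh
    simp only [pt] at hh
    rw [dif_pos hk, dif_pos hl, Option.some.injEq, Sigma.mk.injEq] at hh
    obtain ⟨rfl, h2⟩ := hh
    exact ⟨rfl, congrArg Fin.val (eq_of_heq h2)⟩
  -- The index `none` stands for the additional path: the remainder of component `i`, the apex, then
  -- an initial stretch of the remainder of component `j`.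
  let F : Option (Σ i, Fin (m i / ℓ)) → ℕ → Option (Σ i, Fin (m i)) := fun x k =>
    match x with
    | some x => pt x.1 (x.2.val * ℓ + k)
    | none => if k < m i % ℓ then pt i (m i / ℓ * ℓ + k) else
        if k = m i % ℓ then none else pt j (m j / ℓ * ℓ + (k - m i % ℓ - 1))
  have hi := hmod i
  have hj := hmod j
  -- the last path uses only leftover vertices
  have hextra : ∀ k, k < ℓ → F none k = none ∧ k = m i % ℓ ∨
      k < m i % ℓ ∧ F none k = pt i (m i / ℓ * ℓ + k) ∨
      m i % ℓ < k ∧ F none k = pt j (m j / ℓ * ℓ + (k - m i % ℓ - 1)) := by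
    intro k hk
    simp only [F]
    rcases lt_trichotomy k (m i % ℓ) with h | h | h
    · exact Or.inr (Or.inl ⟨h, if_pos h⟩)
    · exact Or.inl ⟨by rw [if_neg (by omega), if_pos h], h⟩
    · exact Or.inr (Or.inr ⟨h, by rw [if_neg (by omega), if_neg (by omega)]⟩)
  have hsep : ∀ (x : Σ i, Fin (m i / ℓ)) k l, k < ℓ → l < ℓ → F (some x) k ≠ F none l := by
    intro x k l hk hl hh
    have h1 := hlt x k hk
    have h2 := hmod x.1
    rcases hextra l hl with ⟨h3, -⟩ | ⟨h4, h3⟩ | ⟨h4, h3⟩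
    · rw [h3] at hh
      exact hpt_ne _ _ (by omega) hh
    · rw [h3] at hh
      obtain ⟨rfl, h5⟩ := hpt_inj _ _ _ _ (by omega) (by omega) hh
      omega
    · rw [h3] at hh
      obtain ⟨rfl, h5⟩ := hpt_inj _ _ _ _ (by omega) (by omega) hh
      omega
  refine not_free_copies (T := Option (Σ i, Fin (m i / ℓ)))
    (by simpa [Fintype.card_option] using ht) F ?_ ?_ h
  · rintro (_ | x) k hk
    · rcases hextra k (by omega) with ⟨h3, h4⟩ | ⟨h4, h3⟩ | ⟨h4, h3⟩ <;>
      rcases hextra (k + 1) hk with ⟨h5, h6⟩ | ⟨h6, h5⟩ | ⟨h6, h5⟩ <;>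
      rw [h3, h5] <;> try omega
      · exact hpt_none _ _ (by omega)
      · exact (hpt_none _ _ (by omega)).symm
      · exact hpt_adj _ _ (by omega)
      · have : k + 1 - m i % ℓ - 1 = k - m i % ℓ - 1 + 1 := by omega
        rw [this]
        exact hpt_adj _ _ (by omega)
    · have h1 := hlt x (k + 1) hk
      have h2 := hmod x.1
      exact hpt_adj _ _ (by omega)
  · rintro (_ | x) (_ | y) k l hk hl hxy
    · refine ⟨rfl, ?_⟩
      rcases hextra k hk with ⟨h3, h4⟩ | ⟨h4, h3⟩ | ⟨h4, h3⟩ <;>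
      rcases hextra l hl with ⟨h5, h6⟩ | ⟨h6, h5⟩ | ⟨h6, h5⟩ <;>
      rw [h3, h5] at hxy
      · omega
      · exact absurd hxy.symm (hpt_ne _ _ (by omega))
      · exact absurd hxy.symm (hpt_ne _ _ (by omega))
      · exact absurd hxy (hpt_ne _ _ (by omega))
      · have := hpt_inj _ _ _ _ (by omega) (by omega) hxy
        omega
      · have := hpt_inj _ _ _ _ (by omega) (by omega) hxy
        exact absurd this.1 hij
      · exact absurd hxy (hpt_ne _ _ (by omega))
      · have := hpt_inj _ _ _ _ (by omega) (by omega) hxy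
        exact absurd this.1.symm hij
      · have := hpt_inj _ _ _ _ (by omega) (by omega) hxy
        omega
    · exact absurd hxy.symm (hsep y l k hl hk)
    · exact absurd hxy (hsep x k l hk hl)
    · have h1 := hlt x k hk
      have h2 := hmod x.1
      have h3 := hlt y l hl
      have h4 := hmod y.1
      obtain ⟨i', x⟩ := x
      obtain ⟨j', y⟩ := y
      obtain ⟨h5, h6⟩ := hpt_inj _ _ _ _ (by omega) (by omega) hxy
      obtain rfl : i' = j' := h5
      simp only at h6
      have h3 : x.val = y.val := by
        have e1 : (x.val * ℓ + k) / ℓ = x.val := by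
          rw [Nat.add_comm, Nat.add_mul_div_right _ _ hℓ, Nat.div_eq_of_lt hk, zero_add]
        have e2 : (y.val * ℓ + l) / ℓ = y.val := by
          rw [Nat.add_comm, Nat.add_mul_div_right _ _ hℓ, Nat.div_eq_of_lt hl, zero_add]
        rw [← e1, ← e2, h6]
      rw [h3] at h6
      obtain rfl : x = y := Fin.ext h3
      exact ⟨rfl, by omega⟩

omit [Fintype ι] in
theorem fst_eq_of_avoids_apex {p : ℕ → Option (Σ i, Fin (m i))} {a b : ℕ} (hab : a ≤ b)
    (hadj : ∀ k, a ≤ k → k < b → (cone (pathForest m)).Adj (p k) (p (k + 1)))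
    (hne : ∀ k, a ≤ k → k ≤ b → p k ≠ none) :
    (p a).map Sigma.fst = (p b).map Sigma.fst := by
  induction b, hab using Nat.le_induction with
  | base => rfl
  | succ b hb ih =>
    rw [ih (fun k h1 h2 => hadj k h1 (by omega)) (fun k h1 h2 => hne k h1 (by omega))]
    have h1 := hadj b hb (by omega)
    obtain ⟨x, hx⟩ := Option.ne_none_iff_exists'.1 (hne b hb (by omega))
    obtain ⟨y, hy⟩ := Option.ne_none_iff_exists'.1 (hne (b + 1) (by omega) le_rfl)
    rw [hx, hy, cone_adj_some] at h1
    rw [hx, hy]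
    exact congrArg some h1.1

omit [Fintype ι] in
theorem card_component_le [DecidableEq ι] (S : Finset ι) {T : Type*} [Fintype T]
    (g : T → Σ i, Fin (m i)) (hg : Function.Injective g) (hS : ∀ x, (g x).1 ∈ S) :
    Fintype.card T ≤ ∑ i ∈ S, m i := by
  have h1 : Fintype.card T ≤ (S.sigma fun i => (Finset.univ : Finset (Fin (m i)))).card :=
    Finset.card_le_card_of_injOn (s := Finset.univ) g (fun x _ => by
      simp only [Finset.coe_sigma, Finset.coe_univ]
      exact ⟨hS x, trivial⟩) hg.injOn
  simpa using h1

-- A path uses the apex at most once, so its other vertices lie in the components of its first and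
-- last vertices; but it needs `ℓ - 1` of them. For `i = j` the sum in `hm` counts the component
-- only once.
omit [Fintype ι] in
theorem free_path_cone [Nonempty ι] [DecidableEq ι] (hm : ∀ i j, ∑ c ∈ {i, j}, m c + 2 ≤ ℓ) :
    (copies 1 (pathGraph ℓ)).Free (cone (pathForest m)) := by
  intro hcon
  obtain ⟨F, hadj, hinj⟩ := exists_paths_of_isContained hcon
  obtain ⟨i₀⟩ := ‹Nonempty ι›
  have hℓ : 2 ≤ ℓ := by have := hm i₀ i₀; omega
  set p : ℕ → Option (Σ i, Fin (m i)) := fun k => if hk : k < ℓ then F 0 ⟨k, hk⟩ else none with hp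
  have hpF : ∀ k (hk : k < ℓ), p k = F 0 ⟨k, hk⟩ := fun k hk => dif_pos hk
  have hpadj : ∀ k, k + 1 < ℓ → (cone (pathForest m)).Adj (p k) (p (k + 1)) := by
    intro k hk
    rw [hpF k (by omega), hpF (k + 1) hk]
    exact hadj 0 _ _ rfl
  have hpinj : ∀ k l, k < ℓ → l < ℓ → p k = p l → k = l := by
    intro k l hk hl h
    rw [hpF k hk, hpF l hl] at h
    exact congrArg Fin.val (hinj _ _ _ _ h).2
  -- The default `i₀` is the value at the apex. It is harmless because `hm` bounds every pair of
  -- components.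
  let comp : Option (Σ i, Fin (m i)) → ι := fun x => (x.map Sigma.fst).getD i₀
  have hcomp : ∀ k (x : Σ i, Fin (m i)), k < ℓ → p k = some x →
      x.1 = comp (p 0) ∨ x.1 = comp (p (ℓ - 1)) := by
    intro k x hk hx
    have hxc : x.1 = comp (p k) := by simp [comp, hx]
    by_cases h : ∃ l, l ≤ k ∧ p l = none
    · right
      obtain ⟨l, hl, hl0⟩ := h
      have := fst_eq_of_avoids_apex (p := p) (a := k) (b := ℓ - 1) (by omega)
        (fun j _ h2 => hpadj j (by omega)) (fun j h1 h2 h3 => by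
          have := hpinj l j (by omega) (by omega) (hl0.trans h3.symm)
          have : k = l := by omega
          subst this
          rw [hl0] at hx
          cases hx)
      rw [hxc]
      simp only [comp, this]
    · left
      push Not at h
      have := fst_eq_of_avoids_apex (p := p) (a := 0) (b := k) (by omega)
        (fun j _ h2 => hpadj j (by omega)) (fun j h1 h2 => h j h2)
      rw [hxc]
      simp only [comp, this]
  -- The position of the apex, or an arbitrary one if the path avoids the apex.
  obtain ⟨k₀, hk₀⟩ : ∃ k₀ : Fin ℓ, ∀ k : Fin ℓ, k ≠ k₀ → p k ≠ none := by
    by_cases h : ∃ k₀ : Fin ℓ, p k₀ = none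
    · obtain ⟨k₀, h⟩ := h
      exact ⟨k₀, fun k hk h' => hk (Fin.ext (hpinj _ _ k.isLt k₀.isLt (h'.trans h.symm)))⟩
    · push Not at h
      exact ⟨⟨0, by omega⟩, fun k _ => h k⟩
  choose g hg using fun k : {k : Fin ℓ // k ≠ k₀} =>
    Option.ne_none_iff_exists'.1 (hk₀ k.1 k.2)
  have h1 := card_component_le {comp (p 0), comp (p (ℓ - 1))} g (fun x y hxy => by
      apply Subtype.ext
      apply Fin.ext
      apply hpinj _ _ x.1.isLt y.1.isLt
      rw [hg, hg, hxy]) (fun x => by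
      have := hcomp x.1 (g x) x.1.isLt (hg x)
      simpa using this)
  have h2 := hm (comp (p 0)) (comp (p (ℓ - 1)))
  have h3 : Fintype.card {k : Fin ℓ // k ≠ k₀} = ℓ - 1 := by
    rw [Fintype.card_subtype_compl, Fintype.card_fin, Fintype.card_subtype_eq]
  omega

-- At most one copy uses the apex. The other `t - 1` copies stay inside single components, and only
-- component `i₀` can have `ℓ` vertices, yet it has fewer than `(t - 1) ℓ`.
omit [Fintype ι] in
theorem free_copies_cone (ht : 0 < t) (hℓ : 0 < ℓ) {i₀ : ι} (hi₀ : m i₀ < (t - 1) * ℓ)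
    (hm : ∀ i, i ≠ i₀ → m i < ℓ) :
    (copies t (pathGraph ℓ)).Free (cone (pathForest m)) := by
  classical
  intro hcon
  obtain ⟨F, hadj, hinj⟩ := exists_paths_of_isContained hcon
  obtain ⟨x₀, hx₀⟩ : ∃ x₀ : Fin t, ∀ x, x ≠ x₀ → ∀ k, F x k ≠ none := by
    by_cases h : ∃ x₀ k₀, F x₀ k₀ = none
    · obtain ⟨x₀, k₀, h⟩ := h
      exact ⟨x₀, fun x hx k h' => hx (hinj _ _ _ _ (h'.trans h.symm)).1⟩
    · push Not at h
      exact ⟨⟨0, ht⟩, fun x _ => h x⟩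
  choose g hg using fun x : {x : Fin t // x ≠ x₀} × Fin ℓ =>
    Option.ne_none_iff_exists'.1 (hx₀ x.1.1 x.1.2 x.2)
  have hginj : Function.Injective g := fun x y hxy => by
    obtain ⟨h1, h2⟩ := hinj _ _ _ _ ((hg x).trans ((congrArg some hxy).trans (hg y).symm))
    exact Prod.ext (Subtype.ext h1) h2
  have hconst : ∀ x k, (g (x, k)).1 = (g (x, ⟨0, hℓ⟩)).1 := by
    intro x k
    set p : ℕ → Option (Σ i, Fin (m i)) := fun k => if hk : k < ℓ then F x ⟨k, hk⟩ else none
      with hp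
    have hpF : ∀ k (hk : k < ℓ), p k = F x ⟨k, hk⟩ := fun k hk => dif_pos hk
    have := fst_eq_of_avoids_apex (p := p) (a := 0) (b := k) (by omega)
      (fun j _ h2 => by
        have := k.isLt
        rw [hpF j (by omega), hpF (j + 1) (by omega)]
        exact hadj _ _ _ rfl)
      (fun j _ h2 => by
        have := k.isLt
        rw [hpF j (by omega)]
        exact hx₀ x.1 x.2 _)
    rw [hpF 0 hℓ, hpF k k.isLt, hg (x, ⟨0, hℓ⟩), hg (x, k)] at this
    simpa using this.symm
  have hcomp : ∀ x, (g x).1 = i₀ := by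
    rintro ⟨x, k⟩
    by_contra hne
    have h1 := card_component_le {(g (x, k)).1} (fun l : Fin ℓ => g (x, l))
      (fun a b hab => congrArg Prod.snd (hginj hab))
      (fun l => by rw [Finset.mem_singleton, hconst x l, hconst x k])
    have h2 := hm _ hne
    simp at h1
    omega
  have h1 := card_component_le {i₀} g hginj (fun x => by rw [Finset.mem_singleton, hcomp])
  rw [Fintype.card_prod, Fintype.card_subtype_compl, Fintype.card_fin, Fintype.card_fin,
    Fintype.card_subtype_eq, Finset.sum_singleton] at h1
  omega

end Packing

end OuterplanarQ

/-! ### Comparison of the weights of a free cone and of the extremal cone. -/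

namespace OuterplanarQ
open SimpleGraph

section Dominated

variable {ι : Type*} [Fintype ι] {m : ι → ℕ} {x : ℝ}

/-- If any two of the numbers `c i` add up to at most `ℓ - 2` but their total is larger, then the
second largest of them, `s`, bounds the total weight from below. -/
theorem exists_second_largest [Nonempty ι] (hx : 1 < x) {c : ι → ℕ} {ℓ Z : ℕ} (h1 : ∀ i, c i + 2 ≤ ℓ)
    (h2 : ∀ i j, i ≠ j → c i + c j + 2 ≤ ℓ) (hZ : 0 < Z) (hsum : ∑ i, c i + 2 = Z + ℓ) :
    ∃ (i₀ : ι) (s : ℕ), 1 ≤ s ∧ 2 * s + 2 ≤ ℓ ∧ c i₀ + s + 2 ≤ ℓ ∧ (∀ i, i ≠ i₀ → c i ≤ s) ∧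
      pathWeight x s * (2 * s + Z) ≤ s * ∑ i, pathWeight x (c i) := by
  classical
  obtain ⟨i₀, -, hi₀⟩ := Finset.exists_max_image Finset.univ c Finset.univ_nonempty
  have hsplit : ∑ i, c i = c i₀ + ∑ i ∈ Finset.univ.erase i₀, c i :=
    (Finset.add_sum_erase _ _ (Finset.mem_univ i₀)).symm
  have hi₀' := h1 i₀
  have hne' : (Finset.univ.erase i₀).Nonempty := by
    rw [Finset.nonempty_iff_ne_empty]
    intro h
    rw [h, Finset.sum_empty] at hsplit
    omega
  obtain ⟨i₁, hi₁, hmax⟩ := Finset.exists_max_image (Finset.univ.erase i₀) c hne'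
  have h3 := h2 i₀ i₁ (Finset.ne_of_mem_erase hi₁).symm
  have h4 := hi₀ i₁ (Finset.mem_univ _)
  have hs : 1 ≤ c i₁ := by
    by_contra h
    have : ∑ i ∈ Finset.univ.erase i₀, c i = 0 := Finset.sum_eq_zero fun i hi => by
      have := hmax i hi
      omega
    omega
  refine ⟨i₀, c i₁, hs, by omega, h3, fun i hi => hmax i (by simp [hi]), ?_⟩
  rw [← Finset.add_sum_erase _ _ (Finset.mem_univ i₀)]
  have h5 : pathWeight x (c i₁) ≤ pathWeight x (c i₀) := (pathWeight_strictMono hx).monotone h4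
  -- By concavity every part `c i ≤ s` carries at least the fraction `c i / s` of the weight of `s`.
  -- As `c i₀ ≤ ℓ - 2 - s`, these parts have total at least `Z + s`; the largest part contributes a
  -- further full weight of `s`.
  have h6 : ∑ i ∈ Finset.univ.erase i₀, (c i : ℝ) * pathWeight x (c i₁) ≤
      ∑ i ∈ Finset.univ.erase i₀, (c i₁ : ℝ) * pathWeight x (c i) :=
    Finset.sum_le_sum fun i hi => mul_pathWeight_le hx (hmax i hi)
  rw [← Finset.sum_mul, ← Finset.mul_sum] at h6
  have h7 : (Z : ℝ) + c i₁ ≤ ∑ i ∈ Finset.univ.erase i₀, (c i : ℝ) := by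
    have : Z + c i₁ ≤ ∑ i ∈ Finset.univ.erase i₀, c i := by omega
    exact_mod_cast this
  have h8 : 0 ≤ pathWeight x (c i₁) := by
    rw [← pathWeight_zero (t := x)]
    exact (pathWeight_strictMono hx).monotone (Nat.zero_le _)
  have h9 := mul_le_mul_of_nonneg_right h7 h8
  have h10 := mul_le_mul_of_nonneg_left h5 (Nat.cast_nonneg (α := ℝ) (c i₁))
  nlinarith

/-- All weights are below 1, so it suffices to count nonempty parts; a nonempty last part costs at
most `B ≤ B - 1 + r`. -/
theorem mul_sum_pathWeight_extremalParts_le (hx : 1 < x) {A B α r Z : ℕ} (hα : 0 < α)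
    (hZ : (α - 1) * B + r = Z) (hB : 0 < B) :
    (B : ℝ) * ∑ j, pathWeight x (extremalParts A α B r j) ≤ 3 * B + Z - 1 := by
  have e1 : ∑ j, pathWeight x (extremalParts A α B r j) =
      pathWeight x A + α * pathWeight x B + pathWeight x r := by
    simp [extremalParts, Fintype.sum_sum_type]
  rw [e1]
  have hA := (pathWeight_lt_one hx A).le
  have hB' := (pathWeight_lt_one hx B).le
  have hr := (pathWeight_lt_one hx r).le
  obtain ⟨k, rfl⟩ : ∃ k, α = k + 1 := ⟨α - 1, by omega⟩
  rw [Nat.add_sub_cancel] at hZ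
  have hB1 : (1 : ℝ) ≤ B := by exact_mod_cast hB
  have hZ' : (Z : ℝ) = k * B + r := by rw [← hZ]; push_cast; rfl
  have h1 : (B : ℝ) * pathWeight x A ≤ B := by nlinarith
  have h2 : (B : ℝ) * ((k + 1 : ℕ) * pathWeight x B) ≤ B * (k + 1 : ℕ) := by
    have : (0 : ℝ) ≤ B * (k + 1 : ℕ) := by positivity
    nlinarith
  have h3 : (B : ℝ) * pathWeight x r ≤ B - 1 + r := by
    rcases Nat.eq_zero_or_pos r with rfl | h
    · rw [pathWeight_zero]
      push_cast
      linarith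
    · have : (1 : ℝ) ≤ r := by exact_mod_cast h
      nlinarith
  push_cast at h2
  rw [hZ']
  push_cast
  nlinarith

theorem weight_lt_or_iso_of_majorized (hx : 1 < x) {A B α r : ℕ} (hBA : B ≤ A) (hr : r ≤ B)
    (hsum : A + α * B + r = ∑ i, m i)
    (hS : ∀ S : Finset ι, S.Nonempty → ∑ i ∈ S, m i ≤ A + (S.card - 1) * B) :
    ∑ j, pathWeight x (extremalParts A α B r j) < ∑ i, pathWeight x (m i) ∨
      Nonempty (pathForest m ≃g pathForest (extremalParts A α B r)) := by
  have hle := sum_min_extremalParts_le hBA hr hsum hS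
  by_cases h : ∃ h, ∑ j, min (extremalParts A α B r j) h ≠ ∑ i, min (m i) h
  · left
    refine sum_pathWeight_lt hx ?_ hle h
    rw [← hsum]
    simp [extremalParts, Fintype.sum_sum_type]
  · right
    push Not at h
    exact nonempty_pathForest_iso_of_sum_min_eq fun k => (h k).symm

theorem weight_lt_of_large_total (hx : 1 < x) {A B α r Z s : ℕ} (hα : 0 < α)
    (hZ : (α - 1) * B + r = Z) (hB : 0 < B) (hs : 0 < s)
    (hw : pathWeight x s * (2 * s + Z) ≤ s * ∑ i, pathWeight x (m i))
    (hnum : (s : ℝ) * (3 * B + Z - 1) < B * (pathWeight x s * (2 * s + Z))) :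
    ∑ j, pathWeight x (extremalParts A α B r j) < ∑ i, pathWeight x (m i) := by
  have h1 := mul_sum_pathWeight_extremalParts_le (A := A) hx hα hZ hB
  have hB' : (0 : ℝ) < B := by exact_mod_cast hB
  have hs' : (0 : ℝ) < s := by exact_mod_cast hs
  have h2 := mul_le_mul_of_nonneg_left h1 hs'.le
  have h3 := mul_le_mul_of_nonneg_left hw hB'.le
  have h4 : (s * B : ℝ) * ∑ j, pathWeight x (extremalParts A α B r j) <
      (s * B) * ∑ i, pathWeight x (m i) := by nlinarith
  exact lt_of_mul_lt_mul_left h4 (by positivity)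

theorem pathWeight_one_sub (hx : 1 < x) (s : ℕ) : 1 - pathWeight x s = 2 / (x ^ s + 1) := by
  have : 0 < x := by linarith
  have : x ^ s + 1 ≠ 0 := by positivity
  unfold pathWeight
  field_simp
  ring

/-- With `pathWeight x s = 1 - ε`, the difference of the sides is linear in `Z` with slope `b - s -
ε b ≥ 0`, which reduces to `Z = b (b - 1)`. Without `ε` what remains is `(b - 1) (b (b - s) - s) >
0`. The error is controlled by `ε ≤ 1 / (14 b)`, improved to `1 / (100 b²)` for `s ≥ 2`, where the
main term may be only linear in `b`. -/
theorem one_path_numeric {b s Z : ℕ} (hs : 1 ≤ s) (hsb : s < b) (hZ : b * (b - 1) ≤ Z)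
    (hx : 28 * (b : ℝ) - 1 ≤ x) :
    (s : ℝ) * (3 * b + Z - 1) < b * (pathWeight x s * (2 * s + Z)) := by
  have hb2 : (2 : ℝ) ≤ b := by exact_mod_cast (by omega : 2 ≤ b)
  have hx1 : 1 < x := by linarith
  have hs1 : (1 : ℝ) ≤ s := by exact_mod_cast hs
  have hsb1 : (s : ℝ) + 1 ≤ b := by exact_mod_cast hsb
  have hZ1 : (b : ℝ) * (b - 1) ≤ Z := by
    have : ((b * (b - 1) : ℕ) : ℝ) ≤ Z := by exact_mod_cast hZ
    rwa [Nat.cast_mul, Nat.cast_sub (by omega), Nat.cast_one] at this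
  obtain ⟨ε, hε⟩ : ∃ ε, ε = 1 - pathWeight x s := ⟨_, rfl⟩
  have hw : pathWeight x s = 1 - ε := by rw [hε]; ring
  rw [pathWeight_one_sub hx1] at hε
  rw [hw]
  have hxs : 0 < x ^ s + 1 := by positivity
  have hε0 : 0 < ε := by rw [hε]; positivity
  have hmono : 14 * (b * ε) ≤ 1 := by
    rw [hε, ← mul_div_assoc, ← mul_div_assoc, div_le_one hxs]
    have : x ^ 1 ≤ x ^ s := pow_le_pow_right₀ hx1.le hs
    linarith
  suffices h : b * (b - 1) * (b - s) - s * b + s - ε * b * (2 * s) - ε * b * (b * (b - 1)) > 0 by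
    have h1 : 0 ≤ (b : ℝ) - s - ε * b := by nlinarith
    nlinarith [mul_le_mul_of_nonneg_left hZ1 h1]
  have hfac : (b : ℝ) * (b - 1) * (b - s) - s * b + s = (b - 1) * (b * (b - s) - s) := by ring
  rw [hfac]
  rcases Nat.lt_or_ge s 2 with hs2 | hs2
  · obtain rfl : s = 1 := by omega
    push_cast
    have h1 : ε * b * (2 * 1) + ε * b * (b * (b - 1)) ≤ (2 + b * (b - 1)) / 14 := by
      have : (0 : ℝ) ≤ 2 + b * (b - 1) := by nlinarith
      nlinarith
    have h2 : (b : ℝ) * (b - 1) ≥ 2 := by nlinarith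
    have h3 : ((b : ℝ) - 1) * (b * (b - 1) - 1) ≥ (b * (b - 1) - 1) := by nlinarith
    linarith
  · have hmono2 : 100 * (b ^ 2 * ε) ≤ 1 := by
      rw [hε, ← mul_div_assoc, ← mul_div_assoc, div_le_one hxs]
      have h1 : x ^ 2 ≤ x ^ s := pow_le_pow_right₀ hx1.le hs2
      nlinarith
    have h1 : (b : ℝ) * (b - s) - s ≥ 1 := by nlinarith
    have h2 : ((b : ℝ) - 1) * (b * (b - s) - s) ≥ b - 1 := by nlinarith
    have h3 : ε * b * (2 * s) ≤ 2 * (b ^ 2 * ε) := by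
      have : (s : ℝ) ≤ b := by linarith
      have h4 : 0 < ε * b := by positivity
      nlinarith
    have h4 : ε * b * (b * (b - 1)) = (b ^ 2 * ε) * (b - 1) := by ring
    rw [h4]
    nlinarith

/-- Here `s` is below `B / 2`, so the slope in `Z` is at least `B / 3` and the constant bound `ε ≤ 1
/ 28` is enough. -/
theorem many_paths_numeric {B s Z : ℕ} (hs : 1 ≤ s) (hsb : 2 * s + 1 ≤ B)
    (hZ : B * (B - 1) ≤ Z) (hx : 55 ≤ x) :
    (s : ℝ) * (3 * B + Z - 1) < B * (pathWeight x s * (2 * s + Z)) := by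
  have hx1 : 1 < x := by linarith
  have hs1 : (1 : ℝ) ≤ s := by exact_mod_cast hs
  have hsb1 : 2 * (s : ℝ) + 1 ≤ B := by exact_mod_cast hsb
  have hZ1 : (B : ℝ) * (B - 1) ≤ Z := by
    have : ((B * (B - 1) : ℕ) : ℝ) ≤ Z := by exact_mod_cast hZ
    rwa [Nat.cast_mul, Nat.cast_sub (by omega), Nat.cast_one] at this
  obtain ⟨ε, hε⟩ : ∃ ε, ε = 1 - pathWeight x s := ⟨_, rfl⟩
  have hw : pathWeight x s = 1 - ε := by rw [hε]; ring
  rw [pathWeight_one_sub hx1] at hε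
  rw [hw]
  have hxs : 0 < x ^ s + 1 := by positivity
  have hε0 : 0 < ε := by rw [hε]; positivity
  have hmono : 28 * ε ≤ 1 := by
    rw [hε, ← mul_div_assoc, div_le_one hxs]
    have : x ^ 1 ≤ x ^ s := pow_le_pow_right₀ hx1.le hs
    linarith
  have h1 : (B : ℝ) / 3 ≤ B - s - ε * B := by nlinarith
  have h2 : (Z : ℝ) * (B / 3) ≤ Z * (B - s - ε * B) :=
    mul_le_mul_of_nonneg_left h1 (Nat.cast_nonneg _)
  have h3 : (B : ℝ) * (B - 1) * (B / 3) ≤ Z * (B / 3) :=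
    mul_le_mul_of_nonneg_right hZ1 (by linarith)
  have h4 : (B : ℝ) * (B - 1) ≤ B * (B - 1) * (B / 3) := by
    have : (0 : ℝ) ≤ B * (B - 1) := by nlinarith
    nlinarith
  have h5 : 28 * (ε * (B * s)) ≤ B * s := by
    have : (0 : ℝ) ≤ B * s := by positivity
    nlinarith
  nlinarith

variable {n t ℓ : ℕ}

/-- Any two parts add up to at most `ℓ - 2 = a + b`, so the second largest part `s` is at most `b`.
If `s = b`, the largest is at most `a` and the partition is majorized by the extremal one; if `s <
b`, there are too many parts. The empty part in `hzero` serves as a partner that bounds single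
parts. -/
theorem weight_lt_or_iso_one_path (hx : 1 < x) {a b α r : ℕ} (hℓ : 0 < b) (hab : a + b + 2 = ℓ)
    (hba : b ≤ a) (hab' : a ≤ b + 1) (hα : 0 < α) (hr : r ≤ b)
    (hsum : a + α * b + r = ∑ i, m i) (hzero : ∃ i, m i = 0)
    (hlarge : b * (b - 1) + (a + b) ≤ ∑ i, m i) (hpos : a + b < ∑ i, m i)
    (hxb : 28 * (b : ℝ) - 1 ≤ x)
    (h : (copies 1 (pathGraph ℓ)).Free (cone (pathForest m))) :
    ∑ j, pathWeight x (extremalParts a α b r j) < ∑ i, pathWeight x (m i) ∨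
      Nonempty (pathForest m ≃g pathForest (extremalParts a α b r)) := by
  have hdiv := sum_div_lt_of_free (by omega) h
  have hlt : ∀ i, m i < ℓ := by
    intro i
    by_contra hcon
    have h1 : 1 ≤ m i / ℓ := (Nat.one_le_div_iff (by omega)).2 (by omega)
    have := Finset.single_le_sum (f := fun i => m i / ℓ) (fun _ _ => Nat.zero_le _)
      (Finset.mem_univ i)
    omega
  have h2 : ∀ i j, i ≠ j → m i + m j + 2 ≤ ℓ := by
    intro i j hij
    have := mod_add_mod_of_free (by omega) h (by omega) hij
    rwa [Nat.mod_eq_of_lt (hlt i), Nat.mod_eq_of_lt (hlt j)] at this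
  obtain ⟨z, hz⟩ := hzero
  have : Nonempty ι := ⟨z⟩
  have h1 : ∀ i, m i + 2 ≤ ℓ := by
    intro i
    by_cases hi : i = z
    · rw [hi, hz]
      omega
    · have := h2 i z hi
      omega
  obtain ⟨k, rfl⟩ : ∃ k, α = k + 1 := ⟨α - 1, by omega⟩
  have e : (k + 1) * b = k * b + b := by ring
  obtain ⟨i₀, s, hs, hs2, hi₀, hother, hw⟩ := exists_second_largest hx h1 h2
    (Z := k * b + r) (by omega) (by omega)
  rcases Nat.lt_or_ge s b with hsb | hsb
  · left
    exact weight_lt_of_large_total hx hα rfl hℓ hs hw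
      (one_path_numeric hs hsb (by rw [Nat.add_sub_cancel]; omega) hxb)
  · obtain rfl : s = b := by omega
    refine weight_lt_or_iso_of_majorized hx hba hr hsum fun S hS => ?_
    classical
    have h3 : ∑ i ∈ S, m i ≤ ∑ i ∈ S, (s + if i = i₀ then a - s else 0) := by
      refine Finset.sum_le_sum fun i _ => ?_
      split_ifs with hi
      · subst hi
        omega
      · have := hother i hi
        omega
    have h4 : ∑ i ∈ S, (if i = i₀ then a - s else 0) ≤ a - s := by
      rw [Finset.sum_ite_eq']
      split_ifs <;> omega
    rw [Finset.sum_add_distrib, Finset.sum_const, smul_eq_mul] at h3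
    have hc := hS.card_pos
    have h5 : S.card * s = (S.card - 1) * s + s := by
      conv_lhs => rw [← Nat.sub_add_cancel hc]
      ring
    omega

/-- At most `t - 1` blocks of `ℓ` vertices fit into the paths. With at most `t - 2` blocks, any `k`
parts have total at most `(t - 2) ℓ + k B = A + (k - 1) B`, which is majorization. With `t - 1`
blocks the remainders behave like the parts in the case of one path, and their second largest value
is below `B / 2`. -/
theorem weight_lt_or_iso_many_paths (hx : 1 < x) {A B α r : ℕ} (ht : 2 ≤ t) (hB : 0 < B)
    (hℓ : B + 1 = ℓ) (hA : A + 1 = (t - 1) * ℓ) (hα : 0 < α) (hr : r ≤ B)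
    (hsum : A + α * B + r = ∑ i, m i) (hzero : ∃ i, m i = 0)
    (hlarge : B * (B - 1) + (A + B) ≤ ∑ i, m i) (hpos : A + B < ∑ i, m i)
    (hxb : 2 ≤ B → 55 ≤ x)
    (h : (copies t (pathGraph ℓ)).Free (cone (pathForest m))) :
    ∑ j, pathWeight x (extremalParts A α B r j) < ∑ i, pathWeight x (m i) ∨
      Nonempty (pathForest m ≃g pathForest (extremalParts A α B r)) := by
  have hℓ0 : 0 < ℓ := by omega
  have hdiv := sum_div_lt_of_free hℓ0 h
  obtain ⟨u, rfl⟩ : ∃ u, t = u + 2 := ⟨t - 2, by omega⟩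
  have hA' : A = u * ℓ + B := by
    have : (u + 2 - 1) * ℓ = u * ℓ + ℓ := by
      rw [show u + 2 - 1 = u + 1 by omega]
      ring
    omega
  rcases Nat.lt_or_ge (∑ i, m i / ℓ) (u + 1) with hK | hK
  · refine weight_lt_or_iso_of_majorized hx (by omega) hr hsum fun S hS => ?_
    have h3 : ∑ i ∈ S, m i ≤ ∑ i ∈ S, (m i / ℓ * ℓ + B) := by
      refine Finset.sum_le_sum fun i _ => ?_
      have h1 := Nat.div_add_mod' (m i) ℓ
      have h2 := Nat.mod_lt (m i) hℓ0
      omega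
    rw [Finset.sum_add_distrib, Finset.sum_const, smul_eq_mul, ← Finset.sum_mul] at h3
    have h4 : ∑ i ∈ S, m i / ℓ ≤ ∑ i, m i / ℓ :=
      Finset.sum_le_sum_of_subset_of_nonneg (Finset.subset_univ _) fun _ _ _ => Nat.zero_le _
    have h5 : (∑ i ∈ S, m i / ℓ) * ℓ ≤ u * ℓ := Nat.mul_le_mul_right _ (by omega)
    have hc := hS.card_pos
    have h6 : S.card * B = (S.card - 1) * B + B := by
      conv_lhs => rw [← Nat.sub_add_cancel hc]
      ring
    omega
  · left
    have h2 : ∀ i j, i ≠ j → m i % ℓ + m j % ℓ + 2 ≤ ℓ := fun i j hij =>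
      mod_add_mod_of_free hℓ0 h (by omega) hij
    obtain ⟨z, hz⟩ := hzero
    have : Nonempty ι := ⟨z⟩
    have h1 : ∀ i, m i % ℓ + 2 ≤ ℓ := by
      intro i
      by_cases hi : i = z
      · rw [hi, hz, Nat.zero_mod]
        omega
      · have := h2 i z hi
        omega
    obtain ⟨k, rfl⟩ : ∃ k, α = k + 1 := ⟨α - 1, by omega⟩
    have e : (k + 1) * B = k * B + B := by ring
    have hres : ∑ i, m i = (u + 1) * ℓ + ∑ i, m i % ℓ := by
      have hK' : ∑ i, m i / ℓ = u + 1 := by omega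
      rw [← hK', Finset.sum_mul, ← Finset.sum_add_distrib]
      exact Finset.sum_congr rfl fun i _ => (Nat.div_add_mod' _ _).symm
    have e2 : (u + 1) * ℓ = u * ℓ + ℓ := by ring
    obtain ⟨i₀, s, hs, hs2, hi₀, hother, hw⟩ := exists_second_largest hx h1 h2
      (Z := k * B + r) (by omega) (by omega)
    have hmono : ∑ i, pathWeight x (m i % ℓ) ≤ ∑ i, pathWeight x (m i) :=
      Finset.sum_le_sum fun i _ => (pathWeight_strictMono hx).monotone (Nat.mod_le _ _)
    refine weight_lt_of_large_total hx hα rfl hB hs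
      (hw.trans (mul_le_mul_of_nonneg_left hmono (Nat.cast_nonneg _)))
      (many_paths_numeric hs (by omega) (by rw [Nat.add_sub_cancel]; omega) (hxb (by omega)))

end Dominated

end OuterplanarQ

/-! ### Row inequalities around a vertex of maximal entry. -/

namespace OuterplanarQ
open SimpleGraph

section NonDominated

open Classical in
/-- The contribution of the pair `i, j` to the action of the signless Laplacian. -/
noncomputable def edgeVal {V : Type*} (G : SimpleGraph V) (y : V → ℝ) (i j : V) : ℝ :=
  if G.Adj i j then y i + y j else 0

variable {V : Type*} {G : SimpleGraph V} {y : V → ℝ} {u : V} {q : ℝ}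

theorem edgeVal_of_adj {i j : V} (h : G.Adj i j) : edgeVal G y i j = y i + y j := if_pos h

theorem edgeVal_of_not_adj {i j : V} (h : ¬ G.Adj i j) : edgeVal G y i j = 0 := if_neg h

theorem edgeVal_comm (i j : V) : edgeVal G y i j = edgeVal G y j i := by
  by_cases h : G.Adj i j
  · rw [edgeVal_of_adj h, edgeVal_of_adj h.symm, add_comm]
  · rw [edgeVal_of_not_adj h, edgeVal_of_not_adj fun h' => h h'.symm]

theorem edgeVal_le {i j : V} {c : ℝ} (hc : 0 ≤ c) (h : G.Adj i j → y i + y j ≤ c) :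
    edgeVal G y i j ≤ c := by
  unfold edgeVal
  split_ifs with h'
  exacts [h h', hc]

/-- A sum of contributions over a set with at most two neighbours. -/
theorem sum_edgeVal_le_two {S : Finset V} {i : V} {c : ℝ} (hc : 0 ≤ c)
    (h : ∀ j ∈ S, G.Adj i j → y i + y j ≤ c)
    (h3 : ∀ a ∈ S, ∀ b ∈ S, ∀ d ∈ S, G.Adj i a → G.Adj i b → G.Adj i d → a = b ∨ a = d ∨ b = d) :
    ∑ j ∈ S, edgeVal G y i j ≤ 2 * c := by
  classical
  unfold edgeVal
  rw [← Finset.sum_filter]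
  have hcard : (S.filter (G.Adj i)).card ≤ 2 := by
    by_contra hcon
    push Not at hcon
    obtain ⟨a, b, d, ha, hb, hd, hab, had, hbd⟩ := Finset.two_lt_card_iff.1 hcon
    rw [Finset.mem_filter] at ha hb hd
    rcases h3 a ha.1 b hb.1 d hd.1 ha.2 hb.2 hd.2 with h | h | h
    exacts [hab h, had h, hbd h]
  calc ∑ j ∈ S.filter (G.Adj i), (y i + y j) ≤ ∑ j ∈ S.filter (G.Adj i), c :=
        Finset.sum_le_sum fun j hj => by
          rw [Finset.mem_filter] at hj
          exact h j hj.1 hj.2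
    _ = (S.filter (G.Adj i)).card * c := by rw [Finset.sum_const, nsmul_eq_mul]
    _ ≤ 2 * c := mul_le_mul_of_nonneg_right (by exact_mod_cast hcard) hc

variable [Fintype V]

open Classical in
/-- The neighbours of `u`. -/
noncomputable def nbrs (G : SimpleGraph V) (u : V) : Finset V := Finset.univ.filter (G.Adj u)

open Classical in
/-- The vertices different from `u` and not adjacent to it. -/
noncomputable def rest (G : SimpleGraph V) (u : V) : Finset V :=
  Finset.univ.filter fun w => w ≠ u ∧ ¬ G.Adj u w

theorem mem_nbrs {v : V} : v ∈ nbrs G u ↔ G.Adj u v := by simp [nbrs]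

theorem mem_rest {v : V} : v ∈ rest G u ↔ v ≠ u ∧ ¬ G.Adj u v := by simp [rest]

theorem sum_eq_nbrs_rest (f : V → ℝ) :
    ∑ j, f j = f u + ∑ j ∈ nbrs G u, f j + ∑ j ∈ rest G u, f j := by
  classical
  rw [← Finset.add_sum_erase _ _ (Finset.mem_univ u), add_assoc,
    ← Finset.sum_filter_add_sum_filter_not (Finset.univ.erase u) (G.Adj u)]
  congr 2
  · refine Finset.sum_congr ?_ fun _ _ => rfl
    ext v
    simp only [Finset.mem_filter, Finset.mem_erase, Finset.mem_univ, and_true, mem_nbrs]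
    exact ⟨fun h => h.2, fun h => ⟨h.ne', h⟩⟩
  · refine Finset.sum_congr ?_ fun _ _ => rfl
    ext v
    simp [mem_rest]

theorem card_nbrs_add_card_rest : (nbrs G u).card + (rest G u).card + 1 = Fintype.card V := by
  have := sum_eq_nbrs_rest (G := G) (u := u) (fun _ => (1 : ℝ))
  simp only [Finset.sum_const, nsmul_eq_mul, mul_one, Finset.card_univ] at this
  have h : (Fintype.card V : ℝ) = ((nbrs G u).card + (rest G u).card + 1 : ℕ) := by
    rw [this]
    push_cast
    ring
  exact_mod_cast h.symm

theorem qAct_eq (i : V) : qAct G y i = edgeVal G y i u + ∑ j ∈ nbrs G u, edgeVal G y i j +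
    ∑ j ∈ rest G u, edgeVal G y i j := by
  rw [← sum_eq_nbrs_rest (fun j => edgeVal G y i j)]
  rfl

theorem le_card_add_sum (hu : y u = 1) (hq : ∀ i, q * y i ≤ qAct G y i) :
    q ≤ (nbrs G u).card + ∑ v ∈ nbrs G u, y v := by
  have h := hq u
  rw [hu, mul_one, qAct_eq (u := u), edgeVal_of_not_adj (G.irrefl)] at h
  have h1 : ∑ j ∈ rest G u, edgeVal G y u j = 0 := Finset.sum_eq_zero fun j hj =>
    edgeVal_of_not_adj (mem_rest.1 hj).2
  have h2 : ∑ j ∈ nbrs G u, edgeVal G y u j = (nbrs G u).card + ∑ v ∈ nbrs G u, y v := by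
    rw [Finset.sum_congr rfl fun j hj => edgeVal_of_adj (mem_nbrs.1 hj), hu,
      Finset.sum_add_distrib]
    simp
  linarith

theorem mul_sub_one_le (hu : y u = 1) (hq : ∀ i, q * y i ≤ qAct G y i) {v : V}
    (hv : v ∈ nbrs G u) : (q - 1) * y v ≤
      1 + ∑ j ∈ nbrs G u, edgeVal G y v j + ∑ w ∈ rest G u, edgeVal G y v w := by
  have h := hq v
  rw [qAct_eq (u := u), edgeVal_of_adj (mem_nbrs.1 hv).symm, hu] at h
  linarith

theorem mul_le_of_mem_rest (hq : ∀ i, q * y i ≤ qAct G y i) {w : V} (hw : w ∈ rest G u) :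
    q * y w ≤ ∑ j ∈ nbrs G u, edgeVal G y w j + ∑ w' ∈ rest G u, edgeVal G y w w' := by
  have h := hq w
  rw [qAct_eq (u := u), edgeVal_of_not_adj fun h => (mem_rest.1 hw).2 h.symm] at h
  linarith

theorem sum_nbrs_le (hu : y u = 1) (hq : ∀ i, q * y i ≤ qAct G y i) :
    (q - 1) * ∑ v ∈ nbrs G u, y v ≤ (nbrs G u).card +
      ∑ v ∈ nbrs G u, ∑ j ∈ nbrs G u, edgeVal G y v j +
      ∑ v ∈ nbrs G u, ∑ w ∈ rest G u, edgeVal G y v w := by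
  rw [Finset.mul_sum]
  refine (Finset.sum_le_sum fun v hv => mul_sub_one_le hu hq hv).trans (le_of_eq ?_)
  rw [Finset.sum_add_distrib, Finset.sum_add_distrib]
  simp

variable (h0 : ∀ i, 0 ≤ y i) (h1 : ∀ i, y i ≤ 1) (hu : y u = 1)
  (hq : ∀ i, q * y i ≤ qAct G y i)

include h1 hu hq in
theorem le_two_mul_card_nbrs : q ≤ 2 * (nbrs G u).card := by
  have h := le_card_add_sum hu hq
  have h2 : ∑ v ∈ nbrs G u, y v ≤ (nbrs G u).card := by
    calc ∑ v ∈ nbrs G u, y v ≤ ∑ v ∈ nbrs G u, (1 : ℝ) := Finset.sum_le_sum fun v _ => h1 v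
      _ = _ := by simp
  linarith

/-- The absence of `K_{2,3}`. -/
def NoK23 (G : SimpleGraph V) : Prop :=
  ∀ a b x y z, a ≠ b → G.Adj a x → G.Adj a y → G.Adj a z → G.Adj b x → G.Adj b y → G.Adj b z →
    x = y ∨ x = z ∨ y = z

-- `X` and `Y` are the largest entries among the neighbours of `u` and among the remaining vertices.
-- Each inequality uses that a vertex other than `u` has at most two neighbours in the neighbourhood
-- of `u`. The first sums the rows over that neighbourhood; the other two are the rows at the
-- maximizing vertices.
include h0 h1 hu hq in
theorem exists_neighbourhood_bounds (hK : NoK23 G) (hq5 : 5 ≤ q) (hR : (rest G u).Nonempty)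
    (hN : (nbrs G u).Nonempty) :
    ∃ X Y : ℝ, 0 ≤ X ∧ X ≤ 1 ∧ 0 ≤ Y ∧ Y ≤ 1 ∧
      (q - 5) * (q - (nbrs G u).card) ≤ (nbrs G u).card + 2 * (rest G u).card * (X + Y) ∧
      (q - 5 - (rest G u).card) * X ≤ 1 + (rest G u).card * Y ∧
      (q - 2 * (rest G u).card) * Y ≤ 2 * X := by
  classical
  obtain ⟨v₀, hv₀, hX⟩ := Finset.exists_max_image (nbrs G u) y hN
  obtain ⟨w₀, hw₀, hY⟩ := Finset.exists_max_image (rest G u) y hR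
  refine ⟨y v₀, y w₀, h0 _, h1 _, h0 _, h1 _, ?_, ?_, ?_⟩
  · have hS := le_card_add_sum hu hq
    have hsum := sum_nbrs_le hu hq
    have hNN : ∑ v ∈ nbrs G u, ∑ j ∈ nbrs G u, edgeVal G y v j ≤ 4 * ∑ v ∈ nbrs G u, y v := by
      -- By symmetry of the double sum each `y v + y j` may be replaced by `2 * y v`. The auxiliary
      -- vector, supported at `v`, puts this in the form to which `sum_edgeVal_le_two` applies.
      have e1 : ∑ v ∈ nbrs G u, ∑ j ∈ nbrs G u, edgeVal G y v j =
          ∑ v ∈ nbrs G u, ∑ j ∈ nbrs G u, edgeVal G (fun a => if a = v then 2 * y v else 0) v j := by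
        have e2 : ∀ v j, edgeVal G y v j =
            (if G.Adj v j then y v else 0) + (if G.Adj v j then y j else 0) := by
          intro v j
          unfold edgeVal
          split_ifs <;> simp
        have e3 : ∀ v j, edgeVal G (fun a => if a = v then 2 * y v else 0) v j =
            (if G.Adj v j then y v else 0) + (if G.Adj v j then y v else 0) := by
          intro v j
          by_cases h : G.Adj v j
          · simp only [edgeVal, h, if_true, if_neg h.ne']
            ring
          · simp [edgeVal, h]
        simp only [e2, e3, Finset.sum_add_distrib]
        congr 1
        rw [Finset.sum_comm]
        simp only [G.adj_comm]
      rw [e1, Finset.mul_sum]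
      refine Finset.sum_le_sum fun v hv => ?_
      have := sum_edgeVal_le_two (G := G) (S := nbrs G u) (i := v)
        (y := fun a => if a = v then 2 * y v else 0) (c := 2 * y v) (by linarith [h0 v])
        (fun j _ hj => by simp [hj.ne'])
        (fun a ha b hb d hd h4 h5 h6 => hK u v a b d (mem_nbrs.1 hv).ne (mem_nbrs.1 ha)
          (mem_nbrs.1 hb) (mem_nbrs.1 hd) h4 h5 h6)
      linarith
    have hNR : ∑ v ∈ nbrs G u, ∑ w ∈ rest G u, edgeVal G y v w ≤
        2 * (rest G u).card * (y v₀ + y w₀) := by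
      rw [Finset.sum_comm]
      calc ∑ w ∈ rest G u, ∑ v ∈ nbrs G u, edgeVal G y v w
          ≤ ∑ w ∈ rest G u, 2 * (y v₀ + y w₀) := Finset.sum_le_sum fun w hw => by
            simp only [edgeVal_comm _ w]
            refine sum_edgeVal_le_two (add_nonneg (h0 _) (h0 _))
              (fun j hj _ => by linarith [hX j hj, hY w hw])
              (fun a ha b hb d hd h4 h5 h6 => hK u w a b d (mem_rest.1 hw).1.symm
                (mem_nbrs.1 ha) (mem_nbrs.1 hb) (mem_nbrs.1 hd) h4 h5 h6)
        _ = _ := by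
          rw [Finset.sum_const, nsmul_eq_mul]
          ring
    nlinarith
  · have h2 := mul_sub_one_le hu hq hv₀
    have h3 : ∑ j ∈ nbrs G u, edgeVal G y v₀ j ≤ 2 * (2 * y v₀) :=
      sum_edgeVal_le_two (by linarith [h0 v₀]) (fun j hj _ => by linarith [hX j hj])
        (fun a ha b hb d hd h4 h5 h6 => hK u v₀ a b d (mem_nbrs.1 hv₀).ne
          (mem_nbrs.1 ha) (mem_nbrs.1 hb) (mem_nbrs.1 hd) h4 h5 h6)
    have h4 : ∑ w ∈ rest G u, edgeVal G y v₀ w ≤ (rest G u).card * (y v₀ + y w₀) := by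
      calc ∑ w ∈ rest G u, edgeVal G y v₀ w ≤ ∑ w ∈ rest G u, (y v₀ + y w₀) :=
            Finset.sum_le_sum fun w hw => edgeVal_le (add_nonneg (h0 _) (h0 _))
              fun _ => by linarith [hY w hw]
        _ = _ := by rw [Finset.sum_const, nsmul_eq_mul]
    linarith
  · have h2 := mul_le_of_mem_rest hq hw₀
    have h3 : ∑ j ∈ nbrs G u, edgeVal G y w₀ j ≤ 2 * (y w₀ + y v₀) :=
      sum_edgeVal_le_two (add_nonneg (h0 _) (h0 _)) (fun j hj _ => by linarith [hX j hj])
        (fun a ha b hb d hd h4 h5 h6 => hK u w₀ a b d (mem_rest.1 hw₀).1.symm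
          (mem_nbrs.1 ha) (mem_nbrs.1 hb) (mem_nbrs.1 hd) h4 h5 h6)
    have h4 : ∑ w ∈ rest G u, edgeVal G y w₀ w ≤ ((rest G u).card - 1) * (2 * y w₀) := by
      rw [← Finset.add_sum_erase _ _ hw₀, edgeVal_of_not_adj G.irrefl, zero_add]
      calc ∑ w ∈ (rest G u).erase w₀, edgeVal G y w₀ w
          ≤ ∑ w ∈ (rest G u).erase w₀, 2 * y w₀ :=
            Finset.sum_le_sum fun w hw => edgeVal_le (by linarith [h0 w₀])
              fun _ => by linarith [hY w (Finset.mem_of_mem_erase hw)]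
        _ = _ := by
          rw [Finset.sum_const, nsmul_eq_mul, Finset.card_erase_of_mem hw₀,
            Nat.cast_sub (Finset.card_pos.2 hR), Nat.cast_one]
    linarith

end NonDominated

end OuterplanarQ

/-! ### Graphs without a dominating vertex, including the small orders. -/

namespace OuterplanarQ
open SimpleGraph

section SmallOrders

variable {V : Type*} {G : SimpleGraph V}

theorem not_free_matching {t : ℕ} {T : Type*} [Fintype T] (ht : t ≤ Fintype.card T)
    (a b : T → V) (hadj : ∀ x, G.Adj (a x) (b x)) (ha : Function.Injective a)
    (hb : Function.Injective b) (hab : ∀ x y, a x ≠ b y) :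
    ¬ (copies t (pathGraph 2)).Free G := by
  refine not_free_copies ht (fun x k => if k = 0 then a x else b x) ?_ ?_
  · intro x k hk
    obtain rfl : k = 0 := by omega
    simpa using hadj x
  · intro x y k l hk hl h
    obtain rfl | rfl : k = 0 ∨ k = 1 := by omega
    · obtain rfl | rfl : l = 0 ∨ l = 1 := by omega
      · exact ⟨ha (by simpa using h), rfl⟩
      · exact absurd (by simpa using h) (hab x y)
    · obtain rfl | rfl : l = 0 ∨ l = 1 := by omega
      · exact absurd (by simpa using h.symm) (hab y x)
      · exact ⟨hb (by simpa using h), rfl⟩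

theorem not_free_three_edges {a₁ b₁ a₂ b₂ a₃ b₃ : V} (h₁ : G.Adj a₁ b₁) (h₂ : G.Adj a₂ b₂)
    (h₃ : G.Adj a₃ b₃) (hnd : [a₁, b₁, a₂, b₂, a₃, b₃].Nodup) :
    ¬ (copies 3 (pathGraph 2)).Free G := by
  simp only [List.nodup_cons, List.mem_cons, List.not_mem_nil, or_false, not_or] at hnd
  obtain ⟨⟨c1, c2, c3, c4, c5⟩, ⟨c6, c7, c8, c9⟩, ⟨c10, c11, c12⟩, ⟨c13, c14⟩, c15, -⟩ := hnd
  refine not_free_matching (T := Fin 3) (by simp) ![a₁, a₂, a₃] ![b₁, b₂, b₃] ?_ ?_ ?_ ?_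
  · intro x
    fin_cases x <;> simpa
  · intro x y h
    fin_cases x <;> fin_cases y <;> simp_all
  · intro x y h
    fin_cases x <;> fin_cases y <;> simp_all
  · intro x y h
    fin_cases x <;> fin_cases y <;> simp_all [eq_comm]

/-- No vertex is adjacent to all the others. -/
def NoDominating (G : SimpleGraph V) : Prop := ∀ u, ∃ w, w ≠ u ∧ ¬ G.Adj u w

variable [Fintype V]

/-- The unknown index is replaced by the assumed lower bound `q₀`, on which the inequalities depend
monotonically. For given `n` and `ρ` they become linear in `X` and `Y`. -/
theorem exists_linear_bounds [Nonempty V] {n : ℕ} (hn : Fintype.card V = n) {q₀ : ℝ} (hq₀ : (n : ℝ) - 1 ≤ q₀)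
    (hq5 : 5 ≤ q₀) (hle : q₀ ≤ qIndex G) (hd : NoDominating G) (hK : NoK23 G) :
    ∃ (ρ : ℕ) (X Y : ℝ), 1 ≤ ρ ∧ q₀ ≤ 2 * (n - 1 - ρ) ∧ 0 ≤ X ∧ X ≤ 1 ∧ 0 ≤ Y ∧ Y ≤ 1 ∧
      (q₀ - 5) * (q₀ - (n - 1 - ρ)) ≤ (n - 1 - ρ) + 2 * ρ * (X + Y) ∧
      (q₀ - 5 - ρ) * X ≤ 1 + ρ * Y ∧ (q₀ - 2 * ρ) * Y ≤ 2 * X := by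
  obtain ⟨y, u, hu, h0, h1, hq⟩ := exists_max_eigenvector G
  have h2d := le_two_mul_card_nbrs h1 hu hq
  have hN : (nbrs G u).Nonempty := by
    rw [← Finset.card_pos]
    have : (0 : ℝ) < (nbrs G u).card := by linarith
    exact_mod_cast this
  obtain ⟨w, hw⟩ := hd u
  have hR : (rest G u).Nonempty := ⟨w, mem_rest.2 hw⟩
  obtain ⟨X, Y, hX0, hX1, hY0, hY1, i1, i2, i3⟩ :=
    exists_neighbourhood_bounds h0 h1 hu hq hK (hq5.trans hle) hR hN
  have hcard : ((nbrs G u).card : ℝ) = n - 1 - (rest G u).card := by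
    have := card_nbrs_add_card_rest (G := G) (u := u)
    rw [hn] at this
    have h3 : (n : ℝ) = ((nbrs G u).card + (rest G u).card + 1 : ℕ) := by rw [this]
    rw [h3]
    push_cast
    ring
  have hρ : 1 ≤ (rest G u).card := hR.card_pos
  have hρ' : (1 : ℝ) ≤ (rest G u).card := by exact_mod_cast hρ
  rw [hcard] at i1 h2d
  refine ⟨(rest G u).card, X, Y, hρ, by linarith, hX0, hX1, hY0, hY1, ?_, ?_, ?_⟩
  · nlinarith
  · nlinarith
  · nlinarith

theorem qIndex_lt_card [Nonempty V] {n : ℕ} (hn : Fintype.card V = n) (h9 : 9 ≤ n) (hd : NoDominating G)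
    (hK : NoK23 G) : qIndex G < n := by
  by_contra hcon
  push Not at hcon
  have h9' : (9 : ℝ) ≤ n := by exact_mod_cast h9
  obtain ⟨ρ, X, Y, hρ, h2d, hX0, hX1, hY0, hY1, i1, i2, i3⟩ :=
    exists_linear_bounds hn (q₀ := n) (by linarith) (by linarith) hcon hd hK
  have hρ' : (1 : ℝ) ≤ ρ := by exact_mod_cast hρ
  -- This uses only `X, Y ≤ 1`. It leaves finitely many pairs `(ρ, n)`, which the full linear system
  -- rules out.
  have hn12 : (ρ : ℝ) * (n - 8) ≤ 4 := by nlinarith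
  have hn12' : ρ * n ≤ 4 + ρ * 8 := by
    have : ((ρ * n : ℕ) : ℝ) ≤ ((4 + ρ * 8 : ℕ) : ℝ) := by
      push_cast
      linarith
    exact_mod_cast this
  have hρ4 : ρ ≤ 4 := by nlinarith
  have hn' : n ≤ 12 := by nlinarith
  clear hn hcon hn12
  interval_cases ρ <;> interval_cases n <;> norm_num at * <;> linarith

theorem qIndex_lt_of_card_eq_eight [Nonempty V] (hn : Fintype.card V = 8) (hd : NoDominating G)
    (hK : NoK23 G) : qIndex G < 83 / 10 := by
  by_contra hcon
  push Not at hcon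
  obtain ⟨ρ, X, Y, hρ, h2d, hX0, hX1, hY0, hY1, i1, i2, i3⟩ :=
    exists_linear_bounds hn (q₀ := 83 / 10) (by norm_num) (by norm_num) hcon hd hK
  have hρ2 : ρ ≤ 2 := by
    have : (ρ : ℝ) < 3 := by
      push_cast at h2d
      linarith
    have : ρ < 3 := by exact_mod_cast this
    omega
  interval_cases ρ <;> norm_num at * <;> linarith

omit [Fintype V] in
theorem exists_boundary_edge (hc : G.Connected) {u w : V} (hwu : w ≠ u) (hw : ¬ G.Adj u w) :
    ∃ z x, G.Adj u z ∧ x ≠ u ∧ ¬ G.Adj u x ∧ G.Adj z x := by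
  obtain ⟨p⟩ := hc.preconnected u w
  obtain ⟨d, -, h1, h2⟩ := p.exists_boundary_dart {v | v = u ∨ G.Adj u v} (Or.inl rfl)
    (fun h => h.elim hwu hw)
  have h2 : ¬ (d.snd = u ∨ G.Adj u d.snd) := h2
  rw [not_or] at h2
  rcases h1 with h1 | h1
  · exact absurd (h1 ▸ d.adj) h2.2
  · exact ⟨d.fst, d.snd, h1, h2.1, h2.2, d.adj⟩

-- An edge from a neighbour `z` of `u` to a non-neighbour `x` exists by connectedness, and likewise
-- an edge from a neighbour `v` of `z` to a non-neighbour `x'` of `z`. The path is `x', v, z`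
-- followed by `x` if `v = u` and by `u` otherwise.
omit [Fintype V] in
theorem exists_path_four (hc : G.Connected) (hd : NoDominating G) [Nonempty V] :
    ∃ x v z c, G.Adj x v ∧ G.Adj v z ∧ G.Adj z c ∧ x ≠ z ∧ x ≠ c ∧ v ≠ c := by
  obtain ⟨u⟩ := ‹Nonempty V›
  obtain ⟨w, hwu, hw⟩ := hd u
  obtain ⟨z, x, huz, hxu, hux, hzx⟩ := exists_boundary_edge hc hwu hw
  obtain ⟨w', hwz', hw'⟩ := hd z
  obtain ⟨v, x', hzv, hxz', hzx', hvx'⟩ := exists_boundary_edge hc hwz' hw'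
  by_cases hv : v = u
  · exact ⟨x', v, z, x, hvx'.symm, hzv.symm, hzx, hxz', fun h => hzx' (h ▸ hzx),
      fun h => hxu (h.symm.trans hv)⟩
  · exact ⟨x', v, z, u, hvx'.symm, hzv.symm, huz.symm, hxz', fun h => hzx' (h ▸ huz.symm), hv⟩

omit [Fintype V] in
theorem not_free_path_four (hc : G.Connected) (hd : NoDominating G) [Nonempty V] :
    ¬ (copies 1 (pathGraph 4)).Free G := by
  obtain ⟨x, v, z, c, h1, h2, h3, h4, h5, h6⟩ := exists_path_four hc hd
  refine not_free_copies (T := Unit) (by simp) (fun _ k => if k = 0 then x else if k = 1 then v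
    else if k = 2 then z else c) ?_ ?_
  · intro _ k hk
    have : k = 0 ∨ k = 1 ∨ k = 2 := by omega
    rcases this with rfl | rfl | rfl <;> simpa
  · intro _ _ k l hk hl h
    refine ⟨rfl, ?_⟩
    have e1 := h1.ne
    have e2 := h2.ne
    have e3 := h3.ne
    have e4 := h1.ne'
    have e5 := h2.ne'
    have e6 := h3.ne'
    interval_cases k <;> interval_cases l <;> simp_all [eq_comm]

omit [Fintype V] in
theorem not_free_two_edges (hc : G.Connected) (hd : NoDominating G) [Nonempty V] :
    ¬ (copies 2 (pathGraph 2)).Free G := by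
  obtain ⟨x, v, z, c, h1, h2, h3, h4, h5, h6⟩ := exists_path_four hc hd
  have e2 := h2.ne
  refine not_free_matching (T := Fin 2) (by simp) ![x, z] ![v, c] ?_ ?_ ?_ ?_
  · intro x
    fin_cases x <;> simpa
  · intro x y h
    fin_cases x <;> fin_cases y <;> simp_all [eq_comm]
  · intro x y h
    fin_cases x <;> fin_cases y <;> simp_all [eq_comm]
  · intro x y h
    have := h1.ne
    have := h3.ne
    fin_cases x <;> fin_cases y <;> simp_all [eq_comm]

-- The general estimate is too weak at these orders, so the structure forced by the absence of three
-- disjoint edges is used. As `q ≤ 2 d` for the degree `d` of `u`, one has `d ≥ 4`, so any two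
-- disjoint edges avoiding `u` that cover at most three neighbours of `u` extend by an edge at `u`.
-- Hence the edges leaving the neighbourhood either share one end inside it or all lead to a single
-- vertex.
set_option maxHeartbeats 1000000 in
theorem qIndex_lt_of_three_matching_free [Nonempty V] {n : ℕ} {q₀ : ℝ}
    (hn : Fintype.card V = n) (hc : G.Connected) (hd : NoDominating G) (hK : NoK23 G)
    (hfree : (copies 3 (pathGraph 2)).Free G)
    (hq₀ : n = 6 ∧ q₀ = 63 / 10 ∨ n = 7 ∧ q₀ = 7 ∨ n = 8 ∧ q₀ = 8) : qIndex G < q₀ := by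
  classical
  by_contra hcon
  push Not at hcon
  obtain ⟨y, u, hu, h0, h1, hq⟩ := exists_max_eigenvector G
  have h2d := le_two_mul_card_nbrs h1 hu hq
  obtain ⟨w, hwu, hw⟩ := hd u
  obtain ⟨z₀, w₀, hz₀, hwu₀, hw₀, hzw₀⟩ := exists_boundary_edge hc hwu hw
  have hρ : 0 < (rest G u).card := Finset.card_pos.2 ⟨w, mem_rest.2 ⟨hwu, hw⟩⟩
  have hcard := card_nbrs_add_card_rest (G := G) (u := u)
  rw [hn] at hcard
  have hcases : (n = 6 ∧ q₀ = 63 / 10 ∧ (nbrs G u).card = 4 ∧ (rest G u).card = 1) ∨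
      (n = 7 ∧ q₀ = 7 ∧ (nbrs G u).card = 5 ∧ (rest G u).card = 1) ∨
      (n = 7 ∧ q₀ = 7 ∧ (nbrs G u).card = 4 ∧ (rest G u).card = 2) ∨
      (n = 8 ∧ q₀ = 8 ∧ (nbrs G u).card = 6 ∧ (rest G u).card = 1) ∨
      (n = 8 ∧ q₀ = 8 ∧ (nbrs G u).card = 5 ∧ (rest G u).card = 2) ∨
      (n = 8 ∧ q₀ = 8 ∧ (nbrs G u).card = 4 ∧ (rest G u).card = 3) := by
    have h3 : (3 : ℝ) < (nbrs G u).card := by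
      rcases hq₀ with ⟨-, h⟩ | ⟨-, h⟩ | ⟨-, h⟩ <;> linarith
    have h3 : 3 < (nbrs G u).card := by exact_mod_cast h3
    rcases hq₀ with ⟨h, h'⟩ | ⟨h, h'⟩ | ⟨h, h'⟩ <;> subst h <;> simp [h'] <;> omega
  have hd4 : 4 ≤ (nbrs G u).card := by omega
  -- the edges inside the neighbourhood meet every edge to the rest
  have hP : ∀ z x a b, G.Adj u z → x ≠ u → ¬ G.Adj u x → G.Adj z x → G.Adj u a → G.Adj u b →
      G.Adj a b → a = z ∨ b = z := by
    intro z x a b hz hxu hx hzx ha hb hab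
    by_contra hne
    rw [not_or] at hne
    obtain ⟨c, hcN, hcS⟩ : ∃ c ∈ nbrs G u, c ∉ ({z, a, b} : Finset V) :=
      Finset.exists_mem_notMem_of_card_lt_card (lt_of_le_of_lt Finset.card_le_three hd4)
    rw [mem_nbrs] at hcN
    simp only [Finset.mem_insert, Finset.mem_singleton, not_or] at hcS
    refine not_free_three_edges hab hzx hcN ?_ hfree
    have e1 : a ≠ x := fun h => hx (h ▸ ha)
    have e2 : b ≠ x := fun h => hx (h ▸ hb)
    have e3 : c ≠ x := fun h => hx (h ▸ hcN)
    simp [hab.ne, hne.1, hne.2, e1, e2, ha.ne', hb.ne', Ne.symm hcS.2.1, Ne.symm hcS.2.2, hzx.ne,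
      hz.ne', Ne.symm hcS.1, hxu, e3.symm, hcN.ne]
  have hQ : ∀ z x z' x', G.Adj u z → x ≠ u → ¬ G.Adj u x → G.Adj z x → G.Adj u z' → x' ≠ u →
      ¬ G.Adj u x' → G.Adj z' x' → z ≠ z' → x = x' := by
    intro z x z' x' hz hxu hx hzx hz' hxu' hx' hzx' hne
    by_contra hxx
    obtain ⟨c, hcN, hcS⟩ : ∃ c ∈ nbrs G u, c ∉ ({z, z', z'} : Finset V) :=
      Finset.exists_mem_notMem_of_card_lt_card (lt_of_le_of_lt Finset.card_le_three hd4)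
    rw [mem_nbrs] at hcN
    simp only [Finset.mem_insert, Finset.mem_singleton, not_or] at hcS
    refine not_free_three_edges hzx hzx' hcN ?_ hfree
    have e1 : z ≠ x' := fun h => hx' (h ▸ hz)
    have e2 : z' ≠ x := fun h => hx (h ▸ hz')
    have e3 : c ≠ x := fun h => hx (h ▸ hcN)
    have e4 : c ≠ x' := fun h => hx' (h ▸ hcN)
    simp [hzx.ne, hne, e1, hz.ne', Ne.symm hcS.1, Ne.symm e2, hxx, hxu, e3.symm, hzx'.ne, hz'.ne',
      Ne.symm hcS.2.1, hxu', e4.symm, hcN.ne]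
  have hS := le_card_add_sum hu hq
  have hsum := sum_nbrs_le hu hq
  have hw₀R : w₀ ∈ rest G u := mem_rest.2 ⟨hwu₀, hw₀⟩
  have hz₀N : z₀ ∈ nbrs G u := mem_nbrs.2 hz₀
  by_cases hB : ∃ z₁ x, G.Adj u z₁ ∧ x ≠ u ∧ ¬ G.Adj u x ∧ G.Adj z₁ x ∧ z₁ ≠ z₀
  · -- all edges to the rest end in the same vertex
    obtain ⟨z₁, x, hz₁, hxu, hx, hzx, hne⟩ := hB
    obtain rfl : x = w₀ := hQ z₁ x z₀ w₀ hz₁ hxu hx hzx hz₀ hwu₀ hw₀ hzw₀ hne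
    have hz₁N : z₁ ∈ nbrs G u := mem_nbrs.2 hz₁
    have hNN : ∀ a b, G.Adj u a → G.Adj u b → G.Adj a b → a = z₀ ∧ b = z₁ ∨ a = z₁ ∧ b = z₀ := by
      intro a b ha hb hab
      rcases hP z₀ x a b hz₀ hxu hx hzw₀ ha hb hab with h | h <;>
      rcases hP z₁ x a b hz₁ hxu hx hzx ha hb hab with h' | h'
      · exact absurd (h'.symm.trans h) hne
      · exact Or.inl ⟨h, h'⟩
      · exact Or.inr ⟨h', h⟩
      · exact absurd (h'.symm.trans h) hne
    have hNR : ∀ v x', G.Adj u v → x' ≠ u → ¬ G.Adj u x' → G.Adj v x' →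
        x' = x ∧ (v = z₀ ∨ v = z₁) := by
      intro v x' hv hxu' hx' hvx'
      have hxx : x' = x := by
        by_cases h : v = z₀
        · exact hQ v x' z₁ x hv hxu' hx' hvx' hz₁ hxu hx hzx (h ▸ hne.symm)
        · exact hQ v x' z₀ x hv hxu' hx' hvx' hz₀ hxu hx hzw₀ h
      refine ⟨hxx, ?_⟩
      subst hxx
      rcases hK u x' v z₀ z₁ hxu.symm hv hz₀ hz₁ hvx'.symm hzw₀.symm hzx.symm with h | h | h
      exacts [Or.inl h, Or.inr h, absurd h.symm hne]
    have hrow : ∀ v z', v = z₀ ∧ z' = z₁ ∨ v = z₁ ∧ z' = z₀ →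
        ∑ j ∈ nbrs G u, edgeVal G y v j ≤ y v + y z' ∧
        ∑ j ∈ rest G u, edgeVal G y v j ≤ y v + 1 := by
      intro v z' hv
      have hz'N : z' ∈ nbrs G u := by rcases hv with ⟨-, h⟩ | ⟨-, h⟩ <;> rw [h] <;> assumption
      have hvN : v ∈ nbrs G u := by rcases hv with ⟨h, -⟩ | ⟨h, -⟩ <;> rw [h] <;> assumption
      constructor
      · rw [Finset.sum_eq_single_of_mem z' hz'N fun j hj hjz => edgeVal_of_not_adj fun h => by
          rcases hNN v j (mem_nbrs.1 hvN) (mem_nbrs.1 hj) h with h' | h' <;>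
          rcases hv with h'' | h'' <;> simp_all]
        exact edgeVal_le (add_nonneg (h0 _) (h0 _)) fun _ => le_rfl
      · rw [Finset.sum_eq_single_of_mem x hw₀R fun j hj hjz => edgeVal_of_not_adj fun h =>
          hjz (hNR v j (mem_nbrs.1 hvN) (mem_rest.1 hj).1 (mem_rest.1 hj).2 h).1]
        exact edgeVal_le (add_nonneg (h0 _) zero_le_one) fun _ => by linarith [h1 x]
    have hrow' : ∀ v ∈ nbrs G u, v ≠ z₀ → v ≠ z₁ →
        ∑ j ∈ nbrs G u, edgeVal G y v j = 0 ∧ ∑ j ∈ rest G u, edgeVal G y v j = 0 := by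
      intro v hv h2 h3
      constructor
      · refine Finset.sum_eq_zero fun j hj => edgeVal_of_not_adj fun h => ?_
        rcases hNN v j (mem_nbrs.1 hv) (mem_nbrs.1 hj) h with h' | h'
        exacts [h2 h'.1, h3 h'.1]
      · refine Finset.sum_eq_zero fun j hj => edgeVal_of_not_adj fun h => ?_
        rcases (hNR v j (mem_nbrs.1 hv) (mem_rest.1 hj).1 (mem_rest.1 hj).2 h).2 with h' | h'
        exacts [h2 h', h3 h']
    have htwo : ∀ f : V → ℝ, (∀ v ∈ nbrs G u, v ≠ z₀ → v ≠ z₁ → f v = 0) →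
        ∑ v ∈ nbrs G u, f v = f z₀ + f z₁ := by
      intro f hf
      rw [← Finset.add_sum_erase _ _ hz₀N, Finset.sum_eq_single_of_mem z₁ (by simp [hne, hz₁N])]
      intro v hv hv1
      exact hf v (Finset.mem_of_mem_erase hv) (Finset.ne_of_mem_erase hv) hv1
    rw [htwo _ fun v hv h2 h3 => (hrow' v hv h2 h3).1,
      htwo _ fun v hv h2 h3 => (hrow' v hv h2 h3).2] at hsum
    obtain ⟨r1, r2⟩ := hrow z₀ z₁ (Or.inl ⟨rfl, rfl⟩)
    obtain ⟨r3, r4⟩ := hrow z₁ z₀ (Or.inr ⟨rfl, rfl⟩)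
    have b1 := mul_sub_one_le hu hq hz₀N
    have b2 := mul_sub_one_le hu hq hz₁N
    have l0 := h1 z₀
    have l1 := h1 z₁
    have p0 := h0 z₀
    have p1 := h0 z₁
    have c1 : (q₀ - 3) * y z₀ ≤ 3 := by nlinarith
    have c2 : (q₀ - 3) * y z₁ ≤ 3 := by nlinarith
    have c3 : (q₀ - 1) * (q₀ - (nbrs G u).card) ≤ (nbrs G u).card + 3 * (y z₀ + y z₁) + 2 := by
      have h3 : (q₀ - 1) * (q₀ - (nbrs G u).card) ≤
          (qIndex G - 1) * ∑ v ∈ nbrs G u, y v := by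
        apply mul_le_mul
        · linarith
        · linarith
        · rcases hcases with h | h | h | h | h | h <;> rw [h.2.1, h.2.2.1] <;> norm_num
        · rcases hcases with h | h | h | h | h | h <;> rw [h.2.1] at hcon <;> linarith
      linarith
    rcases hcases with h | h | h | h | h | h <;> rw [h.2.1] at c1 c2 c3 <;> rw [h.2.2.1] at c3 <;>
    push_cast at c3 <;> linarith
  · -- all edges to the rest start in the same vertex
    push Not at hB
    have hNN : ∀ a b, G.Adj u a → G.Adj u b → G.Adj a b → a ≠ z₀ → b = z₀ := fun a b ha hb hab hne =>
      (hP z₀ w₀ a b hz₀ hwu₀ hw₀ hzw₀ ha hb hab).resolve_left hne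
    have hNR : ∀ v ∈ nbrs G u, v ≠ z₀ → ∀ x ∈ rest G u, ¬ G.Adj v x := fun v hv hne x hx h =>
      hne (hB v x (mem_nbrs.1 hv) (mem_rest.1 hx).1 (mem_rest.1 hx).2 h)
    have hq1 : 6 ≤ q₀ := by rcases hq₀ with ⟨-, h⟩ | ⟨-, h⟩ | ⟨-, h⟩ <;> linarith
    have hrow : ∀ v ∈ nbrs G u, v ≠ z₀ →
        ∑ j ∈ nbrs G u, edgeVal G y v j = edgeVal G y z₀ v ∧
        ∑ j ∈ rest G u, edgeVal G y v j = 0 := by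
      intro v hv hne
      constructor
      · rw [Finset.sum_eq_single_of_mem z₀ hz₀N fun j hj hjz => edgeVal_of_not_adj fun h =>
          hjz (hNN v j (mem_nbrs.1 hv) (mem_nbrs.1 hj) h hne), edgeVal_comm]
      · exact Finset.sum_eq_zero fun j hj => edgeVal_of_not_adj (hNR v hv hne j hj)
    set T := ∑ j ∈ nbrs G u, edgeVal G y z₀ j with hT
    set U := ∑ j ∈ rest G u, edgeVal G y z₀ j with hU
    have e1 : ∑ v ∈ nbrs G u, ∑ j ∈ nbrs G u, edgeVal G y v j = 2 * T := by
      rw [← Finset.add_sum_erase _ _ hz₀N, Finset.sum_congr rfl fun v hv =>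
        (hrow v (Finset.mem_of_mem_erase hv) (Finset.ne_of_mem_erase hv)).1]
      have : T = edgeVal G y z₀ z₀ + ∑ v ∈ (nbrs G u).erase z₀, edgeVal G y z₀ v :=
        (Finset.add_sum_erase _ _ hz₀N).symm
      rw [edgeVal_of_not_adj G.irrefl] at this
      linarith
    have e2 : ∑ v ∈ nbrs G u, ∑ j ∈ rest G u, edgeVal G y v j = U :=
      Finset.sum_eq_single_of_mem z₀ hz₀N fun v hv hne => (hrow v hv hne).2
    rw [e1, e2] at hsum
    have hA : ∀ a ∈ nbrs G u, a ≠ z₀ → y a ≤ 2 / (q₀ - 2) := by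
      intro a ha hne
      rw [le_div_iff₀ (by linarith)]
      have b1 := mul_sub_one_le hu hq ha
      rw [(hrow a ha hne).1, (hrow a ha hne).2] at b1
      have b2 : edgeVal G y z₀ a ≤ 1 + y a :=
        edgeVal_le (add_nonneg zero_le_one (h0 _)) fun _ => by linarith [h1 z₀]
      have b3 := h0 a
      nlinarith
    have hW : ∀ x ∈ rest G u, y x ≤ (2 * (rest G u).card - 1) / (q₀ - 1) := by
      intro x hx
      rw [le_div_iff₀ (by linarith)]
      have b1 := mul_le_of_mem_rest hq hx
      have b2 : ∑ j ∈ nbrs G u, edgeVal G y x j ≤ y x + 1 := by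
        rw [Finset.sum_eq_single_of_mem z₀ hz₀N fun j hj hjz => edgeVal_of_not_adj fun h =>
          hNR j hj hjz x hx h.symm]
        exact edgeVal_le (add_nonneg (h0 _) zero_le_one) fun _ => by linarith [h1 z₀]
      have b3 : ∑ j ∈ rest G u, edgeVal G y x j ≤ ((rest G u).card - 1) * 2 := by
        rw [← Finset.add_sum_erase _ _ hx, edgeVal_of_not_adj G.irrefl, zero_add]
        calc ∑ j ∈ (rest G u).erase x, edgeVal G y x j
            ≤ ∑ j ∈ (rest G u).erase x, (2 : ℝ) :=
              Finset.sum_le_sum fun j _ => edgeVal_le zero_le_two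
                fun _ => by linarith [h1 x, h1 j]
          _ = _ := by
            rw [Finset.sum_const, nsmul_eq_mul, Finset.card_erase_of_mem hx,
              Nat.cast_sub hρ, Nat.cast_one]
      have b4 := h0 x
      nlinarith
    have hTle : T ≤ 2 * (1 + 2 / (q₀ - 2)) :=
      sum_edgeVal_le_two (add_nonneg zero_le_one (div_nonneg zero_le_two (by linarith)))
        (fun j hj h => by linarith [h1 z₀, hA j hj h.ne'])
        (fun a ha b hb d hd h4 h5 h6 => hK u z₀ a b d hz₀.ne (mem_nbrs.1 ha)
          (mem_nbrs.1 hb) (mem_nbrs.1 hd) h4 h5 h6)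
    have hρ' : (1 : ℝ) ≤ (rest G u).card := by exact_mod_cast hρ
    have hUle : U ≤ (rest G u).card * (1 + (2 * (rest G u).card - 1) / (q₀ - 1)) := by
      calc U ≤ ∑ x ∈ rest G u, (1 + (2 * ((rest G u).card : ℝ) - 1) / (q₀ - 1)) :=
            Finset.sum_le_sum fun x hx => edgeVal_le
              (add_nonneg zero_le_one (div_nonneg (by linarith) (by linarith)))
              fun _ => by linarith [h1 z₀, hW x hx]
        _ = _ := by rw [Finset.sum_const, nsmul_eq_mul]
    have c3 : (q₀ - 1) * (q₀ - (nbrs G u).card) ≤ (nbrs G u).card + 2 * T + U := by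
      have h3 : (q₀ - 1) * (q₀ - (nbrs G u).card) ≤
          (qIndex G - 1) * ∑ v ∈ nbrs G u, y v := by
        apply mul_le_mul
        · linarith
        · linarith
        · rcases hcases with h | h | h | h | h | h <;> rw [h.2.1, h.2.2.1] <;> norm_num
        · linarith
      linarith
    rcases hcases with h | h | h | h | h | h <;> rw [h.2.1] at hTle hUle c3 <;>
    rw [h.2.2.1] at c3 <;> rw [h.2.2.2] at hUle <;> norm_num at hTle hUle c3 <;> linarith

end SmallOrders

end OuterplanarQ

/-! ### Admissibility of the extremal graph and the case analysis. -/

namespace OuterplanarQ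
open SimpleGraph

section ExtremalGraphs

variable {n t ℓ a b α r : ℕ}

theorem sum_extremalParts (a α b r : ℕ) : ∑ j, extremalParts a α b r j = a + α * b + r := by
  simp [extremalParts, Fintype.sum_sum_type]

theorem admissible_pathCone (hcard : a + α * b + r + 1 = n)
    (hfree : (copies t (pathGraph ℓ)).Free (cone (pathForest (extremalParts a α b r)))) :
    Admissible n t ℓ (pathCone a α b r) where
  card_eq := by
    simp
    omega
  connected := connected_cone _
  outerplanar := isOuterplanar_pathCone a α b r
  free := (free_congr_right (extremalIso a α b r)).2 hfree

theorem free_path_extremalParts (hab : a + b + 2 ≤ ℓ) (hba : b ≤ a) (hr : r ≤ b) :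
    (copies 1 (pathGraph ℓ)).Free (cone (pathForest (extremalParts a α b r))) := by
  classical
  refine free_path_cone fun i j => ?_
  have h1 : ∀ c, extremalParts a α b r c ≤ b + if c = Sum.inl (Sum.inl ()) then a - b else 0 := by
    rintro ((c | c) | c) <;> simp [extremalParts, hr]
    omega
  have h2 : ∀ c, extremalParts a α b r c ≤ a := by
    intro c
    have := h1 c
    split_ifs at this <;> omega
  by_cases hij : i = j
  · subst hij
    rw [Finset.pair_eq_singleton, Finset.sum_singleton]
    have := h2 i
    omega
  · rw [Finset.sum_pair hij]
    by_cases hi : i = Sum.inl (Sum.inl ())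
    · have := h2 i
      have := h1 j
      rw [if_neg fun h => hij (hi.trans h.symm)] at this
      omega
    · have := h2 j
      have := h1 i
      rw [if_neg hi] at this
      omega

theorem free_copies_extremalParts (ht : 2 ≤ t) (hℓ : 2 ≤ ℓ) (ha : a + 1 = (t - 1) * ℓ)
    (hb : b + 1 = ℓ) (hr : r ≤ b) :
    (copies t (pathGraph ℓ)).Free (cone (pathForest (extremalParts a α b r))) := by
  refine free_copies_cone (i₀ := Sum.inl (Sum.inl ())) (by omega) (by omega) ?_ ?_
  · change a < _
    omega
  · rintro ((c | c) | c) hc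
    · exact absurd rfl hc
    · change b < _
      omega
    · change r < _
      omega

/-- At this order the bound `q(G*) ≥ n` is not sufficient. The equations on the two kinds of paths
and at the apex give the sharper value needed. -/
theorem specVal_ge_of_six {x : ℝ} (hx : 1 < x)
    (h : ∑ j, (extremalParts 3 2 1 0 j : ℝ) + forestSum (extremalParts 3 2 1 0) x = specVal x) :
    63 / 10 ≤ specVal x := by
  have e := specVal_mul_pathVal hx
  have e0 := e 0 0
  have e1 := e 0 2
  have e2 := e 1 1
  have e3 := e 2 0
  have p := pathVal_pos hx
  have p0 := p 0 0
  have p1 := p 0 2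
  have p2 := p 1 1
  have p3 := p 2 0
  norm_num at e0 e1 e2 e3
  simp [forestSum, extremalParts, Fintype.sum_sum_type, Finset.sum_range_succ] at h
  by_contra hcon
  push Not at hcon
  nlinarith

theorem specVal_ge_of_eight {x : ℝ} (hx : 1 < x)
    (h : ∑ j, (extremalParts 5 2 1 0 j : ℝ) + forestSum (extremalParts 5 2 1 0) x = specVal x) :
    83 / 10 ≤ specVal x := by
  have e := specVal_mul_pathVal hx
  have e0 := e 0 0
  have e1 := e 0 4
  have e2 := e 1 3
  have e3 := e 2 2
  have e4 := e 3 1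
  have e5 := e 4 0
  have p := pathVal_pos hx
  have p0 := p 0 0
  have p1 := p 0 4
  have p2 := p 1 3
  have p3 := p 2 2
  have p4 := p 3 1
  have p5 := p 4 0
  norm_num at e0 e1 e2 e3 e4 e5
  simp [forestSum, extremalParts, Fintype.sum_sum_type, Finset.sum_range_succ] at h
  by_contra hcon
  push Not at hcon
  nlinarith

variable {V : Type*} [Fintype V] {G : SimpleGraph V}

/-- An empty path is added under the index `none`; it does not change the graph but supplies the
zero part needed for bounding single parts. -/
theorem Admissible.exists_forest (hG : Admissible n t ℓ G) (hd : ¬ NoDominating G) :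
    ∃ (k : ℕ) (m : Option (Fin k) → ℕ), m none = 0 ∧ ∑ i, m i + 1 = n ∧
      (copies t (pathGraph ℓ)).Free (cone (pathForest m)) ∧
      Nonempty (G ≃g cone (pathForest m)) := by
  unfold NoDominating at hd
  push Not at hd
  obtain ⟨u, hu⟩ := hd
  obtain ⟨k, m, ⟨e⟩⟩ := hG.outerplanar.exists_iso_cone hu
  let m' : Option (Fin k) → ℕ := fun i => i.elim 0 m
  obtain ⟨e'⟩ : Nonempty (pathForest m ≃g pathForest m') :=
    nonempty_pathForest_iso_of_sum_min_eq fun h => by simp [m', Fintype.sum_option]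
  have e'' : G ≃g cone (pathForest m') := e.trans (coneIso e')
  refine ⟨k, m', rfl, ?_, (free_congr_right e'').1 hG.free, ⟨e''⟩⟩
  rw [← hG.card_eq, Fintype.card_congr e''.toEquiv, Fintype.card_option, Fintype.card_sigma]
  simp

omit [Fintype V] in
theorem noK23_of_isOuterplanar (h : IsOuterplanar G) : NoK23 G :=
  fun _ _ _ _ _ hab h1 h2 h3 h4 h5 h6 => h.no_K23 hab h1 h2 h3 h4 h5 h6

/-- The conclusion about one competitor. -/
theorem le_and_eq_iff_of_lt_or_iso
    (h : qIndex G < qIndex (pathCone a α b r) ∨ Nonempty (G ≃g pathCone a α b r)) :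
    qIndex G ≤ qIndex (pathCone a α b r) ∧
      (qIndex G = qIndex (pathCone a α b r) ↔ Nonempty (G ≃g pathCone a α b r)) := by
  rcases h with h | h
  · refine ⟨h.le, fun h' => absurd h' h.ne, fun ⟨e⟩ => qIndex_congr e⟩
  · obtain ⟨e⟩ := h
    exact ⟨(qIndex_congr e).le, fun _ => ⟨e⟩, fun _ => qIndex_congr e⟩

theorem exists_specVal_pathCone (hn : 6 ≤ n) (hcard : a + α * b + r + 1 = n) :
    ∃ x : ℝ, 1 < x ∧ (n : ℝ) - 4 ≤ x ∧ (n : ℝ) ≤ specVal x ∧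
      qIndex (pathCone a α b r) = specVal x ∧
      ∑ j, (extremalParts a α b r j : ℝ) + forestSum (extremalParts a α b r) x = specVal x := by
  have hsum : ∑ j, extremalParts a α b r j + 1 = n := by rw [sum_extremalParts, hcard]
  obtain ⟨x, hx, hnx, h⟩ := exists_specVal hn hsum
  refine ⟨x, hx, hnx, ?_, ?_, h⟩
  · have := le_specVal hx h
    have h2 : (n : ℝ) = ∑ j, (extremalParts a α b r j : ℝ) + 1 := by
      rw [← hsum]
      push_cast
      rfl
    rwa [h2]
  · rw [qIndex_congr (extremalIso a α b r), qIndex_cone_eq hx h]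

theorem lt_or_iso_of_forest {ι : Type*} [Fintype ι] {m : ι → ℕ} {x : ℝ} (hx : 1 < x)
    (hq : qIndex (pathCone a α b r) = specVal x)
    (hs : ∑ j, (extremalParts a α b r j : ℝ) + forestSum (extremalParts a α b r) x = specVal x)
    (hsum : a + α * b + r = ∑ i, m i) (e : G ≃g cone (pathForest m))
    (h : ∑ j, pathWeight x (extremalParts a α b r j) < ∑ i, pathWeight x (m i) ∨
      Nonempty (pathForest m ≃g pathForest (extremalParts a α b r))) :
    qIndex G < qIndex (pathCone a α b r) ∨ Nonempty (G ≃g pathCone a α b r) := by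
  rcases h with h | ⟨⟨e'⟩⟩
  · left
    rw [hq, qIndex_congr e]
    exact qIndex_cone_lt_of_weight_lt hx (by rw [← hsum, sum_extremalParts]) hs h
  · exact Or.inr ⟨(e.trans (coneIso e')).trans (extremalIso a α b r).symm⟩

-- When `G*` is a star, its weight sum is the largest possible by concavity, so the strict
-- alternative is void. Since `x` is free here, no lower bound on `n` is needed.
omit [Fintype V] in
theorem iso_of_forest_of_small_parts {ι : Type*} [Fintype ι] {m : ι → ℕ} {x : ℝ} (hx : 1 < x)
    (ha : a ≤ 1) (hb : b ≤ 1) (hr : r ≤ 1)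
    (hsum : a + α * b + r = ∑ i, m i) (e : G ≃g cone (pathForest m))
    (h : ∑ j, pathWeight x (extremalParts a α b r j) < ∑ i, pathWeight x (m i) ∨
      Nonempty (pathForest m ≃g pathForest (extremalParts a α b r))) :
    Nonempty (G ≃g pathCone a α b r) := by
  rcases h with h | ⟨⟨e'⟩⟩
  · exfalso
    have h1 : ∑ i, pathWeight x (m i) ≤ ∑ i, (m i : ℝ) * pathWeight x 1 := by
      refine Finset.sum_le_sum fun i _ => ?_
      rcases Nat.eq_zero_or_pos (m i) with hi | hi
      · simp [hi, pathWeight_zero]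
      · simpa using mul_pathWeight_le hx hi
    have h2 : ∀ c : ℕ, c ≤ 1 → pathWeight x c = c * pathWeight x 1 := by
      intro c hc
      obtain rfl | rfl : c = 0 ∨ c = 1 := by omega
      · simp [pathWeight_zero]
      · simp
    have h3 : ∑ j, pathWeight x (extremalParts a α b r j) =
        ∑ j, (extremalParts a α b r j : ℝ) * pathWeight x 1 := by
      refine Finset.sum_congr rfl fun j _ => h2 _ ?_
      rcases j with (j | j) | j <;> simpa [extremalParts]
    rw [← Finset.sum_mul] at h1 h3
    have h4 : ∑ j, (extremalParts a α b r j : ℝ) = ∑ i, (m i : ℝ) := by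
      rw [← sum_extremalParts] at hsum
      exact_mod_cast hsum
    rw [h4] at h3
    linarith
  · exact ⟨(e.trans (coneIso e')).trans (extremalIso a α b r).symm⟩

theorem Admissible.nonempty_of_pos (hG : Admissible n t ℓ G) (hn : 0 < n) : Nonempty V :=
  Fintype.card_pos_iff.1 (by rw [hG.card_eq]; exact hn)

theorem lt_or_iso_one_path (hℓ : 4 ≤ ℓ) (hab : a + b + 2 = ℓ) (hba : b ≤ a) (hab' : a ≤ b + 1)
    (hα : 0 < α) (hr : r ≤ b) (hcard : a + α * b + r + 1 = n) (hn : ℓ ≤ n)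
    (hlarge : b * (b - 1) + (a + b) + 1 ≤ n) (h60 : 5 ≤ ℓ → 60 ≤ n ∧ 28 * b + 3 ≤ n)
    (hG : Admissible n 1 ℓ G) :
    qIndex G < qIndex (pathCone a α b r) ∨ Nonempty (G ≃g pathCone a α b r) := by
  have := hG.nonempty_of_pos (by omega)
  rcases Nat.lt_or_ge ℓ 5 with h5 | h5
  · right
    obtain rfl : ℓ = 4 := by omega
    obtain rfl : b = 1 := by omega
    by_cases hd : NoDominating G
    · exact absurd hG.free (not_free_path_four hG.connected hd)
    · obtain ⟨k, m, hm0, hsum, hfree, ⟨e⟩⟩ := hG.exists_forest hd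
      -- The value 27 is `28 b - 1` for `b = 1`, the least one allowed by the numerical estimate.
      exact iso_of_forest_of_small_parts (x := 27) (by norm_num) (by omega) le_rfl hr (by omega) e
        (weight_lt_or_iso_one_path (by norm_num) one_pos hab hba hab' hα hr (by omega) ⟨none, hm0⟩
          (by omega) (by omega) (by norm_num) hfree)
  · obtain ⟨h60, h28⟩ := h60 h5
    obtain ⟨x, hx, hnx, hns, hq, hs⟩ := exists_specVal_pathCone (by omega) hcard
    by_cases hd : NoDominating G
    · left
      rw [hq]
      exact (qIndex_lt_card hG.card_eq (by omega) hd
        (noK23_of_isOuterplanar hG.outerplanar)).trans_le hns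
    · obtain ⟨k, m, hm0, hsum, hfree, ⟨e⟩⟩ := hG.exists_forest hd
      have h28' : 28 * (b : ℝ) + 3 ≤ n := by exact_mod_cast h28
      exact lt_or_iso_of_forest hx hq hs (by omega) e
        (weight_lt_or_iso_one_path hx (by omega) hab hba hab' hα hr (by omega) ⟨none, hm0⟩
          (by omega) (by omega) (by linarith) hfree)

theorem lt_or_iso_many_paths (ht : 2 ≤ t) (hb : 0 < b) (hbℓ : b + 1 = ℓ)
    (ha : a + 1 = (t - 1) * ℓ) (hα : 0 < α) (hr : r < b) (hcard : a + α * b + r + 1 = n)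
    (hn : t * ℓ ≤ n) (hlarge : b * (b - 1) + (a + b) + 1 ≤ n) (h60 : 3 ≤ ℓ → 60 ≤ n)
    (hG : Admissible n t ℓ G) :
    qIndex G < qIndex (pathCone a α b r) ∨ Nonempty (G ≃g pathCone a α b r) := by
  have h4n : 4 ≤ n := le_trans (Nat.mul_le_mul ht (by omega : 2 ≤ ℓ)) hn
  have := hG.nonempty_of_pos (by omega)
  have hab : a + b + 2 = t * ℓ := by
    obtain ⟨v, rfl⟩ : ∃ v, t = v + 1 := ⟨t - 1, by omega⟩
    rw [Nat.add_sub_cancel] at ha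
    have : (v + 1) * ℓ = v * ℓ + ℓ := by ring
    omega
  by_cases hstar : ℓ = 2 ∧ t = 2
  · right
    obtain ⟨rfl, rfl⟩ := hstar
    by_cases hd : NoDominating G
    · exact absurd hG.free (not_free_two_edges hG.connected hd)
    · obtain ⟨k, m, hm0, hsum, hfree, ⟨e⟩⟩ := hG.exists_forest hd
      exact iso_of_forest_of_small_parts (x := 2) (by norm_num) (by omega) (by omega) (by omega)
        (by omega) e
        (weight_lt_or_iso_many_paths (by norm_num) ht hb hbℓ ha hα hr.le (by omega) ⟨none, hm0⟩
          (by omega) (by omega) (fun h => by omega) hfree)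
  · have h6 : 6 ≤ n := by
      rcases Nat.lt_or_ge ℓ 3 with h3 | h3
      · have : 3 ≤ t := by omega
        exact le_trans (Nat.mul_le_mul this (by omega : 2 ≤ ℓ)) hn
      · have := h60 h3
        omega
    obtain ⟨x, hx, hnx, hns, hq, hs⟩ := exists_specVal_pathCone h6 hcard
    by_cases hd : NoDominating G
    · left
      have hK := noK23_of_isOuterplanar hG.outerplanar
      rw [hq]
      rcases Nat.lt_or_ge n 9 with h9 | h9
      · have h3 : ℓ = 2 := by
          by_contra h
          have := h60 (by omega)
          omega
        subst h3
        obtain rfl : b = 1 := by omega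
        -- For `ℓ = 2` the extremal forest is one path and isolated vertices, and `2 t ≤ n ≤ 8` with
        -- `t ≠ 2` leaves `t = 3` and `t = 4`.
        obtain rfl : r = 0 := by omega
        have ht' : t = 3 ∨ t = 4 := by omega
        rcases ht' with rfl | rfl
        · have hn' : n = 6 ∨ n = 7 ∨ n = 8 := by omega
          rcases hn' with rfl | rfl | rfl
          · obtain rfl : a = 3 := by omega
            obtain rfl : α = 2 := by omega
            exact (qIndex_lt_of_three_matching_free hG.card_eq hG.connected hd hK hG.free
              (Or.inl ⟨rfl, rfl⟩)).trans_le (specVal_ge_of_six hx hs)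
          · exact (qIndex_lt_of_three_matching_free hG.card_eq hG.connected hd hK hG.free
              (Or.inr (Or.inl ⟨rfl, rfl⟩))).trans_le (by exact_mod_cast hns)
          · exact (qIndex_lt_of_three_matching_free hG.card_eq hG.connected hd hK hG.free
              (Or.inr (Or.inr ⟨rfl, rfl⟩))).trans_le (by exact_mod_cast hns)
        · obtain rfl : n = 8 := by omega
          obtain rfl : a = 5 := by omega
          obtain rfl : α = 2 := by omega
          exact (qIndex_lt_of_card_eq_eight hG.card_eq hd hK).trans_le (specVal_ge_of_eight hx hs)
      · exact (qIndex_lt_card hG.card_eq h9 hd hK).trans_le hns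
    · obtain ⟨k, m, hm0, hsum, hfree, ⟨e⟩⟩ := hG.exists_forest hd
      refine lt_or_iso_of_forest hx hq hs (by omega) e
        (weight_lt_or_iso_many_paths hx ht hb hbℓ ha hα hr.le (by omega) ⟨none, hm0⟩
          (by omega) (by omega) (fun h => ?_) hfree)
      have : (60 : ℝ) ≤ n := by exact_mod_cast h60 (by omega)
      linarith

theorem natCast_le_sqrt (k : ℕ) : (k : ℝ) ≤ √((k : ℝ) * (k + 1)) := by
  apply Real.le_sqrt_of_sq_le
  nlinarith [Nat.cast_nonneg (α := ℝ) k]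

end ExtremalGraphs

end OuterplanarQ

/-! ### Translation of the parameters in the theorem. -/

theorem theorem2 (n t ℓ : ℕ) (hn : t * ℓ ≤ n) :
    (t = 1 → 4 ≤ ℓ →
      max ((((ℓ - 3) / 2 : ℕ) : ℝ) ^ 2 + (((ℓ - 3) / 2 : ℕ) : ℝ) + (ℓ : ℝ) - 1)
          (30 * (((ℓ - 3) / 2 : ℕ) : ℝ) +
            30 * √((((ℓ - 3) / 2 : ℕ) : ℝ) * ((((ℓ - 3) / 2 : ℕ) : ℝ) + 1))) ≤ (n : ℝ) →
      ∀ a b α r : ℕ,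
        a = ⌈((ℓ : ℝ) - 2) / 2⌉₊ → b = ⌊((ℓ : ℝ) - 2) / 2⌋₊ →
        α = (n - ℓ + 1) / b + 1 → r = n - ℓ + 1 - (α - 1) * b →
        OuterplanarQ.Admissible n t ℓ (OuterplanarQ.pathCone a α b r) ∧
        ∀ (V : Type*) [Fintype V] (G : SimpleGraph V), OuterplanarQ.Admissible n t ℓ G →
          OuterplanarQ.qIndex G ≤ OuterplanarQ.qIndex (OuterplanarQ.pathCone a α b r) ∧
          (OuterplanarQ.qIndex G = OuterplanarQ.qIndex (OuterplanarQ.pathCone a α b r) ↔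
            Nonempty (G ≃g OuterplanarQ.pathCone a α b r))) ∧
    (2 ≤ t → 2 ≤ ℓ →
      max ((ℓ : ℝ) ^ 2 + ((t : ℝ) - 3) * (ℓ : ℝ) + 1)
          (30 * ((ℓ : ℝ) - 2) + 30 * √(((ℓ : ℝ) - 2) * ((ℓ : ℝ) - 1))) ≤ (n : ℝ) →
      ∀ a b α r : ℕ,
        a = t * ℓ - ℓ - 1 → b = ℓ - 1 →
        α = (n - t + 1) / (ℓ - 1) - t + 1 → r = n - t * ℓ + 1 - (α - 1) * (ℓ - 1) →
        OuterplanarQ.Admissible n t ℓ (OuterplanarQ.pathCone a α b r) ∧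
        ∀ (V : Type*) [Fintype V] (G : SimpleGraph V), OuterplanarQ.Admissible n t ℓ G →
          OuterplanarQ.qIndex G ≤ OuterplanarQ.qIndex (OuterplanarQ.pathCone a α b r) ∧
          (OuterplanarQ.qIndex G = OuterplanarQ.qIndex (OuterplanarQ.pathCone a α b r) ↔
            Nonempty (G ≃g OuterplanarQ.pathCone a α b r))) := by
  open OuterplanarQ in
  refine ⟨?_, ?_⟩
  · rintro rfl hℓ hmax a b α r rfl rfl rfl rfl
    rw [one_mul] at hn
    obtain ⟨f, hf⟩ : ∃ f, f = (ℓ - 3) / 2 := ⟨_, rfl⟩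
    obtain ⟨c, hc⟩ : ∃ c, c = ℓ - 2 := ⟨_, rfl⟩
    have hcℓ : (ℓ : ℝ) - 2 = c := by
      rw [hc, Nat.cast_sub (by omega)]
      norm_num
    have hfloor : ⌊((ℓ : ℝ) - 2) / 2⌋₊ = c / 2 := by
      rw [hcℓ]
      exact_mod_cast Nat.floor_div_eq_div c 2
    have hceil : ⌈((ℓ : ℝ) - 2) / 2⌉₊ = (c + 1) / 2 := by
      rw [hcℓ]
      apply le_antisymm
      · rw [Nat.ceil_le, div_le_iff₀ two_pos]
        exact_mod_cast (by omega : c ≤ (c + 1) / 2 * 2)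
      · obtain ⟨k, hk⟩ : ∃ k, (c + 1) / 2 = k + 1 := ⟨(c + 1) / 2 - 1, by omega⟩
        rw [hk, Nat.add_one_le_iff, Nat.lt_ceil, lt_div_iff₀ two_pos]
        exact_mod_cast (by omega : k * 2 < c)
    rw [hfloor, hceil]
    rw [← hf] at hmax
    have h1 := (le_max_left _ _).trans hmax
    have h2 := (le_max_right _ _).trans hmax
    have h3 := natCast_le_sqrt f
    have h1' : f * f + f + ℓ ≤ n + 1 := by
      have : (f : ℝ) * f + f + ℓ ≤ n + 1 := by nlinarith
      exact_mod_cast this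
    -- From `√(f (f + 1)) ≥ f`. For `ℓ ≥ 5` one has `f ≥ 1` and `b ≤ f + 1`, so `28 b + 3 ≤ 28 f +
    -- 31 ≤ 60 f ≤ n`.
    have h2' : 60 * f ≤ n := by
      have : 60 * (f : ℝ) ≤ n := by linarith
      exact_mod_cast this
    set b := c / 2 with hb
    have hb0 : 0 < b := by omega
    have hdiv := Nat.div_add_mod' (n - ℓ + 1) b
    have hmod := Nat.mod_lt (n - ℓ + 1) hb0
    rw [Nat.add_sub_cancel]
    generalize (n - ℓ + 1) / b = k at *
    have hr : n - ℓ + 1 - k * b = (n - ℓ + 1) % b := by omega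
    rw [hr]
    have hcard : (c + 1) / 2 + (k + 1) * b + (n - ℓ + 1) % b + 1 = n := by
      rw [add_mul, one_mul]
      omega
    have hbb : b * (b - 1) ≤ f * f + f := by
      calc b * (b - 1) ≤ (f + 1) * f := Nat.mul_le_mul (by omega) (by omega)
        _ = f * f + f := by ring
    refine ⟨admissible_pathCone hcard (free_path_extremalParts (by omega) (by omega) hmod.le), ?_⟩
    intro V _ G hG
    exact le_and_eq_iff_of_lt_or_iso (lt_or_iso_one_path hℓ (by omega) (by omega) (by omega)
      (by omega) hmod.le hcard hn (by omega) (fun h5 => by omega) hG)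
  · rintro ht hℓ hmax a b α r rfl rfl rfl rfl
    obtain ⟨c, hc⟩ : ∃ c, ℓ = c + 2 := ⟨ℓ - 2, by omega⟩
    have hcℓ : (ℓ : ℝ) = c + 2 := by
      rw [hc]
      push_cast
      rfl
    have h1 := (le_max_left _ _).trans hmax
    have h2 := (le_max_right _ _).trans hmax
    have e1 : (ℓ : ℝ) - 2 = c := by rw [hcℓ]; ring
    have e2 : (ℓ : ℝ) - 1 = c + 1 := by rw [hcℓ]; ring
    rw [e1, e2] at h2
    have h3 := natCast_le_sqrt c
    have h2' : 60 * c ≤ n := by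
      have : 60 * (c : ℝ) ≤ n := by linarith
      exact_mod_cast this
    -- With `c = ℓ - 2`, the identity `ℓ² + (t - 3) ℓ + 1 = (ℓ - 1) (ℓ - 2) + t ℓ - 1` turns the
    -- hypothesis into the size condition on the partition.
    have h1' : (c + 1) * c + t * ℓ ≤ n + 1 := by
      have : ((c : ℝ) + 1) * c + t * ℓ ≤ n + 1 := by
        rw [hcℓ] at h1 ⊢
        nlinarith
      exact_mod_cast this
    have hb : ℓ - 1 = c + 1 := by omega
    rw [hb]
    obtain ⟨v, rfl⟩ : ∃ v, t = v + 2 := ⟨t - 2, by omega⟩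
    have ht1 : (v + 2 - 1) * ℓ = v * ℓ + ℓ := by
      rw [show v + 2 - 1 = v + 1 by omega]
      ring
    have ht2 : (v + 2) * ℓ = v * ℓ + ℓ + ℓ := by ring
    have ht3 : (v + 2) * (c + 1) + (v + 2) = (v + 2) * ℓ := by
      rw [hc]
      ring
    obtain ⟨Z, hZ⟩ : ∃ Z, Z = n - (v + 2) * ℓ + 1 := ⟨_, rfl⟩
    -- Since `n - t + 1 = Z + t (ℓ - 1)`, subtracting `t` from the quotient leaves that of `Z`, so
    -- `α - 1` and `r` are the quotient and remainder of `Z` by `ℓ - 1`.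
    have hα : (n - (v + 2) + 1) / (c + 1) = Z / (c + 1) + (v + 2) := by
      rw [← Nat.add_mul_div_right _ _ (by omega : 0 < c + 1)]
      congr 1
      omega
    rw [hα]
    have hdiv := Nat.div_add_mod' Z (c + 1)
    have hmod := Nat.mod_lt Z (by omega : 0 < c + 1)
    generalize Z / (c + 1) = k at *
    rw [Nat.add_sub_cancel, Nat.add_sub_cancel, ← hZ]
    have hr : Z - k * (c + 1) = Z % (c + 1) := by omega
    rw [hr]
    have hcard : (v + 2) * ℓ - ℓ - 1 + (k + 1) * (c + 1) + Z % (c + 1) + 1 = n := by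
      rw [add_mul k, one_mul]
      omega
    refine ⟨admissible_pathCone hcard
      (free_copies_extremalParts ht hℓ (by omega) (by omega) (by omega)), ?_⟩
    intro V _ G hG
    refine le_and_eq_iff_of_lt_or_iso (lt_or_iso_many_paths ht (by omega) (by omega) (by omega)
      (by omega) hmod hcard hn ?_ (fun h5 => by omega) hG)
    rw [Nat.add_sub_cancel]
    omega
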